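/- Let $n\ge 0$ and let $R=(R^{ij}_{mn})$ be an invertible complex matrix on $\mathbb C^n\otimes\mathbb C^n$ satisfying the Yang–Baxter equation $R_{12}R_{13}R_{23}=R_{23}R_{13}R_{12}$. Let $Y_+$ be the bialgebra over $\mathbb C$ generated by $U=(u^i_j)$ and the column $F=(F^i)$ with relations $R_{12}U_1U_2=U_2U_1R_{12}$, $F_2U_1=R_{12}U_1F_2$, and let $Y_-$ be the bialgebra generated by $T=(t^i_j)$ and the row $E=(E_i)$ with relations $R_{12}T_1T_2=T_2T_1R_{12}$, $E_1T_2=T_2E_1R_{12}$; the coalgebra structures are $$\Delta(t^i_j)=\sum_a t^i_a\otimes t^a_j,\quad \Delta(E_i)=\sum_a E_a\otimes t^a_i+1\otimes E_i,\quad \varepsilon(t^i_j)=\delta^i_j,\ \varepsilon(E_i)=0,$$ $$\Delta(u^i_j)=\sum_a u^i_a\otimes u^a_j,\quad \Delta(F^i)=F^i\otimes 1+\sum_a u^i_a\otimes F^a,\quad \varepsilon(u^i_j)=\delta^i_j,\ \varepsilon(F^i)=0.$$ Let $Y$ be the Yang–Baxter bialgebra generated by $T,E,U,F$ with all these relations,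 the cross relations $$R_{12}U_1T_2=T_2U_1R_{12},\quad T_2F_1=R_{12}F_1T_2,\quad E_jF^i-F^iE_j=t^i_j-u^i_j,\quad U_1E_2=E_2U_1R_{12},$$ and the same formulas for $\Delta$ and $\varepsilon$. Then: (a) There is exactly one bilinear form $\langle\,,\rangle: Y_+\times Y_-\to\mathbb C$ which is a skew pairing, i.e. $\langle xy,a\rangle=\langle x\otimes y,\Delta(a)\rangle$, $\langle\Delta(x),a\otimes b\rangle=\langle x,ba\rangle$, $\langle 1,a\rangle=\varepsilon(a)$, $\langle x,1\rangle=\varepsilon(x)$, and has the values $\langle U_1,T_2\rangle=R_{12}$, $\langle 1,T\rangle=\langle U,1\rangle=\mathbf 1$, $\langle F^i,E_j\rangle=\delta^i_j$, all other pairings among the generators and $1$ (except $\langle 1,1\rangle=1$) being zero. (b) There is exactly one bilinear form $\langle\,,\rangle^-: Y_+\times Y_-\to\mathbb C$ with $\langle xy,a\rangle^-=\langle y\otimes x,\Delta(a)\rangle^-$, $\langle\Delta(x),a\otimes b\rangle^-=\langle x,ab\rangle^-$, $\langle 1,a\rangle^-=\varepsilon(a)$, $\langle x,1\rangle^-=\varepsilon(x)$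 and the values $\langle U_1,T_2\rangle^-=R_{12}^{-1}$, $\langle 1,T\rangle^-=\langle U,1\rangle^-=\mathbf 1$, $\langle F^i,E_j\rangle^-=-\delta^i_j$, all other pairings among the generators and $1$ (except $\langle 1,1\rangle^-=1$) being zero. (c) These forms are convolution inverse to each other: $\langle x_{(1)},a_{(1)}\rangle^-\langle x_{(2)},a_{(2)}\rangle=\langle x_{(1)},a_{(1)}\rangle\langle x_{(2)},a_{(2)}\rangle^-=\varepsilon(x)\varepsilon(a)$. (d) With the left action $x\triangleright a=\langle x_{(1)},a_{(1)}\rangle^-\,a_{(2)}\,\langle x_{(2)},a_{(3)}\rangle$ of $Y_+$ on $Y_-$ and the right action $x\triangleleft a=\langle x_{(1)},a_{(1)}\rangle^-\,x_{(2)}\,\langle x_{(3)},a_{(2)}\rangle$ of $Y_-$ on $Y_+$, $(Y_-,Y_+)$ is a matched pair of bialgebras: $Y_-$ is a left $Y_+$-module coalgebra, $Y_+$ is a right $Y_-$-module coalgebra, and $$1\triangleleft a=\varepsilon(a)1,\quad (xy)\triangleleft a=(x\triangleleft(y_{(1)}\triangleright a_{(1)}))(y_{(2)}\triangleleft a_{(2)}),$$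 $$x\triangleright 1=\varepsilon(x)1,\quad x\triangleright(ab)=(x_{(1)}\triangleright a_{(1)})((x_{(2)}\triangleleft a_{(2)})\triangleright b),$$ $$x_{(1)}\triangleleft a_{(1)}\otimes x_{(2)}\triangleright a_{(2)}=x_{(2)}\triangleleft a_{(2)}\otimes x_{(1)}\triangleright a_{(1)}.$$ (e) The double crossproduct of this matched pair, i.e. the tensor product coalgebra $Y_-\otimes Y_+$ with unit $1\otimes 1$ and product $(a\otimes x)(b\otimes y)=a(x_{(1)}\triangleright b_{(1)})\otimes(x_{(2)}\triangleleft b_{(2)})y$, is the bialgebra $Y$: there are injective bialgebra homomorphisms $j_-:Y_-\to Y$ and $j_+:Y_+\to Y$ sending generators to the generators of the same name (so $Y_\pm$ embed as sub-bialgebras), and $a\otimes x\mapsto j_-(a)j_+(x)$ is a bijection $Y_-\otimes Y_+\to Y$ which is an isomorphism of coalgebras and carries the unit and product above to those of $Y$. In particular the images of $t^i_j\otimes1$, $E_i\otimes 1$, $1\otimes u^i_j$, $1\otimes F^i$ satisfy the cross relations. -/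

import Mathlib

open scoped TensorProduct

noncomputable section

namespace YangBaxter

/-! ### Generalities on pairings, matched pairs and double crossproducts

Throughout, `k` is a commutative ring, `H` and `A` are bialgebras over `k`; in the application
`H` is the bialgebra generated by `U, F` and `A` the bialgebra generated by `T, E`. -/

section Pairings

variable {k H A : Type*} [CommRing k] [Ring H] [Bialgebra k H] [Ring A] [Bialgebra k A]

/-- For bilinear forms `P`, `Q` on `H × A`, the bilinear form on `(H ⊗ H) × (A ⊗ A)` with
`⟨x ⊗ y, a ⊗ b⟩ = P(x, a) Q(y, b)`. -/
def tensorForm (P Q : H →ₗ[k] A →ₗ[k] k) : H ⊗[k] H →ₗ[k] A ⊗[k] A →ₗ[k] k :=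
  (TensorProduct.map₂ P Q).compr₂ (LinearMap.mul' k k)

/-- A skew pairing of bialgebras: `⟨xy, a⟩ = ⟨x ⊗ y, Δ a⟩`, `⟨Δ x, a ⊗ b⟩ = ⟨x, ba⟩`,
`⟨1, a⟩ = ε(a)`, `⟨x, 1⟩ = ε(x)`. -/
structure IsSkewPairing (P : H →ₗ[k] A →ₗ[k] k) : Prop where
  mul_left : ∀ x y a, P (x * y) a = tensorForm P P (x ⊗ₜ y) (Coalgebra.comul (R := k) a)
  mul_right : ∀ x a b, tensorForm P P (Coalgebra.comul (R := k) x) (a ⊗ₜ b) = P x (b * a)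
  one_left : ∀ a, P 1 a = Coalgebra.counit (R := k) a
  one_right : ∀ x, P x 1 = Coalgebra.counit (R := k) x

/-- The mirror image of a skew pairing (both multiplicativity rules in the opposite order), the
law of convolution inverses of skew pairings: `⟨xy, a⟩ = ⟨y ⊗ x, Δ a⟩`,
`⟨Δ x, a ⊗ b⟩ = ⟨x, ab⟩`, `⟨1, a⟩ = ε(a)`, `⟨x, 1⟩ = ε(x)`. -/
structure IsOppositeSkewPairing (P : H →ₗ[k] A →ₗ[k] k) : Prop where
  mul_left : ∀ x y a, P (x * y) a = tensorForm P P (y ⊗ₜ x) (Coalgebra.comul (R := k) a)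
  mul_right : ∀ x a b, tensorForm P P (Coalgebra.comul (R := k) x) (a ⊗ₜ b) = P x (a * b)
  one_left : ∀ a, P 1 a = Coalgebra.counit (R := k) a
  one_right : ∀ x, P x 1 = Coalgebra.counit (R := k) x

/-- `Q` is the convolution inverse of `P`:
`Q(x₁, a₁) P(x₂, a₂) = P(x₁, a₁) Q(x₂, a₂) = ε(x) ε(a)`. -/
def IsConvolutionInverse (Q P : H →ₗ[k] A →ₗ[k] k) : Prop :=
  ∀ x a,
    tensorForm Q P (Coalgebra.comul (R := k) x) (Coalgebra.comul (R := k) a) =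
        Coalgebra.counit (R := k) x * Coalgebra.counit (R := k) a ∧
    tensorForm P Q (Coalgebra.comul (R := k) x) (Coalgebra.comul (R := k) a) =
        Coalgebra.counit (R := k) x * Coalgebra.counit (R := k) a

/-- `a ↦ f(a₁) a₂`, linearly in the functional `f`. -/
def contractFirst : (A →ₗ[k] k) →ₗ[k] Module.End k A where
  toFun f := (TensorProduct.lid k A).toLinearMap ∘ₗ f.rTensor A ∘ₗ Coalgebra.comul
  map_add' f g := by
    rw [LinearMap.rTensor_add, LinearMap.add_comp, LinearMap.comp_add]
  map_smul' c f := by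
    rw [LinearMap.rTensor_smul, LinearMap.smul_comp, LinearMap.comp_smul, RingHom.id_apply]

/-- `a ↦ a₁ f(a₂)`, linearly in the functional `f`. -/
def contractLast : (A →ₗ[k] k) →ₗ[k] Module.End k A where
  toFun f := (TensorProduct.rid k A).toLinearMap ∘ₗ f.lTensor A ∘ₗ Coalgebra.comul
  map_add' f g := by
    rw [LinearMap.lTensor_add, LinearMap.add_comp, LinearMap.comp_add]
  map_smul' c f := by
    rw [LinearMap.lTensor_smul, LinearMap.smul_comp, LinearMap.comp_smul, RingHom.id_apply]

/-- The map `H → End A`, `x ↦ (a ↦ Q(x₁, a₁) a₂ P(x₂, a₃))`. -/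
def twoSided (Q P : H →ₗ[k] A →ₗ[k] k) : H →ₗ[k] A →ₗ[k] A :=
  TensorProduct.lift ((LinearMap.mul k (Module.End k A)).compl₁₂
    (contractFirst ∘ₗ Q) (contractLast ∘ₗ P)) ∘ₗ Coalgebra.comul

/-- The left action `x ▷ a = Q(x₁, a₁) a₂ P(x₂, a₃)` of `H` on `A` attached to a skew pairing `P`
with convolution inverse `Q`. -/
def leftAction (Q P : H →ₗ[k] A →ₗ[k] k) : H →ₗ[k] A →ₗ[k] A := twoSided Q P

/-- The right action `x ◁ a = Q(x₁, a₁) x₂ P(x₃, a₂)` of `A` on `H` attached to a skew pairing `P`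
with convolution inverse `Q`; `rightAction Q P x a` is `x ◁ a`. -/
def rightAction (Q P : H →ₗ[k] A →ₗ[k] k) : H →ₗ[k] A →ₗ[k] H := (twoSided Q.flip P.flip).flip

/-- `(A, H)` is a matched pair of bialgebras with respect to a left action `l x a = x ▷ a` of `H`
on `A` and a right action `r x a = x ◁ a` of `A` on `H`: `A` is a left `H`-module coalgebra,
`H` is a right `A`-module coalgebra, and
`1 ◁ a = ε(a) 1`, `(xy) ◁ a = (x ◁ (y₁ ▷ a₁)) (y₂ ◁ a₂)`,
`x ▷ 1 = ε(x) 1`, `x ▷ (ab) = (x₁ ▷ a₁) ((x₂ ◁ a₂) ▷ b)`,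
`(x₁ ◁ a₁) ⊗ (x₂ ▷ a₂) = (x₂ ◁ a₂) ⊗ (x₁ ▷ a₁)`. -/
structure IsMatchedPair (l : H →ₗ[k] A →ₗ[k] A) (r : H →ₗ[k] A →ₗ[k] H) : Prop where
  left_one : ∀ a, l 1 a = a
  left_mul : ∀ x y a, l (x * y) a = l x (l y a)
  right_one : ∀ x, r x 1 = x
  right_mul : ∀ x a b, r x (a * b) = r (r x a) b
  left_comul : ∀ x a, Coalgebra.comul (R := k) (l x a) =
    TensorProduct.map₂ l l (Coalgebra.comul x) (Coalgebra.comul a)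
  left_counit : ∀ x a, Coalgebra.counit (R := k) (l x a) =
    Coalgebra.counit (R := k) x * Coalgebra.counit (R := k) a
  right_comul : ∀ x a, Coalgebra.comul (R := k) (r x a) =
    TensorProduct.map₂ r r (Coalgebra.comul x) (Coalgebra.comul a)
  right_counit : ∀ x a, Coalgebra.counit (R := k) (r x a) =
    Coalgebra.counit (R := k) x * Coalgebra.counit (R := k) a
  one_right : ∀ a, r 1 a = Coalgebra.counit (R := k) a • 1
  mul_right : ∀ x y a, r (x * y) a =
    TensorProduct.lift (LinearMap.mul k H ∘ₗ r x)
      (TensorProduct.map₂ l r (Coalgebra.comul y) (Coalgebra.comul a))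
  one_left : ∀ x, l x 1 = Coalgebra.counit (R := k) x • 1
  mul_left : ∀ x a b, l x (a * b) =
    TensorProduct.lift ((LinearMap.mul k A).compl₂ (l.flip b))
      (TensorProduct.map₂ l r (Coalgebra.comul x) (Coalgebra.comul a))
  compat : ∀ x a, TensorProduct.map₂ r l (Coalgebra.comul (R := k) x) (Coalgebra.comul a) =
    TensorProduct.comm k A H (TensorProduct.map₂ l r (Coalgebra.comul x) (Coalgebra.comul a))

/-- `D`, with the identification `θ : A ⊗ H ≃ D`, is the double crossproduct bialgebra `A ⋈ H` of
a matched pair with actions `l`, `r`. The double crossproduct is the tensor product coalgebra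
`A ⊗ H` (so `θ` is an isomorphism of coalgebras) with unit `1 ⊗ 1` and product
`(a ⊗ x) (b ⊗ y) = a (x₁ ▷ b₁) ⊗ (x₂ ◁ b₂) y`. -/
structure IsDoubleCrossproduct (l : H →ₗ[k] A →ₗ[k] A) (r : H →ₗ[k] A →ₗ[k] H)
    {D : Type*} [Ring D] [Bialgebra k D] (θ : A ⊗[k] H ≃ₗc[k] D) : Prop where
  map_one : θ (1 ⊗ₜ 1) = 1
  map_mul : ∀ a x b y, θ (a ⊗ₜ x) * θ (b ⊗ₜ y) =
    θ (TensorProduct.map (LinearMap.mulLeft k a) (LinearMap.mulRight k y)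
      (TensorProduct.map₂ l r (Coalgebra.comul x) (Coalgebra.comul b)))

end Pairings

/-! ### Matrix relations

A matrix `R` on `V ⊗ V` is indexed by pairs: `R (i, j) (m, n)` is `R^{ij}_{mn}`, with `i, m`
belonging to the first tensor factor. A matrix `T = (t^i_j)` over an algebra is written as
`T i j = t^i_j`. -/

section Relations

variable {k ι : Type*} [CommRing k] [Fintype ι]

/-- `R₁₂` on `V ⊗ V ⊗ V`. -/
def R₁₂ [DecidableEq ι] (R : Matrix (ι × ι) (ι × ι) k) : Matrix (ι × ι × ι) (ι × ι × ι) k :=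
  Matrix.of fun p q => R (p.1, p.2.1) (q.1, q.2.1) * (if p.2.2 = q.2.2 then 1 else 0)

/-- `R₁₃` on `V ⊗ V ⊗ V`. -/
def R₁₃ [DecidableEq ι] (R : Matrix (ι × ι) (ι × ι) k) : Matrix (ι × ι × ι) (ι × ι × ι) k :=
  Matrix.of fun p q => R (p.1, p.2.2) (q.1, q.2.2) * (if p.2.1 = q.2.1 then 1 else 0)

/-- `R₂₃` on `V ⊗ V ⊗ V`. -/
def R₂₃ [DecidableEq ι] (R : Matrix (ι × ι) (ι × ι) k) : Matrix (ι × ι × ι) (ι × ι × ι) k :=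
  Matrix.of fun p q => R (p.2.1, p.2.2) (q.2.1, q.2.2) * (if p.1 = q.1 then 1 else 0)

/-- The Yang-Baxter equation `R₁₂ R₁₃ R₂₃ = R₂₃ R₁₃ R₁₂`. -/
def YangBaxterEquation [DecidableEq ι] (R : Matrix (ι × ι) (ι × ι) k) : Prop :=
  R₁₂ R * R₁₃ R * R₂₃ R = R₂₃ R * R₁₃ R * R₁₂ R

variable {S : Type*} [Ring S] [Algebra k S]

/-- `R₁₂ X₁ Z₂ = Z₂ X₁ R₁₂`. -/
def RelXZ (R : Matrix (ι × ι) (ι × ι) k) (X Z : ι → ι → S) : Prop :=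
  ∀ i j m n, ∑ p, ∑ q, R (i, j) (p, q) • (X p m * Z q n) =
    ∑ p, ∑ q, R (p, q) (m, n) • (Z j q * X i p)

/-- `E₁ T₂ = T₂ E₁ R₁₂`. -/
def RelET (R : Matrix (ι × ι) (ι × ι) k) (E : ι → S) (T : ι → ι → S) : Prop :=
  ∀ j m n, E m * T j n = ∑ p, ∑ q, R (p, q) (m, n) • (T j q * E p)

/-- `F₂ U₁ = R₁₂ U₁ F₂`. -/
def RelFU (R : Matrix (ι × ι) (ι × ι) k) (F : ι → S) (U : ι → ι → S) : Prop :=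
  ∀ i j m, F j * U i m = ∑ p, ∑ q, R (i, j) (p, q) • (U p m * F q)

/-- `T₂ F₁ = R₁₂ F₁ T₂`. -/
def RelTF (R : Matrix (ι × ι) (ι × ι) k) (T : ι → ι → S) (F : ι → S) : Prop :=
  ∀ i j n, T j n * F i = ∑ p, ∑ q, R (i, j) (p, q) • (F p * T q n)

/-- `U₁ E₂ = E₂ U₁ R₁₂`. -/
def RelUE (R : Matrix (ι × ι) (ι × ι) k) (U : ι → ι → S) (E : ι → S) : Prop :=
  ∀ i m n, U i m * E n = ∑ p, ∑ q, R (p, q) (m, n) • (E q * U i p)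

/-- `E F - F E = T - U`. -/
def RelEF (T : ι → ι → S) (E : ι → S) (U : ι → ι → S) (F : ι → S) : Prop :=
  ∀ i j, E j * F i - F i * E j = T i j - U i j

/-- The cross relations `R₁₂ U₁ T₂ = T₂ U₁ R₁₂`, `T₂ F₁ = R₁₂ F₁ T₂`, `E F - F E = T - U`,
`U₁ E₂ = E₂ U₁ R₁₂`. -/
structure CrossRelations (R : Matrix (ι × ι) (ι × ι) k)
    (T : ι → ι → S) (E : ι → S) (U : ι → ι → S) (F : ι → S) : Prop where
  ut : RelXZ R U T
  tf : RelTF R T F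
  ef : RelEF T E U F
  ue : RelUE R U E

/-! Compatibility of the relations with the comultiplication (used to define the bialgebra
structures below): here primed generators play the role of the second tensor factor. -/

/-- The product of two (rectangular) matrices of elements. -/
def dot {α β γ : Type*} [Fintype β] (X : α → β → S) (X' : β → γ → S) : α → γ → S :=
  fun i j => ∑ a, X i a * X' a j

theorem dot_def {α β γ : Type*} [Fintype β] (X : α → β → S) (X' : β → γ → S) :
    dot X X' = fun i j => ∑ a, X i a * X' a j := rfl

theorem dot_assoc {α β γ δ : Type*} [Fintype β] [Fintype γ] (X : α → β → S) (Y : β → γ → S)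
    (Z : γ → δ → S) : dot (dot X Y) Z = dot X (dot Y Z) := by
  funext i j
  simp only [dot, Finset.sum_mul, Finset.mul_sum, mul_assoc]
  exact Finset.sum_comm

theorem dot_add {α β γ : Type*} [Fintype β] (X : α → β → S) (Y Z : β → γ → S) :
    dot X (Y + Z) = dot X Y + dot X Z := by
  funext i j
  simp [dot, mul_add, Finset.sum_add_distrib]

theorem add_dot {α β γ : Type*} [Fintype β] (X Y : α → β → S) (Z : β → γ → S) :
    dot (X + Y) Z = dot X Z + dot Y Z := by
  funext i j
  simp [dot, add_mul, Finset.sum_add_distrib]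

/-- `R` with entries moved to the algebra. -/
def toAlg (R : Matrix (ι × ι) (ι × ι) k) : ι × ι → ι × ι → S := fun p q => algebraMap k S (R p q)

/-- Entries of `X₁ Z₂`. -/
def prodXZ (X Z : ι → ι → S) : ι × ι → ι × ι → S := fun p q => X p.1 q.1 * Z p.2 q.2

/-- Entries of `Z₂ X₁`. -/
def prodZX (X Z : ι → ι → S) : ι × ι → ι × ι → S := fun p q => Z p.2 q.2 * X p.1 q.1

theorem relXZ_iff (R : Matrix (ι × ι) (ι × ι) k) (X Z : ι → ι → S) :
    RelXZ R X Z ↔ dot (toAlg R) (prodXZ X Z) = dot (prodZX X Z) (toAlg R) := by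
  simp only [RelXZ, funext_iff, Prod.forall, dot, Fintype.sum_prod_type, toAlg, prodXZ, prodZX,
    Algebra.smul_def, Algebra.commutes]

theorem prodXZ_dot {X X' Z Z' : ι → ι → S} (h : ∀ a b c d, X' a b * Z c d = Z c d * X' a b) :
    prodXZ (dot X X') (dot Z Z') = dot (prodXZ X Z) (prodXZ X' Z') := by
  funext ⟨i, j⟩ ⟨m, n⟩
  simp only [Fintype.sum_prod_type, prodXZ, dot, Finset.sum_mul_sum]
  refine Finset.sum_congr rfl fun a _ => Finset.sum_congr rfl fun b _ => ?_
  rw [mul_assoc, ← mul_assoc (X' a m), h, mul_assoc, mul_assoc]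

theorem prodZX_dot {X X' Z Z' : ι → ι → S} (h : ∀ a b c d, Z' a b * X c d = X c d * Z' a b) :
    prodZX (dot X X') (dot Z Z') = dot (prodZX X Z) (prodZX X' Z') := by
  funext ⟨i, j⟩ ⟨m, n⟩
  simp only [Fintype.sum_prod_type, prodZX, dot, Finset.sum_mul_sum]
  rw [Finset.sum_comm]
  refine Finset.sum_congr rfl fun a _ => Finset.sum_congr rfl fun b _ => ?_
  rw [mul_assoc, ← mul_assoc (Z' b n), h, mul_assoc, mul_assoc]

theorem RelXZ.comul {R : Matrix (ι × ι) (ι × ι) k} {X X' Z Z' : ι → ι → S}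
    (h : RelXZ R X Z) (h' : RelXZ R X' Z')
    (c : ∀ a b c d, X' a b * Z c d = Z c d * X' a b)
    (c' : ∀ a b c d, Z' a b * X c d = X c d * Z' a b) :
    RelXZ R (dot X X') (dot Z Z') := by
  rw [relXZ_iff] at *
  rw [prodXZ_dot c, prodZX_dot c', ← dot_assoc, h, dot_assoc, h', dot_assoc]

theorem RelET.comul {R : Matrix (ι × ι) (ι × ι) k} {E E' : ι → S} {T T' : ι → ι → S}
    (h : RelET R E T) (h' : RelET R E' T') (ht : RelXZ R T' T')
    (c₁ : ∀ a b c d, T' a b * T c d = T c d * T' a b)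
    (c₂ : ∀ a c d, E' a * T c d = T c d * E' a)
    (c₃ : ∀ a b d, T' a b * E d = E d * T' a b) :
    RelET R (fun i => ∑ a, E a * T' a i + E' i) (dot T T') := by
  let N (E : ι → S) (T : ι → ι → S) : ι → ι × ι → S := fun j p => E p.1 * T j p.2
  let N' (E : ι → S) (T : ι → ι → S) : ι → ι × ι → S := fun j p => T j p.2 * E p.1
  have key : ∀ (E : ι → S) (T : ι → ι → S), RelET R E T ↔ N E T = dot (N' E T) (toAlg R) := by
    intro E T
    simp only [RelET, funext_iff, Prod.forall, dot, Fintype.sum_prod_type, toAlg, N, N',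
      Algebra.smul_def, Algebra.commutes]
  have e1 : N (fun i => ∑ a, E a * T' a i + E' i) (dot T T') =
      dot (N E T) (prodXZ T' T') + dot T (N E' T') := by
    funext j ⟨m, n⟩
    simp only [N, Pi.add_apply, Fintype.sum_prod_type, prodXZ, dot, add_mul]
    rw [Finset.sum_mul_sum, Finset.mul_sum]
    congr 1
    · refine Finset.sum_congr rfl fun a _ => Finset.sum_congr rfl fun b _ => ?_
      rw [mul_assoc, ← mul_assoc (T' a m), c₁, mul_assoc, mul_assoc]
    · refine Finset.sum_congr rfl fun a _ => ?_
      rw [← mul_assoc, c₂, mul_assoc]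
  have e2 : N' (fun i => ∑ a, E a * T' a i + E' i) (dot T T') =
      dot (N' E T) (prodZX T' T') + dot T (N' E' T') := by
    funext j ⟨m, n⟩
    simp only [N', Pi.add_apply, Fintype.sum_prod_type, prodZX, dot, mul_add]
    rw [Finset.sum_mul_sum, Finset.sum_mul]
    congr 1
    · rw [Finset.sum_comm]
      refine Finset.sum_congr rfl fun a _ => Finset.sum_congr rfl fun b _ => ?_
      rw [mul_assoc, ← mul_assoc (T' b n), c₃, mul_assoc, mul_assoc]
    · refine Finset.sum_congr rfl fun a _ => ?_
      rw [mul_assoc]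
  rw [key] at h h' ⊢
  rw [relXZ_iff] at ht
  rw [e1, e2, h, h', dot_assoc, ht, add_dot, dot_assoc, dot_assoc]

theorem RelUE.comul {R : Matrix (ι × ι) (ι × ι) k} {E E' : ι → S} {T' U U' : ι → ι → S}
    (h : RelUE R U E) (h' : RelUE R U' E') (hut : RelXZ R U' T')
    (c₁ : ∀ a b c d, T' a b * U c d = U c d * T' a b)
    (c₂ : ∀ a c d, E' a * U c d = U c d * E' a)
    (c₃ : ∀ a b d, U' a b * E d = E d * U' a b) :
    RelUE R (dot U U') (fun i => ∑ a, E a * T' a i + E' i) := by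
  let K (U : ι → ι → S) (E : ι → S) : ι → ι × ι → S := fun i p => U i p.1 * E p.2
  let K' (U : ι → ι → S) (E : ι → S) : ι → ι × ι → S := fun i p => E p.2 * U i p.1
  have key : ∀ (U : ι → ι → S) (E : ι → S), RelUE R U E ↔ K U E = dot (K' U E) (toAlg R) := by
    intro U E
    simp only [RelUE, funext_iff, Prod.forall, dot, Fintype.sum_prod_type, toAlg, K, K',
      Algebra.smul_def, Algebra.commutes]
  have e1 : K (dot U U') (fun i => ∑ a, E a * T' a i + E' i) =
      dot (K U E) (prodXZ U' T') + dot U (K U' E') := by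
    funext j ⟨m, n⟩
    simp only [K, Pi.add_apply, Fintype.sum_prod_type, prodXZ, dot, mul_add]
    rw [Finset.sum_mul_sum, Finset.sum_mul]
    congr 1
    · refine Finset.sum_congr rfl fun a _ => Finset.sum_congr rfl fun b _ => ?_
      rw [mul_assoc, ← mul_assoc (U' a m), c₃, mul_assoc, mul_assoc]
    · refine Finset.sum_congr rfl fun a _ => ?_
      rw [mul_assoc]
  have e2 : K' (dot U U') (fun i => ∑ a, E a * T' a i + E' i) =
      dot (K' U E) (prodZX U' T') + dot U (K' U' E') := by
    funext j ⟨m, n⟩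
    simp only [K', Pi.add_apply, Fintype.sum_prod_type, prodZX, dot, add_mul]
    rw [Finset.sum_mul_sum, Finset.mul_sum]
    congr 1
    · rw [Finset.sum_comm]
      refine Finset.sum_congr rfl fun a _ => Finset.sum_congr rfl fun b _ => ?_
      rw [mul_assoc, ← mul_assoc (T' b n), c₁, mul_assoc, mul_assoc]
    · refine Finset.sum_congr rfl fun a _ => ?_
      rw [← mul_assoc, c₂, mul_assoc]
  rw [key] at h h' ⊢
  rw [relXZ_iff] at hut
  rw [e1, e2, h, h', dot_assoc, hut, add_dot, dot_assoc, dot_assoc]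

theorem RelFU.comul {R : Matrix (ι × ι) (ι × ι) k} {F F' : ι → S} {U U' : ι → ι → S}
    (h : RelFU R F U) (h' : RelFU R F' U') (hu : RelXZ R U U)
    (c₁ : ∀ a b c d, U' a b * U c d = U c d * U' a b)
    (c₂ : ∀ a c d, F' a * U c d = U c d * F' a)
    (c₃ : ∀ a b d, U' a b * F d = F d * U' a b) :
    RelFU R (fun i => F i + ∑ a, U i a * F' a) (dot U U') := by
  let P (F : ι → S) (U : ι → ι → S) : ι × ι → ι → S := fun p m => F p.2 * U p.1 m
  let P' (F : ι → S) (U : ι → ι → S) : ι × ι → ι → S := fun p m => U p.1 m * F p.2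
  have key : ∀ (F : ι → S) (U : ι → ι → S), RelFU R F U ↔ P F U = dot (toAlg R) (P' F U) := by
    intro F U
    simp only [RelFU, funext_iff, Prod.forall, dot, Fintype.sum_prod_type, toAlg, P, P',
      Algebra.smul_def]
  have e1 : P (fun i => F i + ∑ a, U i a * F' a) (dot U U') =
      dot (P F U) U' + dot (prodZX U U) (P F' U') := by
    funext ⟨i, j⟩ m
    simp only [P, Pi.add_apply, Fintype.sum_prod_type, prodZX, dot, add_mul]
    rw [Finset.sum_mul_sum, Finset.mul_sum]
    congr 1
    · refine Finset.sum_congr rfl fun a _ => ?_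
      rw [mul_assoc]
    · rw [Finset.sum_comm]
      refine Finset.sum_congr rfl fun a _ => Finset.sum_congr rfl fun b _ => ?_
      rw [mul_assoc, ← mul_assoc (F' b), c₂, mul_assoc, mul_assoc]
  have e2 : P' (fun i => F i + ∑ a, U i a * F' a) (dot U U') =
      dot (P' F U) U' + dot (prodXZ U U) (P' F' U') := by
    funext ⟨i, j⟩ m
    simp only [P', Pi.add_apply, Fintype.sum_prod_type, prodXZ, dot, mul_add]
    rw [Finset.sum_mul_sum, Finset.sum_mul]
    congr 1
    · refine Finset.sum_congr rfl fun a _ => ?_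
      rw [mul_assoc, c₃, mul_assoc]
    · refine Finset.sum_congr rfl fun a _ => Finset.sum_congr rfl fun b _ => ?_
      rw [mul_assoc, ← mul_assoc (U' a m), c₁, mul_assoc, mul_assoc]
  rw [key] at h h' ⊢
  rw [relXZ_iff] at hu
  rw [e1, e2, h, h', dot_add, ← dot_assoc (prodZX U U), ← hu, dot_assoc, dot_assoc]

theorem RelTF.comul {R : Matrix (ι × ι) (ι × ι) k} {F F' : ι → S} {T T' U : ι → ι → S}
    (h : RelTF R T F) (h' : RelTF R T' F') (hut : RelXZ R U T)
    (c₁ : ∀ a b c d, T' a b * U c d = U c d * T' a b)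
    (c₂ : ∀ a c d, F' a * T c d = T c d * F' a)
    (c₃ : ∀ a b d, T' a b * F d = F d * T' a b) :
    RelTF R (dot T T') (fun i => F i + ∑ a, U i a * F' a) := by
  let P (T : ι → ι → S) (F : ι → S) : ι × ι → ι → S := fun p m => T p.2 m * F p.1
  let P' (T : ι → ι → S) (F : ι → S) : ι × ι → ι → S := fun p m => F p.1 * T p.2 m
  have key : ∀ (T : ι → ι → S) (F : ι → S), RelTF R T F ↔ P T F = dot (toAlg R) (P' T F) := by
    intro T F
    simp only [RelTF, funext_iff, Prod.forall, dot, Fintype.sum_prod_type, toAlg, P, P',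
      Algebra.smul_def]
  have e1 : P (dot T T') (fun i => F i + ∑ a, U i a * F' a) =
      dot (P T F) T' + dot (prodZX U T) (P T' F') := by
    funext ⟨i, j⟩ m
    simp only [P, Pi.add_apply, Fintype.sum_prod_type, prodZX, dot, mul_add]
    rw [Finset.sum_mul_sum, Finset.sum_mul]
    congr 1
    · refine Finset.sum_congr rfl fun a _ => ?_
      rw [mul_assoc, c₃, mul_assoc]
    · rw [Finset.sum_comm]
      refine Finset.sum_congr rfl fun a _ => Finset.sum_congr rfl fun b _ => ?_
      rw [mul_assoc, ← mul_assoc (T' b m), c₁, mul_assoc, mul_assoc]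
  have e2 : P' (dot T T') (fun i => F i + ∑ a, U i a * F' a) =
      dot (P' T F) T' + dot (prodXZ U T) (P' T' F') := by
    funext ⟨i, j⟩ m
    simp only [P', Pi.add_apply, Fintype.sum_prod_type, prodXZ, dot, add_mul]
    rw [Finset.sum_mul_sum, Finset.mul_sum]
    congr 1
    · refine Finset.sum_congr rfl fun a _ => ?_
      rw [mul_assoc]
    · refine Finset.sum_congr rfl fun a _ => Finset.sum_congr rfl fun b _ => ?_
      rw [mul_assoc, ← mul_assoc (F' a), c₂, mul_assoc, mul_assoc]
  rw [key] at h h' ⊢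
  rw [relXZ_iff] at hut
  rw [e1, e2, h, h', dot_add, ← dot_assoc (prodZX U T), ← hut, dot_assoc, dot_assoc]

theorem RelEF.comul {R : Matrix (ι × ι) (ι × ι) k} {E E' F F' : ι → S} {T T' U U' : ι → ι → S}
    (h : RelEF T E U F) (h' : RelEF T' E' U' F') (hue : RelUE R U E) (htf : RelTF R T' F')
    (c₁ : ∀ a b c, T' a b * F c = F c * T' a b)
    (c₂ : ∀ a b, E' a * F b = F b * E' a)
    (c₃ : ∀ a c d, E' a * U c d = U c d * E' a)
    (c₄ : ∀ a b, F' a * E b = E b * F' a)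
    (c₅ : ∀ a b c d, T' a b * U c d = U c d * T' a b) :
    RelEF (dot T T') (fun i => ∑ a, E a * T' a i + E' i)
      (dot U U') (fun i => F i + ∑ a, U i a * F' a) := by
  intro i j
  have hx : ∑ a, ∑ b, E a * T' a j * (U i b * F' b) = ∑ a, ∑ b, U i b * F' b * (E a * T' a j) := by
    have l1 : ∀ a b, E a * T' a j * (U i b * F' b) =
        ∑ p, ∑ q, R (b, a) (p, q) • ((E a * U i b) * (F' p * T' q j)) := by
      intro a b
      rw [mul_assoc, ← mul_assoc (T' a j), c₅, mul_assoc, ← mul_assoc, htf b a j, Finset.mul_sum]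
      simp only [Finset.mul_sum, mul_smul_comm]
    have l2 : ∀ a b, U i b * F' b * (E a * T' a j) =
        ∑ p, ∑ q, R (p, q) (b, a) • ((E q * U i p) * (F' b * T' a j)) := by
      intro a b
      rw [mul_assoc, ← mul_assoc (F' b), c₄, mul_assoc, ← mul_assoc, hue i b a, Finset.sum_mul]
      simp only [Finset.sum_mul, smul_mul_assoc]
    simp only [l1, l2]
    rw [Finset.sum_comm]
    have e : ∀ f : ι → ι → ι → ι → S, ∑ b, ∑ a, ∑ p, ∑ q, f b a p q =
        ∑ a, ∑ b, ∑ p, ∑ q, f p q b a := by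
      intro f
      calc ∑ b, ∑ a, ∑ p, ∑ q, f b a p q
          = ∑ x : ι × ι, ∑ y : ι × ι, f x.1 x.2 y.1 y.2 := by simp [Fintype.sum_prod_type]
        _ = ∑ y : ι × ι, ∑ x : ι × ι, f x.1 x.2 y.1 y.2 := Finset.sum_comm
        _ = ∑ b, ∑ a, ∑ p, ∑ q, f p q b a := by simp [Fintype.sum_prod_type]
        _ = _ := Finset.sum_comm
    exact e _
  have hx1 : ∑ a, E a * T' a j * F i - F i * ∑ a, E a * T' a j =
      ∑ a, (T i a - U i a) * T' a j := by
    rw [Finset.mul_sum, ← Finset.sum_sub_distrib]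
    refine Finset.sum_congr rfl fun a _ => ?_
    rw [← h i a, sub_mul, mul_assoc, c₁, mul_assoc, mul_assoc]
  have hx2 : E' j * ∑ a, U i a * F' a - ∑ a, U i a * F' a * E' j =
      ∑ a, U i a * (T' a j - U' a j) := by
    rw [Finset.mul_sum, ← Finset.sum_sub_distrib]
    refine Finset.sum_congr rfl fun a _ => ?_
    rw [← h' a j, mul_sub, ← mul_assoc, c₃, mul_assoc, mul_assoc]
  simp only [dot, mul_add, add_mul, Finset.sum_mul_sum, c₂]
  rw [hx, Finset.sum_mul, Finset.sum_mul]
  rw [Finset.sum_comm]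
  simp only [sub_mul, mul_sub, Finset.sum_sub_distrib] at hx1 hx2
  linear_combination (norm := abel) hx1 + hx2

section Map

variable {S' : Type*} [Ring S'] [Algebra k S'] {R : Matrix (ι × ι) (ι × ι) k} (f : S →ₐ[k] S')

theorem RelXZ.map {X Z : ι → ι → S} (h : RelXZ R X Z) :
    RelXZ R (fun i j => f (X i j)) (fun i j => f (Z i j)) := by
  intro i j m n
  simpa using congrArg f (h i j m n)

theorem RelET.map {E : ι → S} {T : ι → ι → S} (h : RelET R E T) :
    RelET R (fun i => f (E i)) (fun i j => f (T i j)) := by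
  intro i j m
  simpa using congrArg f (h i j m)

theorem RelFU.map {F : ι → S} {U : ι → ι → S} (h : RelFU R F U) :
    RelFU R (fun i => f (F i)) (fun i j => f (U i j)) := by
  intro i j m
  simpa using congrArg f (h i j m)

theorem RelTF.map {F : ι → S} {T : ι → ι → S} (h : RelTF R T F) :
    RelTF R (fun i j => f (T i j)) (fun i => f (F i)) := by
  intro i j m
  simpa using congrArg f (h i j m)

theorem RelUE.map {E : ι → S} {U : ι → ι → S} (h : RelUE R U E) :
    RelUE R (fun i j => f (U i j)) (fun i => f (E i)) := by
  intro i j m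
  simpa using congrArg f (h i j m)

set_option linter.unusedSectionVars false in
theorem RelEF.map {E F : ι → S} {T U : ι → ι → S} (h : RelEF T E U F) :
    RelEF (fun i j => f (T i j)) (fun i => f (E i)) (fun i j => f (U i j)) (fun i => f (F i)) := by
  intro i j
  simpa using congrArg f (h i j)

end Map

end Relations

/-! ### The bialgebra `Y₊` -/

section Plus

variable {k ι : Type*} [CommRing k] [Fintype ι]

/-- Generators of `Y₊`. -/
inductive PlusGen (ι : Type*) where
  | u : ι → ι → PlusGen ι
  | F : ι → PlusGen ι

/-- Defining relations of `Y₊`: `R₁₂ U₁ U₂ = U₂ U₁ R₁₂`, `F₂ U₁ = R₁₂ U₁ F₂`. -/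
inductive PlusRel (R : Matrix (ι × ι) (ι × ι) k) :
    FreeAlgebra k (PlusGen ι) → FreeAlgebra k (PlusGen ι) → Prop where
  | uu (i j m n : ι) : PlusRel R
      (∑ p, ∑ q, R (i, j) (p, q) • (FreeAlgebra.ι k (.u p m) * FreeAlgebra.ι k (.u q n)))
      (∑ p, ∑ q, R (p, q) (m, n) • (FreeAlgebra.ι k (.u j q) * FreeAlgebra.ι k (.u i p)))
  | fu (i j m : ι) : PlusRel R
      (FreeAlgebra.ι k (.F j) * FreeAlgebra.ι k (.u i m))
      (∑ p, ∑ q, R (i, j) (p, q) • (FreeAlgebra.ι k (.u p m) * FreeAlgebra.ι k (.F q)))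

/-- The algebra `Y₊` generated by `u^i_j`, `F^i`. -/
def YPlus (R : Matrix (ι × ι) (ι × ι) k) : Type _ := RingQuot (PlusRel R)

variable (R : Matrix (ι × ι) (ι × ι) k)

instance : Ring (YPlus R) := inferInstanceAs (Ring (RingQuot (PlusRel R)))
instance : Algebra k (YPlus R) := inferInstanceAs (Algebra k (RingQuot (PlusRel R)))

namespace YPlus

/-- The quotient map from the free algebra. -/
def mk : FreeAlgebra k (PlusGen ι) →ₐ[k] YPlus R := RingQuot.mkAlgHom k (PlusRel R)

variable {R} in
theorem mk_rel {x y : FreeAlgebra k (PlusGen ι)} (h : PlusRel R x y) : mk R x = mk R y :=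
  RingQuot.mkAlgHom_rel k h

/-- The generator `u^i_j`. -/
def u (i j : ι) : YPlus R := mk R (FreeAlgebra.ι k (.u i j))

/-- The generator `F^i`. -/
def F (i : ι) : YPlus R := mk R (FreeAlgebra.ι k (.F i))

theorem rel_uu : RelXZ R (u R) (u R) := by
  intro i j m n
  simpa [u] using mk_rel (PlusRel.uu (R := R) i j m n)

theorem rel_fu : RelFU R (F R) (u R) := by
  intro i j m
  simpa [F, u] using mk_rel (PlusRel.fu (R := R) i j m)

variable {R} {B : Type*} [Ring B] [Algebra k B]

/-- The algebra homomorphism out of `Y₊` determined by images of generators. -/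
def lift (u' : ι → ι → B) (F' : ι → B)
    (h_uu : RelXZ R u' u')
    (h_fu : RelFU R F' u') :
    YPlus R →ₐ[k] B :=
  RingQuot.liftAlgHom k
    ⟨FreeAlgebra.lift k (fun g => match g with | .u i j => u' i j | .F i => F' i), by
      rintro _ _ (⟨i, j, m, n⟩ | ⟨i, j, m⟩)
      · simpa using h_uu i j m n
      · simpa using h_fu i j m⟩

theorem lift_u (u' : ι → ι → B) (F' : ι → B)
    (h_uu : RelXZ R u' u')
    (h_fu : RelFU R F' u')
    (i j : ι) : lift u' F' h_uu h_fu (u R i j) = u' i j := by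
  unfold lift u mk
  exact (RingQuot.liftAlgHom_mkAlgHom_apply ..).trans (by simp)

theorem lift_F (u' : ι → ι → B) (F' : ι → B)
    (h_uu : RelXZ R u' u')
    (h_fu : RelFU R F' u')
    (i : ι) : lift u' F' h_uu h_fu (F R i) = F' i := by
  unfold lift F mk
  exact (RingQuot.liftAlgHom_mkAlgHom_apply ..).trans (by simp)

theorem algHom_ext {f g : YPlus R →ₐ[k] B} (h_u : ∀ i j, f (u R i j) = g (u R i j))
    (h_F : ∀ i, f (F R i) = g (F R i)) : f = g := by
  refine RingQuot.ringQuot_ext' k f g (FreeAlgebra.hom_ext (funext fun x => ?_))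
  cases x with
  | u i j => exact h_u i j
  | F i => exact h_F i

variable (R)

/-- `Δ(U) = U ⊗ U`, `Δ(F) = F ⊗ 1 + U ⊗ F`. -/
def comulHom : YPlus R →ₐ[k] YPlus R ⊗[k] YPlus R :=
  lift (fun i j => ∑ a, u R i a ⊗ₜ u R a j)
    (fun i => F R i ⊗ₜ 1 + ∑ a, u R i a ⊗ₜ F R a)
    (by
      have h := RelXZ.comul
          ((rel_uu R).map (Algebra.TensorProduct.includeLeft (R := k) (S := k) (A := YPlus R) (B := YPlus R)))
          ((rel_uu R).map (Algebra.TensorProduct.includeRight (R := k) (A := YPlus R) (B := YPlus R)))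
          (by simp) (by simp)
      simpa [dot_def] using h)
    (by
      have h := RelFU.comul
          ((rel_fu R).map (Algebra.TensorProduct.includeLeft (R := k) (S := k) (A := YPlus R) (B := YPlus R)))
          ((rel_fu R).map (Algebra.TensorProduct.includeRight (R := k) (A := YPlus R) (B := YPlus R)))
          ((rel_uu R).map (Algebra.TensorProduct.includeLeft (R := k) (S := k) (A := YPlus R) (B := YPlus R)))
          (by simp) (by simp) (by simp)
      simpa [dot_def] using h)

@[simp] theorem comulHom_u (i j : ι) :
    comulHom R (u R i j) = ∑ a, u R i a ⊗ₜ u R a j := lift_u ..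

@[simp] theorem comulHom_F (i : ι) :
    comulHom R (F R i) = F R i ⊗ₜ 1 + ∑ a, u R i a ⊗ₜ F R a := lift_F ..

variable [DecidableEq ι]

/-- `ε(U) = 1`, `ε(F) = 0`. -/
def counitHom : YPlus R →ₐ[k] k :=
  lift (fun i j => if i = j then 1 else 0) (fun _ => 0)
    (by intro i j m n; simp)
    (by intro i j m; simp)

@[simp] theorem counitHom_u (i j : ι) : counitHom R (u R i j) = (if i = j then 1 else 0) := lift_u ..

@[simp] theorem counitHom_F (i : ι) : counitHom R (F R i) = 0 := lift_F ..

instance : Bialgebra k (YPlus R) :=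
  Bialgebra.ofAlgHom (comulHom R) (counitHom R)
    (by
      apply algHom_ext
      · intro i j
        simp [TensorProduct.sum_tmul, TensorProduct.tmul_sum]
        rw [Finset.sum_comm]
      · intro i
        simp [TensorProduct.sum_tmul, TensorProduct.tmul_sum, TensorProduct.add_tmul,
          TensorProduct.tmul_add, Finset.sum_add_distrib, Algebra.TensorProduct.one_def, add_assoc]
        rw [Finset.sum_comm])
    (by
      apply algHom_ext
      · intro i j
        simp [TensorProduct.ite_tmul]
      · intro i
        simp [TensorProduct.ite_tmul])
    (by
      apply algHom_ext
      · intro i j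
        simp [TensorProduct.tmul_ite]
      · intro i
        simp)

theorem comul_u (i j : ι) : Coalgebra.comul (R := k) (u R i j) =
    ∑ a, u R i a ⊗ₜ u R a j := comulHom_u R i j

theorem counit_u (i j : ι) : Coalgebra.counit (R := k) (u R i j) = (if i = j then 1 else 0) :=
  counitHom_u R i j

theorem comul_F (i : ι) : Coalgebra.comul (R := k) (F R i) =
    F R i ⊗ₜ 1 + ∑ a, u R i a ⊗ₜ F R a := comulHom_F R i

theorem counit_F (i : ι) : Coalgebra.counit (R := k) (F R i) = 0 :=
  counitHom_F R i

end YPlus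

end Plus

/-! ### The bialgebra `Y₋` -/

section Minus

variable {k ι : Type*} [CommRing k] [Fintype ι]

/-- Generators of `Y₋`. -/
inductive MinusGen (ι : Type*) where
  | t : ι → ι → MinusGen ι
  | E : ι → MinusGen ι

/-- Defining relations of `Y₋`: `R₁₂ T₁ T₂ = T₂ T₁ R₁₂`, `E₁ T₂ = T₂ E₁ R₁₂`. -/
inductive MinusRel (R : Matrix (ι × ι) (ι × ι) k) :
    FreeAlgebra k (MinusGen ι) → FreeAlgebra k (MinusGen ι) → Prop where
  | tt (i j m n : ι) : MinusRel R
      (∑ p, ∑ q, R (i, j) (p, q) • (FreeAlgebra.ι k (.t p m) * FreeAlgebra.ι k (.t q n)))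
      (∑ p, ∑ q, R (p, q) (m, n) • (FreeAlgebra.ι k (.t j q) * FreeAlgebra.ι k (.t i p)))
  | et (j m n : ι) : MinusRel R
      (FreeAlgebra.ι k (.E m) * FreeAlgebra.ι k (.t j n))
      (∑ p, ∑ q, R (p, q) (m, n) • (FreeAlgebra.ι k (.t j q) * FreeAlgebra.ι k (.E p)))

/-- The algebra `Y₋` generated by `t^i_j`, `E_i`. -/
def YMinus (R : Matrix (ι × ι) (ι × ι) k) : Type _ := RingQuot (MinusRel R)

variable (R : Matrix (ι × ι) (ι × ι) k)

instance : Ring (YMinus R) := inferInstanceAs (Ring (RingQuot (MinusRel R)))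
instance : Algebra k (YMinus R) := inferInstanceAs (Algebra k (RingQuot (MinusRel R)))

namespace YMinus

/-- The quotient map from the free algebra. -/
def mk : FreeAlgebra k (MinusGen ι) →ₐ[k] YMinus R := RingQuot.mkAlgHom k (MinusRel R)

variable {R} in
theorem mk_rel {x y : FreeAlgebra k (MinusGen ι)} (h : MinusRel R x y) : mk R x = mk R y :=
  RingQuot.mkAlgHom_rel k h

/-- The generator `t^i_j`. -/
def t (i j : ι) : YMinus R := mk R (FreeAlgebra.ι k (.t i j))

/-- The generator `E_i`. -/
def E (i : ι) : YMinus R := mk R (FreeAlgebra.ι k (.E i))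

theorem rel_tt : RelXZ R (t R) (t R) := by
  intro i j m n
  simpa [t] using mk_rel (MinusRel.tt (R := R) i j m n)

theorem rel_et : RelET R (E R) (t R) := by
  intro j m n
  simpa [E, t] using mk_rel (MinusRel.et (R := R) j m n)

variable {R} {B : Type*} [Ring B] [Algebra k B]

/-- The algebra homomorphism out of `Y₋` determined by images of generators. -/
def lift (t' : ι → ι → B) (E' : ι → B)
    (h_tt : RelXZ R t' t')
    (h_et : RelET R E' t') :
    YMinus R →ₐ[k] B :=
  RingQuot.liftAlgHom k
    ⟨FreeAlgebra.lift k (fun g => match g with | .t i j => t' i j | .E i => E' i), by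
      rintro _ _ (⟨i, j, m, n⟩ | ⟨j, m, n⟩)
      · simpa using h_tt i j m n
      · simpa using h_et j m n⟩

theorem lift_t (t' : ι → ι → B) (E' : ι → B)
    (h_tt : RelXZ R t' t')
    (h_et : RelET R E' t')
    (i j : ι) : lift t' E' h_tt h_et (t R i j) = t' i j := by
  unfold lift t mk
  exact (RingQuot.liftAlgHom_mkAlgHom_apply ..).trans (by simp)

theorem lift_E (t' : ι → ι → B) (E' : ι → B)
    (h_tt : RelXZ R t' t')
    (h_et : RelET R E' t')
    (i : ι) : lift t' E' h_tt h_et (E R i) = E' i := by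
  unfold lift E mk
  exact (RingQuot.liftAlgHom_mkAlgHom_apply ..).trans (by simp)

theorem algHom_ext {f g : YMinus R →ₐ[k] B} (h_t : ∀ i j, f (t R i j) = g (t R i j))
    (h_E : ∀ i, f (E R i) = g (E R i)) : f = g := by
  refine RingQuot.ringQuot_ext' k f g (FreeAlgebra.hom_ext (funext fun x => ?_))
  cases x with
  | t i j => exact h_t i j
  | E i => exact h_E i

variable (R)

/-- `Δ(T) = T ⊗ T`, `Δ(E) = E ⊗ T + 1 ⊗ E`. -/
def comulHom : YMinus R →ₐ[k] YMinus R ⊗[k] YMinus R :=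
  lift (fun i j => ∑ a, t R i a ⊗ₜ t R a j)
    (fun i => ∑ a, E R a ⊗ₜ t R a i + 1 ⊗ₜ E R i)
    (by
      have h := RelXZ.comul
          ((rel_tt R).map (Algebra.TensorProduct.includeLeft (R := k) (S := k) (A := YMinus R) (B := YMinus R)))
          ((rel_tt R).map (Algebra.TensorProduct.includeRight (R := k) (A := YMinus R) (B := YMinus R)))
          (by simp) (by simp)
      simpa [dot_def] using h)
    (by
      have h := RelET.comul
          ((rel_et R).map (Algebra.TensorProduct.includeLeft (R := k) (S := k) (A := YMinus R) (B := YMinus R)))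
          ((rel_et R).map (Algebra.TensorProduct.includeRight (R := k) (A := YMinus R) (B := YMinus R)))
          ((rel_tt R).map (Algebra.TensorProduct.includeRight (R := k) (A := YMinus R) (B := YMinus R)))
          (by simp) (by simp) (by simp)
      simpa [dot_def] using h)

@[simp] theorem comulHom_t (i j : ι) :
    comulHom R (t R i j) = ∑ a, t R i a ⊗ₜ t R a j := lift_t ..

@[simp] theorem comulHom_E (i : ι) :
    comulHom R (E R i) = ∑ a, E R a ⊗ₜ t R a i + 1 ⊗ₜ E R i := lift_E ..

variable [DecidableEq ι]

/-- `ε(T) = 1`, `ε(E) = 0`. -/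
def counitHom : YMinus R →ₐ[k] k :=
  lift (fun i j => if i = j then 1 else 0) (fun _ => 0)
    (by intro i j m n; simp)
    (by intro j m n; simp)

@[simp] theorem counitHom_t (i j : ι) : counitHom R (t R i j) = (if i = j then 1 else 0) := lift_t ..

@[simp] theorem counitHom_E (i : ι) : counitHom R (E R i) = 0 := lift_E ..

instance : Bialgebra k (YMinus R) :=
  Bialgebra.ofAlgHom (comulHom R) (counitHom R)
    (by
      apply algHom_ext
      · intro i j
        simp [TensorProduct.sum_tmul, TensorProduct.tmul_sum]
        rw [Finset.sum_comm]
      · intro i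
        simp [TensorProduct.sum_tmul, TensorProduct.tmul_sum, TensorProduct.add_tmul,
          TensorProduct.tmul_add, Finset.sum_add_distrib, Algebra.TensorProduct.one_def, add_assoc]
        rw [Finset.sum_comm])
    (by
      apply algHom_ext
      · intro i j
        simp [TensorProduct.ite_tmul]
      · intro i
        simp)
    (by
      apply algHom_ext
      · intro i j
        simp [TensorProduct.tmul_ite]
      · intro i
        simp [TensorProduct.tmul_ite])

theorem comul_t (i j : ι) : Coalgebra.comul (R := k) (t R i j) =
    ∑ a, t R i a ⊗ₜ t R a j := comulHom_t R i j

theorem counit_t (i j : ι) : Coalgebra.counit (R := k) (t R i j) = (if i = j then 1 else 0) :=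
  counitHom_t R i j

theorem comul_E (i : ι) : Coalgebra.comul (R := k) (E R i) =
    ∑ a, E R a ⊗ₜ t R a i + 1 ⊗ₜ E R i := comulHom_E R i

theorem counit_E (i : ι) : Coalgebra.counit (R := k) (E R i) = 0 :=
  counitHom_E R i

end YMinus

end Minus

/-! ### The bialgebra `Y` -/

section YB

variable {k ι : Type*} [CommRing k] [Fintype ι]

/-- Generators of `Y`. -/
inductive YBGen (ι : Type*) where
  | t : ι → ι → YBGen ι
  | E : ι → YBGen ι
  | u : ι → ι → YBGen ι
  | F : ι → YBGen ι

/-- Defining relations of `Y`: those of `Y₋` and `Y₊` and the cross relations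
`R₁₂ U₁ T₂ = T₂ U₁ R₁₂`, `T₂ F₁ = R₁₂ F₁ T₂`, `E F - F E = T - U`, `U₁ E₂ = E₂ U₁ R₁₂`. -/
inductive YBRel (R : Matrix (ι × ι) (ι × ι) k) :
    FreeAlgebra k (YBGen ι) → FreeAlgebra k (YBGen ι) → Prop where
  | tt (i j m n : ι) : YBRel R
      (∑ p, ∑ q, R (i, j) (p, q) • (FreeAlgebra.ι k (.t p m) * FreeAlgebra.ι k (.t q n)))
      (∑ p, ∑ q, R (p, q) (m, n) • (FreeAlgebra.ι k (.t j q) * FreeAlgebra.ι k (.t i p)))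
  | et (j m n : ι) : YBRel R
      (FreeAlgebra.ι k (.E m) * FreeAlgebra.ι k (.t j n))
      (∑ p, ∑ q, R (p, q) (m, n) • (FreeAlgebra.ι k (.t j q) * FreeAlgebra.ι k (.E p)))
  | uu (i j m n : ι) : YBRel R
      (∑ p, ∑ q, R (i, j) (p, q) • (FreeAlgebra.ι k (.u p m) * FreeAlgebra.ι k (.u q n)))
      (∑ p, ∑ q, R (p, q) (m, n) • (FreeAlgebra.ι k (.u j q) * FreeAlgebra.ι k (.u i p)))
  | fu (i j m : ι) : YBRel R
      (FreeAlgebra.ι k (.F j) * FreeAlgebra.ι k (.u i m))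
      (∑ p, ∑ q, R (i, j) (p, q) • (FreeAlgebra.ι k (.u p m) * FreeAlgebra.ι k (.F q)))
  | ut (i j m n : ι) : YBRel R
      (∑ p, ∑ q, R (i, j) (p, q) • (FreeAlgebra.ι k (.u p m) * FreeAlgebra.ι k (.t q n)))
      (∑ p, ∑ q, R (p, q) (m, n) • (FreeAlgebra.ι k (.t j q) * FreeAlgebra.ι k (.u i p)))
  | tf (i j n : ι) : YBRel R
      (FreeAlgebra.ι k (.t j n) * FreeAlgebra.ι k (.F i))
      (∑ p, ∑ q, R (i, j) (p, q) • (FreeAlgebra.ι k (.F p) * FreeAlgebra.ι k (.t q n)))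
  | ef (i j : ι) : YBRel R
      (FreeAlgebra.ι k (.E j) * FreeAlgebra.ι k (.F i) - FreeAlgebra.ι k (.F i) * FreeAlgebra.ι k (.E j))
      (FreeAlgebra.ι k (.t i j) - FreeAlgebra.ι k (.u i j))
  | ue (i m n : ι) : YBRel R
      (FreeAlgebra.ι k (.u i m) * FreeAlgebra.ι k (.E n))
      (∑ p, ∑ q, R (p, q) (m, n) • (FreeAlgebra.ι k (.E q) * FreeAlgebra.ι k (.u i p)))

/-- The Yang-Baxter algebra `Y` generated by `t^i_j`, `E_i`, `u^i_j`, `F^i`. -/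
def YB (R : Matrix (ι × ι) (ι × ι) k) : Type _ := RingQuot (YBRel R)

variable (R : Matrix (ι × ι) (ι × ι) k)

instance : Ring (YB R) := inferInstanceAs (Ring (RingQuot (YBRel R)))
instance : Algebra k (YB R) := inferInstanceAs (Algebra k (RingQuot (YBRel R)))

namespace YB

/-- The quotient map from the free algebra. -/
def mk : FreeAlgebra k (YBGen ι) →ₐ[k] YB R := RingQuot.mkAlgHom k (YBRel R)

variable {R} in
theorem mk_rel {x y : FreeAlgebra k (YBGen ι)} (h : YBRel R x y) : mk R x = mk R y :=
  RingQuot.mkAlgHom_rel k h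

/-- The generator `t^i_j`. -/
def t (i j : ι) : YB R := mk R (FreeAlgebra.ι k (.t i j))

/-- The generator `E_i`. -/
def E (i : ι) : YB R := mk R (FreeAlgebra.ι k (.E i))

/-- The generator `u^i_j`. -/
def u (i j : ι) : YB R := mk R (FreeAlgebra.ι k (.u i j))

/-- The generator `F^i`. -/
def F (i : ι) : YB R := mk R (FreeAlgebra.ι k (.F i))

theorem rel_tt : RelXZ R (t R) (t R) := by
  intro i j m n
  simpa [t] using mk_rel (YBRel.tt (R := R) i j m n)

theorem rel_et : RelET R (E R) (t R) := by
  intro j m n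
  simpa [E, t] using mk_rel (YBRel.et (R := R) j m n)

theorem rel_uu : RelXZ R (u R) (u R) := by
  intro i j m n
  simpa [u] using mk_rel (YBRel.uu (R := R) i j m n)

theorem rel_fu : RelFU R (F R) (u R) := by
  intro i j m
  simpa [F, u] using mk_rel (YBRel.fu (R := R) i j m)

theorem rel_ut : RelXZ R (u R) (t R) := by
  intro i j m n
  simpa [t, u] using mk_rel (YBRel.ut (R := R) i j m n)

theorem rel_tf : RelTF R (t R) (F R) := by
  intro i j n
  simpa [F, t] using mk_rel (YBRel.tf (R := R) i j n)

theorem rel_ef : RelEF (t R) (E R) (u R) (F R) := by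
  intro i j
  simpa [E, F, t, u] using mk_rel (YBRel.ef (R := R) i j)

theorem rel_ue : RelUE R (u R) (E R) := by
  intro i m n
  simpa [E, u] using mk_rel (YBRel.ue (R := R) i m n)

variable {R} {B : Type*} [Ring B] [Algebra k B]

/-- The algebra homomorphism out of `Y` determined by images of generators. -/
def lift (t' : ι → ι → B) (E' : ι → B) (u' : ι → ι → B) (F' : ι → B)
    (h_tt : RelXZ R t' t')
    (h_et : RelET R E' t')
    (h_uu : RelXZ R u' u')
    (h_fu : RelFU R F' u')
    (h_ut : RelXZ R u' t')
    (h_tf : RelTF R t' F')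
    (h_ef : RelEF t' E' u' F')
    (h_ue : RelUE R u' E') :
    YB R →ₐ[k] B :=
  RingQuot.liftAlgHom k
    ⟨FreeAlgebra.lift k (fun g => match g with | .t i j => t' i j | .E i => E' i | .u i j => u' i j | .F i => F' i), by
      rintro _ _ (⟨i, j, m, n⟩ | ⟨j, m, n⟩ | ⟨i, j, m, n⟩ | ⟨i, j, m⟩ | ⟨i, j, m, n⟩ | ⟨i, j, n⟩ | ⟨i, j⟩ | ⟨i, m, n⟩)
      · simpa using h_tt i j m n
      · simpa using h_et j m n
      · simpa using h_uu i j m n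
      · simpa using h_fu i j m
      · simpa using h_ut i j m n
      · simpa using h_tf i j n
      · simpa using h_ef i j
      · simpa using h_ue i m n⟩

theorem lift_t (t' : ι → ι → B) (E' : ι → B) (u' : ι → ι → B) (F' : ι → B)
    (h_tt : RelXZ R t' t')
    (h_et : RelET R E' t')
    (h_uu : RelXZ R u' u')
    (h_fu : RelFU R F' u')
    (h_ut : RelXZ R u' t')
    (h_tf : RelTF R t' F')
    (h_ef : RelEF t' E' u' F')
    (h_ue : RelUE R u' E')
    (i j : ι) : lift t' E' u' F' h_tt h_et h_uu h_fu h_ut h_tf h_ef h_ue (t R i j) = t' i j := by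
  unfold lift t mk
  exact (RingQuot.liftAlgHom_mkAlgHom_apply ..).trans (by simp)

theorem lift_E (t' : ι → ι → B) (E' : ι → B) (u' : ι → ι → B) (F' : ι → B)
    (h_tt : RelXZ R t' t')
    (h_et : RelET R E' t')
    (h_uu : RelXZ R u' u')
    (h_fu : RelFU R F' u')
    (h_ut : RelXZ R u' t')
    (h_tf : RelTF R t' F')
    (h_ef : RelEF t' E' u' F')
    (h_ue : RelUE R u' E')
    (i : ι) : lift t' E' u' F' h_tt h_et h_uu h_fu h_ut h_tf h_ef h_ue (E R i) = E' i := by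
  unfold lift E mk
  exact (RingQuot.liftAlgHom_mkAlgHom_apply ..).trans (by simp)

theorem lift_u (t' : ι → ι → B) (E' : ι → B) (u' : ι → ι → B) (F' : ι → B)
    (h_tt : RelXZ R t' t')
    (h_et : RelET R E' t')
    (h_uu : RelXZ R u' u')
    (h_fu : RelFU R F' u')
    (h_ut : RelXZ R u' t')
    (h_tf : RelTF R t' F')
    (h_ef : RelEF t' E' u' F')
    (h_ue : RelUE R u' E')
    (i j : ι) : lift t' E' u' F' h_tt h_et h_uu h_fu h_ut h_tf h_ef h_ue (u R i j) = u' i j := by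
  unfold lift u mk
  exact (RingQuot.liftAlgHom_mkAlgHom_apply ..).trans (by simp)

theorem lift_F (t' : ι → ι → B) (E' : ι → B) (u' : ι → ι → B) (F' : ι → B)
    (h_tt : RelXZ R t' t')
    (h_et : RelET R E' t')
    (h_uu : RelXZ R u' u')
    (h_fu : RelFU R F' u')
    (h_ut : RelXZ R u' t')
    (h_tf : RelTF R t' F')
    (h_ef : RelEF t' E' u' F')
    (h_ue : RelUE R u' E')
    (i : ι) : lift t' E' u' F' h_tt h_et h_uu h_fu h_ut h_tf h_ef h_ue (F R i) = F' i := by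
  unfold lift F mk
  exact (RingQuot.liftAlgHom_mkAlgHom_apply ..).trans (by simp)

theorem algHom_ext {f g : YB R →ₐ[k] B} (h_t : ∀ i j, f (t R i j) = g (t R i j))
    (h_E : ∀ i, f (E R i) = g (E R i))
    (h_u : ∀ i j, f (u R i j) = g (u R i j))
    (h_F : ∀ i, f (F R i) = g (F R i)) : f = g := by
  refine RingQuot.ringQuot_ext' k f g (FreeAlgebra.hom_ext (funext fun x => ?_))
  cases x with
  | t i j => exact h_t i j
  | E i => exact h_E i
  | u i j => exact h_u i j
  | F i => exact h_F i

variable (R)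

/-- `Δ(T) = T ⊗ T`, `Δ(E) = E ⊗ T + 1 ⊗ E`, `Δ(U) = U ⊗ U`, `Δ(F) = F ⊗ 1 + U ⊗ F`. -/
def comulHom : YB R →ₐ[k] YB R ⊗[k] YB R :=
  lift (fun i j => ∑ a, t R i a ⊗ₜ t R a j)
    (fun i => ∑ a, E R a ⊗ₜ t R a i + 1 ⊗ₜ E R i)
    (fun i j => ∑ a, u R i a ⊗ₜ u R a j)
    (fun i => F R i ⊗ₜ 1 + ∑ a, u R i a ⊗ₜ F R a)
    (by
      have h := RelXZ.comul
          ((rel_tt R).map (Algebra.TensorProduct.includeLeft (R := k) (S := k) (A := YB R) (B := YB R)))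
          ((rel_tt R).map (Algebra.TensorProduct.includeRight (R := k) (A := YB R) (B := YB R)))
          (by simp) (by simp)
      simpa [dot_def] using h)
    (by
      have h := RelET.comul
          ((rel_et R).map (Algebra.TensorProduct.includeLeft (R := k) (S := k) (A := YB R) (B := YB R)))
          ((rel_et R).map (Algebra.TensorProduct.includeRight (R := k) (A := YB R) (B := YB R)))
          ((rel_tt R).map (Algebra.TensorProduct.includeRight (R := k) (A := YB R) (B := YB R)))
          (by simp) (by simp) (by simp)
      simpa [dot_def] using h)
    (by
      have h := RelXZ.comul
          ((rel_uu R).map (Algebra.TensorProduct.includeLeft (R := k) (S := k) (A := YB R) (B := YB R)))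
          ((rel_uu R).map (Algebra.TensorProduct.includeRight (R := k) (A := YB R) (B := YB R)))
          (by simp) (by simp)
      simpa [dot_def] using h)
    (by
      have h := RelFU.comul
          ((rel_fu R).map (Algebra.TensorProduct.includeLeft (R := k) (S := k) (A := YB R) (B := YB R)))
          ((rel_fu R).map (Algebra.TensorProduct.includeRight (R := k) (A := YB R) (B := YB R)))
          ((rel_uu R).map (Algebra.TensorProduct.includeLeft (R := k) (S := k) (A := YB R) (B := YB R)))
          (by simp) (by simp) (by simp)
      simpa [dot_def] using h)
    (by
      have h := RelXZ.comul
          ((rel_ut R).map (Algebra.TensorProduct.includeLeft (R := k) (S := k) (A := YB R) (B := YB R)))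
          ((rel_ut R).map (Algebra.TensorProduct.includeRight (R := k) (A := YB R) (B := YB R)))
          (by simp) (by simp)
      simpa [dot_def] using h)
    (by
      have h := RelTF.comul
          ((rel_tf R).map (Algebra.TensorProduct.includeLeft (R := k) (S := k) (A := YB R) (B := YB R)))
          ((rel_tf R).map (Algebra.TensorProduct.includeRight (R := k) (A := YB R) (B := YB R)))
          ((rel_ut R).map (Algebra.TensorProduct.includeLeft (R := k) (S := k) (A := YB R) (B := YB R)))
          (by simp) (by simp) (by simp)
      simpa [dot_def] using h)
    (by
      have h := RelEF.comul
          ((rel_ef R).map (Algebra.TensorProduct.includeLeft (R := k) (S := k) (A := YB R) (B := YB R)))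
          ((rel_ef R).map (Algebra.TensorProduct.includeRight (R := k) (A := YB R) (B := YB R)))
          ((rel_ue R).map (Algebra.TensorProduct.includeLeft (R := k) (S := k) (A := YB R) (B := YB R)))
          ((rel_tf R).map (Algebra.TensorProduct.includeRight (R := k) (A := YB R) (B := YB R)))
          (by simp) (by simp) (by simp) (by simp) (by simp)
      simpa [dot_def] using h)
    (by
      have h := RelUE.comul
          ((rel_ue R).map (Algebra.TensorProduct.includeLeft (R := k) (S := k) (A := YB R) (B := YB R)))
          ((rel_ue R).map (Algebra.TensorProduct.includeRight (R := k) (A := YB R) (B := YB R)))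
          ((rel_ut R).map (Algebra.TensorProduct.includeRight (R := k) (A := YB R) (B := YB R)))
          (by simp) (by simp) (by simp)
      simpa [dot_def] using h)

@[simp] theorem comulHom_t (i j : ι) :
    comulHom R (t R i j) = ∑ a, t R i a ⊗ₜ t R a j := lift_t ..

@[simp] theorem comulHom_E (i : ι) :
    comulHom R (E R i) = ∑ a, E R a ⊗ₜ t R a i + 1 ⊗ₜ E R i := lift_E ..

@[simp] theorem comulHom_u (i j : ι) :
    comulHom R (u R i j) = ∑ a, u R i a ⊗ₜ u R a j := lift_u ..

@[simp] theorem comulHom_F (i : ι) :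
    comulHom R (F R i) = F R i ⊗ₜ 1 + ∑ a, u R i a ⊗ₜ F R a := lift_F ..

variable [DecidableEq ι]

/-- `ε(T) = 1`, `ε(E) = 0`, `ε(U) = 1`, `ε(F) = 0`. -/
def counitHom : YB R →ₐ[k] k :=
  lift (fun i j => if i = j then 1 else 0) (fun _ => 0) (fun i j => if i = j then 1 else 0) (fun _ => 0)
    (by intro i j m n; simp)
    (by intro j m n; simp)
    (by intro i j m n; simp)
    (by intro i j m; simp)
    (by intro i j m n; simp)
    (by intro i j n; simp)
    (by intro i j; simp)
    (by intro i m n; simp)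

@[simp] theorem counitHom_t (i j : ι) : counitHom R (t R i j) = (if i = j then 1 else 0) := lift_t ..

@[simp] theorem counitHom_E (i : ι) : counitHom R (E R i) = 0 := lift_E ..

@[simp] theorem counitHom_u (i j : ι) : counitHom R (u R i j) = (if i = j then 1 else 0) := lift_u ..

@[simp] theorem counitHom_F (i : ι) : counitHom R (F R i) = 0 := lift_F ..

instance : Bialgebra k (YB R) :=
  Bialgebra.ofAlgHom (comulHom R) (counitHom R)
    (by
      apply algHom_ext
      · intro i j
        simp [TensorProduct.sum_tmul, TensorProduct.tmul_sum]
        rw [Finset.sum_comm]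
      · intro i
        simp [TensorProduct.sum_tmul, TensorProduct.tmul_sum, TensorProduct.add_tmul,
          TensorProduct.tmul_add, Finset.sum_add_distrib, Algebra.TensorProduct.one_def, add_assoc]
        rw [Finset.sum_comm]
      · intro i j
        simp [TensorProduct.sum_tmul, TensorProduct.tmul_sum]
        rw [Finset.sum_comm]
      · intro i
        simp [TensorProduct.sum_tmul, TensorProduct.tmul_sum, TensorProduct.add_tmul,
          TensorProduct.tmul_add, Finset.sum_add_distrib, Algebra.TensorProduct.one_def, add_assoc]
        rw [Finset.sum_comm])
    (by
      apply algHom_ext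
      · intro i j
        simp [TensorProduct.ite_tmul]
      · intro i
        simp
      · intro i j
        simp [TensorProduct.ite_tmul]
      · intro i
        simp [TensorProduct.ite_tmul])
    (by
      apply algHom_ext
      · intro i j
        simp [TensorProduct.tmul_ite]
      · intro i
        simp [TensorProduct.tmul_ite]
      · intro i j
        simp [TensorProduct.tmul_ite]
      · intro i
        simp)

theorem comul_t (i j : ι) : Coalgebra.comul (R := k) (t R i j) =
    ∑ a, t R i a ⊗ₜ t R a j := comulHom_t R i j

theorem counit_t (i j : ι) : Coalgebra.counit (R := k) (t R i j) = (if i = j then 1 else 0) :=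
  counitHom_t R i j

theorem comul_E (i : ι) : Coalgebra.comul (R := k) (E R i) =
    ∑ a, E R a ⊗ₜ t R a i + 1 ⊗ₜ E R i := comulHom_E R i

theorem counit_E (i : ι) : Coalgebra.counit (R := k) (E R i) = 0 :=
  counitHom_E R i

theorem comul_u (i j : ι) : Coalgebra.comul (R := k) (u R i j) =
    ∑ a, u R i a ⊗ₜ u R a j := comulHom_u R i j

theorem counit_u (i j : ι) : Coalgebra.counit (R := k) (u R i j) = (if i = j then 1 else 0) :=
  counitHom_u R i j

theorem comul_F (i : ι) : Coalgebra.comul (R := k) (F R i) =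
    F R i ⊗ₜ 1 + ∑ a, u R i a ⊗ₜ F R a := comulHom_F R i

theorem counit_F (i : ι) : Coalgebra.counit (R := k) (F R i) = 0 :=
  counitHom_F R i

end YB

end YB

/-! ### Generator values of pairings -/

section Values

variable {k ι : Type*} [CommRing k] [Fintype ι] [DecidableEq ι]

/-- The pairing of `Y₊` and `Y₋` has the values `⟨U₁, T₂⟩ = M₁₂`, `⟨1, T⟩ = 1`, `⟨U, 1⟩ = 1`,
`⟨F^i, E_j⟩ = c δ^i_j` on generators, and all other pairings between generators (and `1`) vanish. -/
structure HasGeneratorValues (R M : Matrix (ι × ι) (ι × ι) k) (c : k)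
    (P : YPlus R →ₗ[k] YMinus R →ₗ[k] k) : Prop where
  u_t : ∀ i j m n, P (YPlus.u R i m) (YMinus.t R j n) = M (i, j) (m, n)
  one_t : ∀ i j, P 1 (YMinus.t R i j) = if i = j then 1 else 0
  u_one : ∀ i j, P (YPlus.u R i j) 1 = if i = j then 1 else 0
  F_E : ∀ i j, P (YPlus.F R i) (YMinus.E R j) = if i = j then c else 0
  u_E : ∀ i j m, P (YPlus.u R i j) (YMinus.E R m) = 0
  F_t : ∀ i j m, P (YPlus.F R m) (YMinus.t R i j) = 0
  one_E : ∀ i, P 1 (YMinus.E R i) = 0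
  F_one : ∀ i, P (YPlus.F R i) 1 = 0

end Values

end YangBaxter

end

/-! Write `H` for `Y₊` and `A` for `Y₋`. Everything about the actions takes place in the convolution
algebras of linear maps `H ⊗ A → B`, with `B` an algebra. There a form becomes a scalar valued
element `scal`, and maps out of `H` and out of `A` become `onLeft` and `onRight`. If `Q` is the
convolution inverse of `P`, both actions are conjugation by `P`: `▷` is `Q * onRight * P` and `◁` is
`Q * onLeft * P`. In `(x₁ ▷ a₁) ⊗ (x₂ ◁ a₂)` the inner `P * Q` cancels, which leaves `Q(x₁, a₁) a₂ ⊗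
x₂ P(x₃, a₃)` (`map_crossMap`).

This suggests letting `H` act on `A ⊗ H` by `x · (a ⊗ y) = Q(x₁, a₁) a₂ ⊗ x₂ y P(x₃, a₃)`. This
operator `crossOp` is the convolution product of three commuting algebra homomorphisms, hence again
a homomorphism. Let `A` act by left multiplication. The two actions satisfy the exchange rule
`onLeft_crossOp_mul`, and `x · (a ⊗ 1) = (x₁ ▷ a₁) ⊗ (x₂ ◁ a₂)`. The module and multiplicativity
axioms of a matched pair follow by applying a counit to one leg; the axioms on `Δ`, `ε` and the
compatibility are cancellations of `P * Q` or `Q * P`. This is `isMatchedPair`, valid for any skew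
pairing with an inverse that is an opposite skew pairing.

The generators of `Y₊` and the entries `0, 1` form one matrix coalgebra `W`, and likewise for `Y₋`.
A skew pairing is an algebra homomorphism from `H` to the convolution dual of `A`, so it can be
built from matrix entries of representations of `A`. The Yang–Baxter equation enters twice: it makes
the prescribed matrices a representation, and it makes `R` intertwine two tensor products of
representations, which is the relations of `H` among the matrix entries (`exists_skewPairing`). The
opposite pairing arises in the same way with the roles of `Y₊` and `Y₋` exchanged and `R⁻¹` for `R`
in the representations. Uniqueness and inverseness are checked on generators, first in one variable
and then in the other.

For `Y`, the exchange rule evaluated on the two matrix coalgebras is the list of cross relations, so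
`Y` acts on `A ⊗ H`. Evaluation of this action at `1 ⊗ 1` is a left inverse of the multiplication
map `A ⊗ H → Y`, which proves injectivity without constructing the double crossproduct beforehand.
Surjectivity (`mulMap_incl_surjective`) is a reordering argument in which the invertibility of `R`
moves `T` to the left of `U` and `F`. The product formula is then read off from the action. -/

open scoped TensorProduct

noncomputable section

namespace YangBaxter

open Coalgebra WithConv

/-! ### Convolution calculus on `H ⊗ A` -/

section Convolution

variable {k : Type*} [CommRing k]

section Basic

variable {C B B' : Type*} [AddCommGroup C] [Module k C] [Coalgebra k C] [Ring B] [Algebra k B]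
  [Ring B'] [Algebra k B']

/-- Postcomposition with an algebra homomorphism is multiplicative for convolution. -/
theorem toConv_algHom_comp_mul (φ : B →ₐ[k] B') (f g : WithConv (C →ₗ[k] B)) :
    toConv (φ.toLinearMap ∘ₗ (f * g).ofConv) =
      toConv (φ.toLinearMap ∘ₗ f.ofConv) * toConv (φ.toLinearMap ∘ₗ g.ofConv) := by
  rw [LinearMap.algHom_comp_convMul_distrib, toConv_ofConv]

variable (B) in
/-- A scalar valued map, as a `B`-valued map. -/
def ofScalar (p : C →ₗ[k] k) : WithConv (C →ₗ[k] B) := toConv (Algebra.linearMap k B ∘ₗ p)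

set_option linter.unusedSectionVars false in
@[simp] theorem ofScalar_apply (p : C →ₗ[k] k) (c : C) : ofScalar B p c = algebraMap k B (p c) := rfl

theorem ofScalar_mul (p q : WithConv (C →ₗ[k] k)) :
    ofScalar B (p * q).ofConv = ofScalar B p.ofConv * ofScalar B q.ofConv :=
  toConv_algHom_comp_mul (Algebra.ofId k B) p q

/-- Postcomposition with a linear map commutes with left multiplication by scalar valued maps. -/
theorem toConv_linear_comp_ofScalar_mul (θ : B →ₗ[k] B') (p : C →ₗ[k] k)
    (f : WithConv (C →ₗ[k] B)) :
    toConv (θ ∘ₗ (ofScalar B p * f).ofConv) = ofScalar B' p * toConv (θ ∘ₗ f.ofConv) := by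
  ext c
  simp [(ℛ k c).convMul_apply, ← Algebra.smul_def]

/-- Postcomposition with a linear map commutes with right multiplication by scalar valued maps. -/
theorem toConv_linear_comp_mul_ofScalar (θ : B →ₗ[k] B') (p : C →ₗ[k] k)
    (f : WithConv (C →ₗ[k] B)) :
    toConv (θ ∘ₗ (f * ofScalar B p).ofConv) = toConv (θ ∘ₗ f.ofConv) * ofScalar B' p := by
  ext c
  simp [(ℛ k c).convMul_apply, ← Algebra.commutes, ← Algebra.smul_def]

end Basic

section CommProd

variable {H B : Type*} [Ring H] [Bialgebra k H] [Ring B] [Algebra k B]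

/-- The convolution product of two algebra homomorphisms with commuting images. -/
def commProd (f g : H →ₐ[k] B) (hc : ∀ x y, Commute (f x) (g y)) : H →ₐ[k] B :=
  (Algebra.TensorProduct.lift f g hc).comp (Bialgebra.comulAlgHom k H)

theorem toConv_commProd (f g : H →ₐ[k] B) (hc : ∀ x y, Commute (f x) (g y)) :
    toConv (commProd f g hc).toLinearMap = toConv f.toLinearMap * toConv g.toLinearMap := by
  ext x
  have := (ℛ k x).eq
  simp [(ℛ k x).convMul_apply, commProd, ← this]

theorem commProd_apply {ι : Type*} (f g : H →ₐ[k] B) (hc : ∀ x y, Commute (f x) (g y)) {x : H}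
    (r : Coalgebra.Repr k x ι) :
    commProd f g hc x = ∑ i ∈ r.index, f (r.left i) * g (r.right i) := by
  simp [commProd, Bialgebra.comulAlgHom_apply, ← r.eq]

theorem commute_commProd (f g : H →ₐ[k] B) (hc : ∀ x y, Commute (f x) (g y)) (x : H) (b : B)
    (hf : ∀ x, Commute (f x) b) (hg : ∀ x, Commute (g x) b) : Commute (commProd f g hc x) b := by
  rw [commProd_apply f g hc (ℛ k x)]
  exact Commute.sum_left _ _ _ fun i _ => (hf _).mul_left (hg _)

end CommProd

variable {H A B B' : Type*} [Ring H] [Bialgebra k H] [Ring A] [Bialgebra k A] [Ring B] [Algebra k B]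
  [Ring B'] [Algebra k B']

variable (B) in
/-- A bilinear form on `H × A`, as a `B`-valued map on `H ⊗ A`. -/
def scal (P : H →ₗ[k] A →ₗ[k] k) : WithConv (H ⊗[k] A →ₗ[k] B) :=
  ofScalar B (TensorProduct.lift P)

variable (A) in
/-- The projection coalgebra homomorphism `x ⊗ a ↦ ε(a) x`. -/
def projLeft : H ⊗[k] A →ₗc[k] H :=
  (Coalgebra.TensorProduct.rid k k H).toCoalgHom.comp
    (Coalgebra.TensorProduct.map (CoalgHom.id k H) (Coalgebra.counitCoalgHom k A))

variable (H) in
/-- The projection coalgebra homomorphism `x ⊗ a ↦ ε(x) a`. -/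
def projRight : H ⊗[k] A →ₗc[k] A :=
  (Coalgebra.TensorProduct.lid k A).toCoalgHom.comp
    (Coalgebra.TensorProduct.map (Coalgebra.counitCoalgHom k H) (CoalgHom.id k A))

variable (A) in
/-- `x ⊗ a ↦ ε(a) g(x)`. -/
def onLeft (g : H →ₗ[k] B) : WithConv (H ⊗[k] A →ₗ[k] B) :=
  toConv (g ∘ₗ (projLeft (k := k) (H := H) A).toLinearMap)

variable (H) in
/-- `x ⊗ a ↦ ε(x) f(a)`. -/
def onRight (f : A →ₗ[k] B) : WithConv (H ⊗[k] A →ₗ[k] B) :=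
  toConv (f ∘ₗ (projRight (k := k) (A := A) H).toLinearMap)

@[simp] theorem scal_tmul (P : H →ₗ[k] A →ₗ[k] k) (x : H) (a : A) :
    scal B P (x ⊗ₜ a) = algebraMap k B (P x a) := rfl

@[simp] theorem onLeft_tmul (g : H →ₗ[k] B) (x : H) (a : A) :
    onLeft A g (x ⊗ₜ a) = counit (R := k) a • g x := by
  simp [onLeft, projLeft]

@[simp] theorem onRight_tmul (f : A →ₗ[k] B) (x : H) (a : A) :
    onRight H f (x ⊗ₜ a) = counit (R := k) x • f a := by
  simp [onRight, projRight]

theorem onLeft_mul (f g : WithConv (H →ₗ[k] B)) :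
    onLeft A (f * g).ofConv = onLeft A f.ofConv * onLeft A g.ofConv := by
  simp only [onLeft, LinearMap.convMul_comp_coalgHom_distrib, toConv_ofConv]

theorem onRight_mul (f g : WithConv (A →ₗ[k] B)) :
    onRight H (f * g).ofConv = onRight H f.ofConv * onRight H g.ofConv := by
  simp only [onRight, LinearMap.convMul_comp_coalgHom_distrib, toConv_ofConv]

theorem conv_ext {f g : WithConv (H ⊗[k] A →ₗ[k] B)} (h : ∀ x a, f (x ⊗ₜ a) = g (x ⊗ₜ a)) :
    f = g := by
  ext x a
  exact h x a

theorem conv_tmul (f g : WithConv (H ⊗[k] A →ₗ[k] B)) {x : H} {a : A} {ι κ : Type*}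
    (r : Coalgebra.Repr k x ι) (s : Coalgebra.Repr k a κ) :
    (f * g) (x ⊗ₜ a) = ∑ i ∈ r.index, ∑ j ∈ s.index,
      f (r.left i ⊗ₜ s.left j) * g (r.right i ⊗ₜ s.right j) := by
  rw [(r.tmul s).convMul_apply]
  simp [Finset.sum_product]

/-- `Σ ε(x₁) f(x₂) = f(x)`. -/
theorem sum_counit_smul_map {M N : Type*} [AddCommGroup M] [Module k M] [Coalgebra k M]
    [AddCommGroup N] [Module k N] (f : M →ₗ[k] N) {x : M} {ι : Type*} (r : Coalgebra.Repr k x ι) :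
    ∑ i ∈ r.index, counit (R := k) (r.left i) • f (r.right i) = f x := by
  conv_rhs => rw [← sum_counit_smul r]
  simp

/-- `Σ ε(x₂) f(x₁) = f(x)`. -/
theorem sum_counit_right_smul_map {M N : Type*} [AddCommGroup M] [Module k M] [Coalgebra k M]
    [AddCommGroup N] [Module k N] (f : M →ₗ[k] N) {x : M} {ι : Type*} (r : Coalgebra.Repr k x ι) :
    ∑ i ∈ r.index, counit (R := k) (r.right i) • f (r.left i) = f x := by
  have := congrArg (TensorProduct.rid k N) (sum_map_tmul_counit_eq (R := k) f x (repr := r))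
  simpa only [map_sum, TensorProduct.rid_tmul, one_smul] using this

/-- The counits inside `onLeft` and `onRight` absorb the coproducts, so the order of convolution is
the order of multiplication in `B`. Commutation rules between images of `H` and of `A` thus become
identities that compare this product with the one in `onLeft_mul_onRight_tmul`. -/
theorem onRight_mul_onLeft_tmul (f : A →ₗ[k] B) (g : H →ₗ[k] B) (x : H) (a : A) :
    (onRight H f * onLeft A g) (x ⊗ₜ a) = f a * g x := by
  rw [conv_tmul _ _ (ℛ k x) (ℛ k a)]
  simp only [onRight_tmul, onLeft_tmul, smul_mul_smul_comm]
  conv_rhs => rw [← sum_counit_smul_map g (ℛ k x), ← sum_counit_right_smul_map f (ℛ k a)]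
  rw [Finset.sum_mul_sum, Finset.sum_comm]
  simp [smul_smul]

theorem onLeft_mul_onRight_tmul (f : A →ₗ[k] B) (g : H →ₗ[k] B) (x : H) (a : A) :
    (onLeft A g * onRight H f) (x ⊗ₜ a) = g x * f a := by
  rw [conv_tmul _ _ (ℛ k x) (ℛ k a)]
  simp only [onRight_tmul, onLeft_tmul, smul_mul_smul_comm]
  conv_rhs => rw [← sum_counit_right_smul_map g (ℛ k x), ← sum_counit_smul_map f (ℛ k a)]
  rw [Finset.sum_mul_sum]
  simp [smul_smul, mul_comm]

theorem contractFirst_apply (f : A →ₗ[k] k) {a : A} {ι : Type*} (s : Coalgebra.Repr k a ι) :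
    contractFirst f a = ∑ i ∈ s.index, f (s.left i) • s.right i := by
  simp [contractFirst, ← s.eq]

theorem contractLast_apply (f : A →ₗ[k] k) {a : A} {ι : Type*} (s : Coalgebra.Repr k a ι) :
    contractLast f a = ∑ i ∈ s.index, f (s.right i) • s.left i := by
  simp [contractLast, ← s.eq]

theorem twoSided_apply (Q P : H →ₗ[k] A →ₗ[k] k) {x : H} {ι : Type*} (r : Coalgebra.Repr k x ι)
    (a : A) : twoSided Q P x a =
      ∑ i ∈ r.index, contractFirst (Q (r.left i)) (contractLast (P (r.right i)) a) := by
  simp [twoSided, ← r.eq]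

theorem tensorForm_apply (Q P : H →ₗ[k] A →ₗ[k] k) {x : H} {a : A} {ι κ : Type*}
    (r : Coalgebra.Repr k x ι) (s : Coalgebra.Repr k a κ) :
    tensorForm Q P (comul x) (comul a) = ∑ i ∈ r.index, ∑ j ∈ s.index,
      Q (r.left i) (s.left j) * P (r.right i) (s.right j) := by
  simp [tensorForm, ← r.eq, ← s.eq]
  exact Finset.sum_comm

theorem scal_mul_scal_tmul (Q P : H →ₗ[k] A →ₗ[k] k) (x : H) (a : A) :
    (scal B Q * scal B P) (x ⊗ₜ a) = algebraMap k B (tensorForm Q P (comul x) (comul a)) := by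
  rw [conv_tmul _ _ (ℛ k x) (ℛ k a), tensorForm_apply _ _ (ℛ k x) (ℛ k a)]
  simp

theorem scal_mul_onRight_tmul (Q : H →ₗ[k] A →ₗ[k] k) (f : A →ₗ[k] B) (x : H) (a : A) :
    (scal B Q * onRight H f) (x ⊗ₜ a) = f (contractFirst (Q x) a) := by
  rw [conv_tmul _ _ (ℛ k x) (ℛ k a), contractFirst_apply _ (ℛ k a), Finset.sum_comm]
  simp only [scal_tmul, onRight_tmul, map_sum, map_smul]
  refine Finset.sum_congr rfl fun j _ => ?_
  have := sum_counit_right_smul_map (Q.flip ((ℛ k a).left j)) (ℛ k x)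
  simp only [LinearMap.flip_apply] at this
  rw [← this, Finset.sum_smul]
  simp [← Algebra.smul_def, smul_smul]

theorem scal_mul_onLeft_tmul (Q : H →ₗ[k] A →ₗ[k] k) (g : H →ₗ[k] B) (x : H) (a : A) :
    (scal B Q * onLeft A g) (x ⊗ₜ a) = g (contractFirst (Q.flip a) x) := by
  rw [conv_tmul _ _ (ℛ k x) (ℛ k a), contractFirst_apply _ (ℛ k x)]
  simp only [scal_tmul, onLeft_tmul, map_sum, map_smul]
  refine Finset.sum_congr rfl fun j _ => ?_
  have := sum_counit_right_smul_map (Q ((ℛ k x).left j)) (ℛ k a)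
  rw [LinearMap.flip_apply, ← this, Finset.sum_smul]
  simp [← Algebra.smul_def, smul_smul]

/-- When `Q` inverts `P`, this exhibits `▷` as the conjugate by `P` of the projection to `A`; the
next lemma does the same for `◁` and the projection to `H`. -/
theorem scal_mul_onRight_mul_scal_tmul (Q P : H →ₗ[k] A →ₗ[k] k) (f : A →ₗ[k] B) (x : H) (a : A) :
    (scal B Q * onRight H f * scal B P) (x ⊗ₜ a) = f (leftAction Q P x a) := by
  rw [conv_tmul _ _ (ℛ k x) (ℛ k a), leftAction, twoSided_apply _ _ (ℛ k x)]
  simp only [contractLast_apply _ (ℛ k a), map_sum, map_smul, scal_mul_onRight_tmul, scal_tmul]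
  simp [← Algebra.commutes, ← Algebra.smul_def]

theorem scal_mul_onLeft_mul_scal_tmul (Q P : H →ₗ[k] A →ₗ[k] k) (g : H →ₗ[k] B) (x : H) (a : A) :
    (scal B Q * onLeft A g * scal B P) (x ⊗ₜ a) = g (rightAction Q P x a) := by
  rw [conv_tmul _ _ (ℛ k x) (ℛ k a), rightAction, LinearMap.flip_apply,
    twoSided_apply _ _ (ℛ k a), Finset.sum_comm]
  simp only [contractLast_apply _ (ℛ k x), map_sum, map_smul, scal_mul_onLeft_tmul, scal_tmul]
  simp [← Algebra.commutes, ← Algebra.smul_def]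

/-- Brings the two-legged expressions of the matched pair axioms into the convolution algebra, with
values in `X ⊗ Y`. -/
theorem map₂_comul_comul {X Y : Type*} [Ring X] [Algebra k X] [Ring Y] [Algebra k Y]
    (f : H →ₗ[k] A →ₗ[k] X) (g : H →ₗ[k] A →ₗ[k] Y) (x : H) (a : A) :
    TensorProduct.map₂ f g (comul x) (comul a) =
      (toConv ((Algebra.TensorProduct.includeLeft : X →ₐ[k] X ⊗[k] Y).toLinearMap ∘ₗ
          TensorProduct.lift f) *
        toConv ((Algebra.TensorProduct.includeRight : Y →ₐ[k] X ⊗[k] Y).toLinearMap ∘ₗ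
          TensorProduct.lift g)) (x ⊗ₜ a) := by
  rw [conv_tmul _ _ (ℛ k x) (ℛ k a)]
  simp [← (ℛ k x).eq, ← (ℛ k a).eq]
  exact Finset.sum_comm

end Convolution

/-! ### The one-sided actions defined by a pairing -/

section SkewPairing

variable {k : Type*} [CommRing k]

section Contraction

variable {A : Type*} [Ring A] [Bialgebra k A]

/-- Contractions are convolutions with the identity, so the composition rules below reduce to
associativity of convolution. -/
theorem toConv_contractFirst (f : A →ₗ[k] k) :
    toConv (contractFirst f) = ofScalar A f * toConv LinearMap.id := by
  ext a
  simp [(ℛ k a).convMul_apply, contractFirst_apply f (ℛ k a), ← Algebra.smul_def]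

theorem toConv_contractLast (f : A →ₗ[k] k) :
    toConv (contractLast f) = toConv LinearMap.id * ofScalar A f := by
  ext a
  simp [(ℛ k a).convMul_apply, contractLast_apply f (ℛ k a), ← Algebra.commutes,
    ← Algebra.smul_def]

/-- The functional applied first consumes the leftmost leg, hence the reversal of order. It cancels
the reversal in `Q(xy, ·) = Q(y, ·) * Q(x, ·)`, which is why `firstHom` is a homomorphism and not an
antihomomorphism. -/
theorem contractFirst_convMul (f g : WithConv (A →ₗ[k] k)) :
    contractFirst (f * g).ofConv = contractFirst g.ofConv * contractFirst f.ofConv := by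
  apply toConv_injective
  have h := toConv_linear_comp_ofScalar_mul (contractFirst g.ofConv) f.ofConv
    (toConv (LinearMap.id : A →ₗ[k] A))
  rw [← toConv_contractFirst, ofConv_toConv, ofConv_toConv, LinearMap.comp_id,
    toConv_contractFirst g.ofConv, ← mul_assoc, ← ofScalar_mul, ← toConv_contractFirst] at h
  exact h.symm

theorem contractLast_convMul (f g : WithConv (A →ₗ[k] k)) :
    contractLast (f * g).ofConv = contractLast f.ofConv * contractLast g.ofConv := by
  apply toConv_injective
  have h := toConv_linear_comp_mul_ofScalar (contractLast f.ofConv) g.ofConv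
    (toConv (LinearMap.id : A →ₗ[k] A))
  rw [← toConv_contractLast, ofConv_toConv, ofConv_toConv, LinearMap.comp_id,
    toConv_contractLast f.ofConv, mul_assoc, ← ofScalar_mul, ← toConv_contractLast] at h
  exact h.symm

/-- Coassociativity: both composites are `f * id * g`. -/
theorem commute_contractFirst_contractLast (f g : A →ₗ[k] k) :
    Commute (contractFirst f) (contractLast g) := by
  apply toConv_injective
  have h := toConv_linear_comp_ofScalar_mul (contractLast g) f (toConv (LinearMap.id : A →ₗ[k] A))
  have h' := toConv_linear_comp_mul_ofScalar (contractFirst f) g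
    (toConv (LinearMap.id : A →ₗ[k] A))
  rw [← toConv_contractFirst, ofConv_toConv, ofConv_toConv, LinearMap.comp_id,
    toConv_contractLast, ← mul_assoc] at h
  rw [← toConv_contractLast, ofConv_toConv, ofConv_toConv, LinearMap.comp_id,
    toConv_contractFirst, ← h] at h'
  exact h'

theorem contractFirst_counit : contractFirst (counit (R := k) (A := A)) = 1 := by
  ext a
  rw [contractFirst_apply _ (ℛ k a)]
  exact sum_counit_smul _

theorem contractLast_counit : contractLast (counit (R := k) (A := A)) = 1 := by
  ext a
  rw [contractLast_apply _ (ℛ k a)]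
  exact sum_counit_right_smul_map LinearMap.id _

end Contraction

variable {H A : Type*} [Ring H] [Bialgebra k H] [Ring A] [Bialgebra k A]
  {P Q : H →ₗ[k] A →ₗ[k] k}

theorem tensorForm_tmul_comul (x y : H) (a : A) : tensorForm P Q (x ⊗ₜ y) (comul a) =
    (toConv (P x) * toConv (Q y)) a := by
  simp [(ℛ k a).convMul_apply, tensorForm, ← (ℛ k a).eq]

theorem tensorForm_comul_tmul (x : H) (a b : A) {ι : Type*} (r : Coalgebra.Repr k x ι) :
    tensorForm P Q (comul x) (a ⊗ₜ b) = ∑ i ∈ r.index, P (r.left i) a * Q (r.right i) b := by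
  simp [tensorForm, ← r.eq]

theorem IsSkewPairing.toConv_mul (hP : IsSkewPairing P) (x y : H) :
    toConv (P (x * y)) = toConv (P x) * toConv (P y) := by
  ext a
  exact (hP.mul_left x y a).trans (tensorForm_tmul_comul x y a)

theorem IsOppositeSkewPairing.toConv_mul (hQ : IsOppositeSkewPairing Q) (x y : H) :
    toConv (Q (x * y)) = toConv (Q y) * toConv (Q x) := by
  ext a
  exact (hQ.mul_left x y a).trans (tensorForm_tmul_comul y x a)

/-- The action `x ↦ (a ↦ Q(x, a₁) a₂)`. -/
def IsOppositeSkewPairing.firstHom (hQ : IsOppositeSkewPairing Q) : H →ₐ[k] Module.End k A :=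
  AlgHom.ofLinearMap (contractFirst ∘ₗ Q)
    (by
      rw [LinearMap.comp_apply, show Q 1 = counit from LinearMap.ext hQ.one_left,
        contractFirst_counit])
    (fun x y => by
      rw [LinearMap.comp_apply, ← ofConv_toConv (Q (x * y)), hQ.toConv_mul, contractFirst_convMul]
      rfl)

/-- The action `x ↦ (a ↦ a₁ P(x, a₂))`. -/
def IsSkewPairing.lastHom (hP : IsSkewPairing P) : H →ₐ[k] Module.End k A :=
  AlgHom.ofLinearMap (contractLast ∘ₗ P)
    (by
      rw [LinearMap.comp_apply, show P 1 = counit from LinearMap.ext hP.one_left,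
        contractLast_counit])
    (fun x y => by
      rw [LinearMap.comp_apply, ← ofConv_toConv (P (x * y)), hP.toConv_mul, contractLast_convMul]
      rfl)

theorem IsOppositeSkewPairing.firstHom_apply (hQ : IsOppositeSkewPairing Q) (x : H) (a : A) :
    hQ.firstHom x a = contractFirst (Q x) a := rfl

theorem IsSkewPairing.lastHom_apply (hP : IsSkewPairing P) (x : H) (a : A) :
    hP.lastHom x a = contractLast (P x) a := rfl

/-- Since `Q(x, a₁ b₁) = Q(x₁, a₁) Q(x₂, b₁)`, the scalar carries the first legs of `x` and `a`. For
`P` the order is reversed and the scalar carries the last legs. In the exchange rule the factor `Q`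
therefore appears on the left and `P` on the right. -/
theorem IsOppositeSkewPairing.firstHom_apply_mul (hQ : IsOppositeSkewPairing Q) (a b : A) {x : H}
    {ι κ : Type*} (r : Coalgebra.Repr k x ι) (s : Coalgebra.Repr k a κ) :
    hQ.firstHom x (a * b) = ∑ i ∈ r.index, ∑ j ∈ s.index,
      Q (r.left i) (s.left j) • (s.right j * hQ.firstHom (r.right i) b) := by
  simp only [hQ.firstHom_apply, contractFirst_apply _ (s.mul (ℛ k b)),
    contractFirst_apply _ (ℛ k b)]
  simp only [Coalgebra.Repr.mul_index, Coalgebra.Repr.mul_left, Coalgebra.Repr.mul_right,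
    Finset.sum_product, ← hQ.mul_right, tensorForm_comul_tmul x _ _ r, Finset.sum_smul,
    Finset.mul_sum, Finset.smul_sum, mul_smul_comm, smul_smul]
  conv_rhs => rw [Finset.sum_comm]
  exact Finset.sum_congr rfl fun j _ => Finset.sum_comm

theorem IsSkewPairing.lastHom_apply_mul (hP : IsSkewPairing P) (a b : A) {x : H}
    {ι κ : Type*} (r : Coalgebra.Repr k x ι) (s : Coalgebra.Repr k a κ) :
    hP.lastHom x (a * b) = ∑ i ∈ r.index, ∑ j ∈ s.index,
      P (r.right i) (s.right j) • (s.left j * hP.lastHom (r.left i) b) := by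
  simp only [hP.lastHom_apply, contractLast_apply _ (s.mul (ℛ k b)),
    contractLast_apply _ (ℛ k b)]
  simp only [Coalgebra.Repr.mul_index, Coalgebra.Repr.mul_left, Coalgebra.Repr.mul_right,
    Finset.sum_product, ← hP.mul_right, tensorForm_comul_tmul x _ _ r, Finset.sum_smul,
    Finset.mul_sum, Finset.smul_sum, mul_smul_comm, smul_smul]
  conv_rhs => rw [Finset.sum_comm]
  refine Finset.sum_congr rfl fun j _ => Finset.sum_comm.trans ?_
  simp only [mul_comm]

theorem IsOppositeSkewPairing.firstHom_apply_one (hQ : IsOppositeSkewPairing Q) (x : H) :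
    hQ.firstHom x 1 = counit (R := k) x • 1 := by
  simp [hQ.firstHom_apply, contractFirst, hQ.one_right, Algebra.TensorProduct.one_def]

theorem IsSkewPairing.lastHom_apply_one (hP : IsSkewPairing P) (x : H) :
    hP.lastHom x 1 = counit (R := k) x • 1 := by
  simp [hP.lastHom_apply, contractLast, hP.one_right, Algebra.TensorProduct.one_def]

end SkewPairing

/-! ### The action of `H` on `A ⊗ H` and the matched pair -/

section DoubleCrossproduct

variable {k H A : Type*} [CommRing k] [Ring H] [Bialgebra k H] [Ring A] [Bialgebra k A]
  {Q P : H →ₗ[k] A →ₗ[k] k}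

variable (k H A) in
/-- `A` acts on `A ⊗ H` by left multiplication. -/
def leftMulOp : A →ₐ[k] Module.End k (A ⊗[k] H) :=
  (Module.End.rTensorAlgHom k A H).comp (Algebra.lmul k A)

variable (k H A) in
/-- `H` acts on `A ⊗ H` by left multiplication on the second factor. -/
def middleOp : H →ₐ[k] Module.End k (A ⊗[k] H) :=
  (Module.End.lTensorAlgHom k H A).comp (Algebra.lmul k H)

/-- The operators `a ⊗ y ↦ Q(x, a₁) a₂ ⊗ y`. -/
def IsOppositeSkewPairing.firstOp (hQ : IsOppositeSkewPairing Q) :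
    H →ₐ[k] Module.End k (A ⊗[k] H) :=
  (Module.End.rTensorAlgHom k A H).comp hQ.firstHom

/-- The operators `a ⊗ y ↦ a₁ P(x, a₂) ⊗ y`. -/
def IsSkewPairing.lastOp (hP : IsSkewPairing P) : H →ₐ[k] Module.End k (A ⊗[k] H) :=
  (Module.End.rTensorAlgHom k A H).comp hP.lastHom

@[simp] theorem leftMulOp_tmul (a b : A) (y : H) :
    leftMulOp k H A a (b ⊗ₜ y) = (a * b) ⊗ₜ y := rfl

@[simp] theorem middleOp_tmul (x : H) (b : A) (y : H) :
    middleOp k H A x (b ⊗ₜ y) = b ⊗ₜ (x * y) := rfl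

@[simp] theorem IsOppositeSkewPairing.firstOp_tmul (hQ : IsOppositeSkewPairing Q) (x : H) (b : A)
    (y : H) : hQ.firstOp x (b ⊗ₜ y) = hQ.firstHom x b ⊗ₜ y := rfl

@[simp] theorem IsSkewPairing.lastOp_tmul (hP : IsSkewPairing P) (x : H) (b : A) (y : H) :
    hP.lastOp x (b ⊗ₜ y) = hP.lastHom x b ⊗ₜ y := rfl

theorem commute_of_tmul {S T : Module.End k (A ⊗[k] H)}
    (h : ∀ a x, S (T (a ⊗ₜ x)) = T (S (a ⊗ₜ x))) : Commute S T :=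
  TensorProduct.ext' h

theorem commute_firstOp_middleOp (hQ : IsOppositeSkewPairing Q) (x y : H) :
    Commute (hQ.firstOp x) (middleOp k H A y) :=
  commute_of_tmul fun _ _ => rfl

theorem commute_lastOp_middleOp (hP : IsSkewPairing P) (x y : H) :
    Commute (middleOp k H A y) (hP.lastOp x) :=
  commute_of_tmul fun _ _ => rfl

theorem commute_firstOp_lastOp (hQ : IsOppositeSkewPairing Q) (hP : IsSkewPairing P) (x y : H) :
    Commute (hQ.firstOp x) (hP.lastOp y) :=
  commute_of_tmul fun a z => congrArg (· ⊗ₜ z)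
    (LinearMap.congr_fun (commute_contractFirst_contractLast (Q x) (P y)).eq a)

theorem commute_middleOp_leftMulOp (x : H) (a : A) :
    Commute (middleOp k H A x) (leftMulOp k H A a) :=
  commute_of_tmul fun _ _ => rfl

/-- `H` acts on `A ⊗ H` by `x · (a ⊗ y) = Q(x₁, a₁) a₂ ⊗ x₂ y P(x₃, a₃)`. -/
def crossOp (hQ : IsOppositeSkewPairing Q) (hP : IsSkewPairing P) :
    H →ₐ[k] Module.End k (A ⊗[k] H) :=
  commProd (commProd hQ.firstOp (middleOp k H A) (commute_firstOp_middleOp hQ)) hP.lastOp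
    fun _ y => commute_commProd _ _ _ _ _ (fun x => commute_firstOp_lastOp hQ hP x y)
      (fun x => commute_lastOp_middleOp hP y x)

theorem toConv_crossOp (hQ : IsOppositeSkewPairing Q) (hP : IsSkewPairing P) :
    toConv (crossOp hQ hP).toLinearMap =
      toConv hQ.firstOp.toLinearMap * toConv (middleOp k H A).toLinearMap *
        toConv hP.lastOp.toLinearMap := by
  rw [crossOp, toConv_commProd, toConv_commProd]

/-- Convolution form of `firstHom_apply_mul`: passing the operators of `H` across left
multiplications costs one factor `Q`. -/
theorem onLeft_firstOp_mul (hQ : IsOppositeSkewPairing Q) :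
    onLeft A hQ.firstOp.toLinearMap * onRight H (leftMulOp k H A).toLinearMap =
      scal _ Q * (onRight H (leftMulOp k H A).toLinearMap * onLeft A hQ.firstOp.toLinearMap) := by
  refine conv_ext fun x a => ?_
  rw [onLeft_mul_onRight_tmul, conv_tmul _ _ (ℛ k x) (ℛ k a)]
  refine TensorProduct.ext' fun b y => ?_
  simp only [onRight_mul_onLeft_tmul]
  simp [hQ.firstHom_apply_mul a b (ℛ k x) (ℛ k a), TensorProduct.sum_tmul,
    LinearMap.sum_apply, ← Algebra.smul_def, TensorProduct.smul_tmul']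

theorem onLeft_lastOp_mul (hP : IsSkewPairing P) :
    onLeft A hP.lastOp.toLinearMap * onRight H (leftMulOp k H A).toLinearMap =
      onRight H (leftMulOp k H A).toLinearMap * onLeft A hP.lastOp.toLinearMap * scal _ P := by
  refine conv_ext fun x a => ?_
  rw [onLeft_mul_onRight_tmul, conv_tmul _ _ (ℛ k x) (ℛ k a)]
  refine TensorProduct.ext' fun b y => ?_
  simp only [onRight_mul_onLeft_tmul]
  simp [hP.lastHom_apply_mul a b (ℛ k x) (ℛ k a), TensorProduct.sum_tmul,
    LinearMap.sum_apply, ← Algebra.commutes, ← Algebra.smul_def, TensorProduct.smul_tmul']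

theorem onLeft_middleOp_mul :
    onLeft A (middleOp k H A).toLinearMap * onRight H (leftMulOp k H A).toLinearMap =
      onRight H (leftMulOp k H A).toLinearMap * onLeft A (middleOp k H A).toLinearMap := by
  refine conv_ext fun x a => ?_
  rw [onLeft_mul_onRight_tmul, onRight_mul_onLeft_tmul]
  exact commute_middleOp_leftMulOp x a

/-- The exchange rule. Left multiplication by `A` is moved through the three factors of `crossOp` in
turn: the last one releases `P` on the right, the middle one commutes, the first one releases `Q` on
the left. -/
theorem onLeft_crossOp_mul (hQ : IsOppositeSkewPairing Q) (hP : IsSkewPairing P) :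
    onLeft A (crossOp hQ hP).toLinearMap * onRight H (leftMulOp k H A).toLinearMap =
      scal _ Q * (onRight H (leftMulOp k H A).toLinearMap *
        onLeft A (crossOp hQ hP).toLinearMap) * scal _ P := by
  rw [← ofConv_toConv (crossOp hQ hP).toLinearMap, toConv_crossOp, onLeft_mul, onLeft_mul]
  rw [mul_assoc, onLeft_lastOp_mul, mul_assoc, ← mul_assoc (onLeft A (middleOp k H A).toLinearMap),
    ← mul_assoc (onLeft A (middleOp k H A).toLinearMap), onLeft_middleOp_mul]
  simp only [← mul_assoc]
  rw [onLeft_firstOp_mul]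
  simp only [← mul_assoc]

/-- Transfers the scalar identity to every coefficient algebra, where the cancellations take place.
-/
theorem scal_mul_scal_eq_one (h : IsConvolutionInverse Q P) {B : Type*} [Ring B] [Algebra k B] :
    scal B Q * scal B P = 1 := by
  refine conv_ext fun x a => ?_
  rw [scal_mul_scal_tmul, (h x a).1, mul_comm]
  simp

theorem scal_mul_scal_eq_one' (h : IsConvolutionInverse Q P) {B : Type*} [Ring B] [Algebra k B] :
    scal B P * scal B Q = 1 := by
  refine conv_ext fun x a => ?_
  rw [scal_mul_scal_tmul, (h x a).2, mul_comm]
  simp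

variable (Q P) in
/-- `x ⊗ a ↦ (x₁ ▷ a₁) ⊗ (x₂ ◁ a₂)`. -/
def crossMap (x : H) (a : A) : A ⊗[k] H :=
  TensorProduct.map₂ (leftAction Q P) (rightAction Q P) (comul x) (comul a)

theorem toConv_comp_leftAction {B : Type*} [Ring B] [Algebra k B] (f : A →ₗ[k] B) :
    toConv (f ∘ₗ TensorProduct.lift (leftAction Q P)) = scal B Q * onRight H f * scal B P :=
  conv_ext fun x a => (scal_mul_onRight_mul_scal_tmul Q P f x a).symm

theorem toConv_comp_rightAction {B : Type*} [Ring B] [Algebra k B] (g : H →ₗ[k] B) :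
    toConv (g ∘ₗ TensorProduct.lift (rightAction Q P)) = scal B Q * onLeft A g * scal B P :=
  conv_ext fun x a => (scal_mul_onLeft_mul_scal_tmul Q P g x a).symm

/-- `θ((x₁ ▷ a₁) ⊗ (x₂ ◁ a₂)) = Q(x₁, a₁) θ(a₂ ⊗ x₂) P(x₃, a₃)`. -/
theorem map_crossMap (h : IsConvolutionInverse Q P) {B : Type*} [Ring B] [Algebra k B]
    (θ : A ⊗[k] H →ₗ[k] B) (x : H) (a : A) :
    θ (crossMap Q P x a) =
      (scal B Q * toConv (θ ∘ₗ (TensorProduct.comm k H A).toLinearMap) * scal B P) (x ⊗ₜ a) := by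
  have e : toConv (θ ∘ₗ (onRight H
        (Algebra.TensorProduct.includeLeft : A →ₐ[k] A ⊗[k] H).toLinearMap * onLeft A
        (Algebra.TensorProduct.includeRight : H →ₐ[k] A ⊗[k] H).toLinearMap).ofConv) =
      toConv (θ ∘ₗ (TensorProduct.comm k H A).toLinearMap) := by
    refine conv_ext fun x a => ?_
    simp only [LinearMap.comp_apply]
    rw [onRight_mul_onLeft_tmul]
    simp
  rw [← e, scal, scal, ← toConv_linear_comp_ofScalar_mul, ← toConv_linear_comp_mul_ofScalar,
    crossMap, map₂_comul_comul, toConv_comp_leftAction, toConv_comp_rightAction]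
  simp only [LinearMap.comp_apply]
  congr 2
  simp only [← mul_assoc]
  -- The trailing `P` of the left action meets the leading `Q` of the right action.
  rw [mul_assoc _ (scal _ P) (scal _ Q), scal_mul_scal_eq_one' h, mul_one]
  rfl

/-- The right side of the exchange rule is `map_crossMap` for the map `a ⊗ x ↦ leftMulOp a * crossOp
x`; this is the straightening rule `x b = (x₁ ▷ b₁)(x₂ ◁ b₂)` at the level of operators. -/
theorem crossOp_mul_leftMulOp (h : IsConvolutionInverse Q P) (hQ : IsOppositeSkewPairing Q)
    (hP : IsSkewPairing P) (x : H) (a : A) :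
    crossOp hQ hP x * leftMulOp k H A a =
      TensorProduct.lift ((LinearMap.mul k _).compl₁₂ (leftMulOp k H A).toLinearMap
        (crossOp hQ hP).toLinearMap) (crossMap Q P x a) := by
  rw [map_crossMap h]
  have e : toConv (TensorProduct.lift ((LinearMap.mul k _).compl₁₂ (leftMulOp k H A).toLinearMap
        (crossOp hQ hP).toLinearMap) ∘ₗ (TensorProduct.comm k H A).toLinearMap) =
      onRight H (leftMulOp k H A).toLinearMap * onLeft A (crossOp hQ hP).toLinearMap := by
    refine conv_ext fun x a => ?_
    rw [onRight_mul_onLeft_tmul]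
    rfl
  rw [e, ← onLeft_crossOp_mul, onLeft_mul_onRight_tmul]
  rfl

/-- As `Q(x, 1) = P(x, 1) = ε(x)`, the two outer legs of `x` collapse. -/
theorem crossOp_one_tmul (hQ : IsOppositeSkewPairing Q) (hP : IsSkewPairing P) (x y : H) :
    crossOp hQ hP x (1 ⊗ₜ y) = 1 ⊗ₜ (x * y) := by
  rw [crossOp, commProd_apply _ _ _ (ℛ k x)]
  simp only [LinearMap.sum_apply, Module.End.mul_apply, hP.lastOp_tmul, hP.lastHom_apply_one,
    ← TensorProduct.smul_tmul', map_smul]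
  have := sum_counit_right_smul_map
    ((commProd hQ.firstOp (middleOp k H A) (commute_firstOp_middleOp hQ)).toLinearMap.flip
      (1 ⊗ₜ y)) (ℛ k x)
  simp only [LinearMap.flip_apply, AlgHom.toLinearMap_apply] at this
  rw [this, commProd_apply _ _ _ (ℛ k x)]
  simp only [LinearMap.sum_apply, Module.End.mul_apply, hQ.firstOp_tmul, hQ.firstHom_apply_one,
    ← TensorProduct.smul_tmul', middleOp_tmul]
  exact sum_counit_smul_map (TensorProduct.mk k A H 1 ∘ₗ LinearMap.mulRight k y) (ℛ k x)

/-- Obtained by applying the straightening rule to `1 ⊗ 1`. It lets identities for `crossMap` be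
derived from the homomorphism property of `crossOp`. -/
theorem crossOp_tmul_one (h : IsConvolutionInverse Q P) (hQ : IsOppositeSkewPairing Q)
    (hP : IsSkewPairing P) (x : H) (a : A) : crossOp hQ hP x (a ⊗ₜ 1) = crossMap Q P x a := by
  have e := LinearMap.congr_fun (crossOp_mul_leftMulOp h hQ hP x a) (1 ⊗ₜ 1)
  simp only [Module.End.mul_apply, leftMulOp_tmul, mul_one] at e
  rw [e]
  generalize crossMap Q P x a = z
  induction z with
  | zero => simp
  | add z w hz hw => simp [hz, hw]
  | tmul b y => simp [crossOp_one_tmul]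

/-- All three factors of `crossOp` commute with right multiplication on the second leg, which
reduces the claim to `y = 1`. -/
theorem crossOp_tmul (h : IsConvolutionInverse Q P) (hQ : IsOppositeSkewPairing Q)
    (hP : IsSkewPairing P) (x : H) (a : A) (y : H) :
    crossOp hQ hP x (a ⊗ₜ y) = (LinearMap.mulRight k y).lTensor A (crossMap Q P x a) := by
  have e : Commute (crossOp hQ hP x) ((LinearMap.mulRight k y).lTensor A) := by
    refine commute_commProd _ _ _ _ _ (fun x => commute_commProd _ _ _ _ _ (fun x => ?_) fun x => ?_)
      fun x => ?_ <;>
    exact commute_of_tmul fun b z => by simp [mul_assoc]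
  have e' := LinearMap.congr_fun e.eq (a ⊗ₜ 1)
  simpa [crossOp_tmul_one h] using e'

/-- The projection `A ⊗ H → A`. -/
def fstProj : A ⊗[k] H →ₗ[k] A := TensorProduct.rid k A ∘ₗ (counit (R := k) (A := H)).lTensor A

/-- The projection `A ⊗ H → H`. -/
def sndProj : A ⊗[k] H →ₗ[k] H := TensorProduct.lid k H ∘ₗ (counit (R := k) (A := A)).rTensor H

@[simp] theorem fstProj_tmul (a : A) (x : H) :
    fstProj (k := k) (a ⊗ₜ x) = counit (R := k) x • a := by
  simp [fstProj]

@[simp] theorem sndProj_tmul (a : A) (x : H) :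
    sndProj (k := k) (a ⊗ₜ x) = counit (R := k) a • x := by
  simp [sndProj]

/-- By `map_crossMap`, applying the counit to the other leg leaves the conjugate by `P` of a single
projection, which is the action. -/
theorem fstProj_crossMap (h : IsConvolutionInverse Q P) (x : H) (a : A) :
    fstProj (crossMap Q P x a) = leftAction Q P x a := by
  rw [map_crossMap h, ← LinearMap.id_apply (R := k) (leftAction Q P x a),
    ← scal_mul_onRight_mul_scal_tmul]
  congr 4
  exact conv_ext fun x a => by simp

theorem sndProj_crossMap (h : IsConvolutionInverse Q P) (x : H) (a : A) :
    sndProj (crossMap Q P x a) = rightAction Q P x a := by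
  rw [map_crossMap h, ← LinearMap.id_apply (R := k) (rightAction Q P x a),
    ← scal_mul_onLeft_mul_scal_tmul]
  congr 4
  exact conv_ext fun x a => by simp

theorem crossMap_mul_left (h : IsConvolutionInverse Q P) (hQ : IsOppositeSkewPairing Q)
    (hP : IsSkewPairing P) (x y : H) (a : A) :
    crossMap Q P (x * y) a = crossOp hQ hP x (crossMap Q P y a) := by
  rw [← crossOp_tmul_one h hQ hP, ← crossOp_tmul_one h hQ hP, map_mul, Module.End.mul_apply]

theorem crossMap_mul_right (h : IsConvolutionInverse Q P) (hQ : IsOppositeSkewPairing Q)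
    (hP : IsSkewPairing P) (x : H) (a b : A) :
    crossMap Q P x (a * b) = TensorProduct.lift ((LinearMap.mul k _).compl₁₂
      (leftMulOp k H A).toLinearMap (crossOp hQ hP).toLinearMap) (crossMap Q P x a) (b ⊗ₜ 1) := by
  rw [← crossOp_mul_leftMulOp h, ← crossOp_tmul_one h hQ hP]
  rfl

theorem toConv_comul : toConv (comul (R := k) (A := A)) =
    toConv (Algebra.TensorProduct.includeLeft : A →ₐ[k] A ⊗[k] A).toLinearMap *
      toConv (Algebra.TensorProduct.includeRight : A →ₐ[k] A ⊗[k] A).toLinearMap := by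
  ext a
  simp [(ℛ k a).convMul_apply, (ℛ k a).eq]

theorem isMatchedPair (h : IsConvolutionInverse Q P) (hQ : IsOppositeSkewPairing Q)
    (hP : IsSkewPairing P) : IsMatchedPair (leftAction Q P) (rightAction Q P) where
  left_one a := by
    rw [← fstProj_crossMap h, ← crossOp_tmul_one h hQ hP]
    simp
  one_right a := by
    rw [← sndProj_crossMap h, ← crossOp_tmul_one h hQ hP]
    simp
  right_one x := by
    rw [← sndProj_crossMap h, ← crossOp_tmul_one h hQ hP, crossOp_one_tmul]
    simp
  one_left x := by
    rw [← fstProj_crossMap h, ← crossOp_tmul_one h hQ hP, crossOp_one_tmul]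
    simp
  left_mul x y a := by
    rw [← fstProj_crossMap h, crossMap_mul_left h hQ hP, ← fstProj_crossMap h y]
    -- What remains is `fstProj (x · z) = x ▷ fstProj z`, linear in an arbitrary `z`. The other
    -- multiplicativity axioms are treated in the same way.
    generalize crossMap Q P y a = z
    induction z with
    | zero => simp
    | add z w hz hw => simp [hz, hw]
    | tmul b y =>
      rw [crossOp_tmul h, fstProj_tmul, map_smul, ← fstProj_crossMap h]
      generalize crossMap Q P x b = z
      induction z with
      | zero => simp
      | add z w hz hw => simp [hz, hw]
      | tmul c z => simp [smul_smul, mul_comm]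
  right_mul x a b := by
    rw [← sndProj_crossMap h, crossMap_mul_right h hQ hP, ← sndProj_crossMap h x]
    generalize crossMap Q P x a = z
    induction z with
    | zero => simp
    | add z w hz hw => simp [hz, hw]
    | tmul c y =>
      simp only [TensorProduct.lift.tmul, LinearMap.compl₁₂_apply, LinearMap.mul_apply',
        AlgHom.toLinearMap_apply, Module.End.mul_apply, crossOp_tmul_one h, sndProj_tmul, map_smul,
        LinearMap.smul_apply]
      rw [← sndProj_crossMap h]
      generalize crossMap Q P y b = z
      induction z with
      | zero => simp
      | add z w hz hw => simp [hz, hw]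
      | tmul c z => simp [smul_smul]
  mul_right x y a := by
    rw [← sndProj_crossMap h, crossMap_mul_left h hQ hP, ← crossMap]
    generalize crossMap Q P y a = z
    induction z with
    | zero => simp
    | add z w hz hw => simp [hz, hw]
    | tmul b y =>
      simp only [TensorProduct.lift.tmul, LinearMap.comp_apply, LinearMap.mul_apply']
      rw [crossOp_tmul h, ← sndProj_crossMap h]
      generalize crossMap Q P x b = z
      induction z with
      | zero => simp
      | add z w hz hw => simp [hz, hw, add_mul]
      | tmul c z => simp
  mul_left x a b := by
    rw [← fstProj_crossMap h, crossMap_mul_right h hQ hP, ← crossMap]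
    generalize crossMap Q P x a = z
    induction z with
    | zero => simp
    | add z w hz hw => simp [hz, hw]
    | tmul c y =>
      simp only [TensorProduct.lift.tmul, LinearMap.compl₁₂_apply, LinearMap.mul_apply',
        AlgHom.toLinearMap_apply, Module.End.mul_apply, crossOp_tmul_one h,
        LinearMap.compl₂_apply, LinearMap.flip_apply]
      rw [← fstProj_crossMap h]
      generalize crossMap Q P y b = z
      induction z with
      | zero => simp
      | add z w hz hw => simp [hz, hw, mul_add]
      | tmul c z => simp
  left_comul x a := by
    rw [← scal_mul_onRight_mul_scal_tmul, map₂_comul_comul, toConv_comp_leftAction,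
      toConv_comp_leftAction, ← ofConv_toConv (comul (R := k) (A := A)), toConv_comul, onRight_mul]
    simp only [← mul_assoc]
    rw [mul_assoc _ (scal _ P) (scal _ Q), scal_mul_scal_eq_one' h, mul_one]
  right_comul x a := by
    rw [← scal_mul_onLeft_mul_scal_tmul, map₂_comul_comul, toConv_comp_rightAction,
      toConv_comp_rightAction, ← ofConv_toConv (comul (R := k) (A := H)), toConv_comul, onLeft_mul]
    simp only [← mul_assoc]
    rw [mul_assoc _ (scal _ P) (scal _ Q), scal_mul_scal_eq_one' h, mul_one]
  left_counit x a := by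
    rw [← scal_mul_onRight_mul_scal_tmul,
      -- The counit is the unit of convolution, so only `Q * P = 1` remains.
      show onRight H (counit (R := k) (A := A)) = 1 from conv_ext fun x a => by simp [mul_comm],
      mul_one, scal_mul_scal_eq_one h]
    simp [mul_comm]
  right_counit x a := by
    rw [← scal_mul_onLeft_mul_scal_tmul,
      show onLeft A (counit (R := k) (A := H)) = 1 from conv_ext fun x a => by simp [mul_comm],
      mul_one, scal_mul_scal_eq_one h]
    simp [mul_comm]
  compat x a := by
    rw [map₂_comul_comul, toConv_comp_leftAction, toConv_comp_rightAction, ← crossMap]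
    have := map_crossMap h (TensorProduct.comm k A H).toLinearMap x a
    rw [LinearEquiv.coe_coe] at this
    rw [this]
    simp only [← mul_assoc]
    -- Both orders of the legs reduce to a conjugate by `P`. They agree because the two factors of a
    -- tensor product algebra commute.
    rw [mul_assoc _ (scal _ P) (scal _ Q), scal_mul_scal_eq_one' h, mul_one,
      mul_assoc (scal _ Q)]
    congr 4
    refine conv_ext fun x a => ?_
    rw [onLeft_mul_onRight_tmul]
    simp

end DoubleCrossproduct

/-! ### Pairings determined by matrix coalgebras of generators -/

section PairingConstruction

variable {k H A : Type*} [CommRing k] [Ring H] [Bialgebra k H] [Ring A] [Bialgebra k A]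

/-- Exchanging the arguments interchanges the two multiplicativity rules together with their orders.
Existence and uniqueness for opposite pairings thereby reduce to the case of skew pairings. -/
theorem isOppositeSkewPairing_iff_flip {Q : H →ₗ[k] A →ₗ[k] k} :
    IsOppositeSkewPairing Q ↔ IsSkewPairing Q.flip := by
  have e : ∀ z w, tensorForm Q.flip Q.flip w z = tensorForm Q Q z w := by
    intro z w
    induction z with
    | zero => simp
    | add z z' hz hz' => simp [hz, hz']
    | tmul x y =>
      induction w with
      | zero => simp
      | add w w' hw hw' => simp only [map_add, LinearMap.add_apply, hw, hw']
      | tmul a b => simp [tensorForm]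
  constructor
  · intro h
    exact ⟨fun a b x => by rw [e]; exact (h.mul_right x a b).symm,
      fun a x y => by rw [e]; exact (h.mul_left y x a).symm, h.one_right, h.one_left⟩
  · intro h
    exact ⟨fun x y a => by rw [← e]; exact (h.mul_right a y x).symm,
      fun x a b => by rw [← e]; exact (h.mul_left a b x).symm, h.one_right, h.one_left⟩

/-- The algebra homomorphism from `H` to the dual of `A` attached to a skew pairing. -/
def IsSkewPairing.dualHom {P : H →ₗ[k] A →ₗ[k] k} (hP : IsSkewPairing P) :
    H →ₐ[k] WithConv (A →ₗ[k] k) :=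
  AlgHom.ofLinearMap ((WithConv.linearEquiv k (A →ₗ[k] k)).symm.toLinearMap ∘ₗ P)
    (by ext a; exact hP.one_left a) hP.toConv_mul

/-- Precomposition with a coalgebra homomorphism, as a homomorphism of convolution algebras. -/
def convComap {C D : Type*} (B : Type*) [AddCommGroup C] [Module k C] [Coalgebra k C]
    [AddCommGroup D] [Module k D] [Coalgebra k D] [Ring B] [Algebra k B] (φ : C →ₗc[k] D) :
    WithConv (D →ₗ[k] B) →ₐ[k] WithConv (C →ₗ[k] B) :=
  AlgHom.ofLinearMap
    ((WithConv.linearEquiv k (C →ₗ[k] B)).symm.toLinearMap ∘ₗ LinearMap.lcomp k B φ.toLinearMap ∘ₗ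
      (WithConv.linearEquiv k (D →ₗ[k] B)).toLinearMap)
    (by
      ext c
      exact congrArg (algebraMap k B) (LinearMap.congr_fun φ.counit_comp c))
    (fun f g => congrArg toConv (LinearMap.convMul_comp_coalgHom_distrib f g φ))

/-- Functionals on different tensor legs commute because `k` is commutative; this makes `dualComul`
an algebra homomorphism. -/
theorem commute_convComap_proj (f : WithConv (H →ₗ[k] k)) (g : WithConv (A →ₗ[k] k)) :
    Commute (convComap k (projLeft A) f) (convComap k (projRight H) g) := by
  refine conv_ext fun x a => ?_
  have h1 := onLeft_mul_onRight_tmul g.ofConv f.ofConv x a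
  have h2 := onRight_mul_onLeft_tmul g.ofConv f.ofConv x a
  exact h1.trans ((mul_comm _ _).trans h2.symm)

/-- For a family `Φ(x)` of functionals on `A`, multiplicative in `x`, the functionals
`a ⊗ b ↦ Φ(x₁)(a) Φ(x₂)(b)`. -/
def dualComul (Φ : H →ₐ[k] WithConv (A →ₗ[k] k)) : H →ₐ[k] WithConv (A ⊗[k] A →ₗ[k] k) :=
  commProd ((convComap k (projLeft A)).comp Φ) ((convComap k (projRight A)).comp Φ)
    fun x y => commute_convComap_proj (Φ x) (Φ y)

/-- For a family `Φ(x)` of functionals on `A`, multiplicative in `x`, the functionals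
`a ⊗ b ↦ Φ(x)(ba)`. -/
def dualMul (Φ : H →ₐ[k] WithConv (A →ₗ[k] k)) : H →ₐ[k] WithConv (A ⊗[k] A →ₗ[k] k) :=
  (convComap k ((Bialgebra.mulCoalgHom k A).comp
    ((Bialgebra.TensorProduct.comm k A A).toBialgHom : A ⊗[k] A →ₗc[k] A ⊗[k] A))).comp Φ

theorem dualMul_apply (Φ : H →ₐ[k] WithConv (A →ₗ[k] k)) (x : H) (a b : A) :
    dualMul Φ x (a ⊗ₜ b) = Φ x (b * a) := rfl

theorem dualComul_apply (Φ : H →ₐ[k] WithConv (A →ₗ[k] k)) {x : H} {ι : Type*}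
    (r : Coalgebra.Repr k x ι) (a b : A) :
    dualComul Φ x (a ⊗ₜ b) = ∑ i ∈ r.index, Φ (r.left i) a * Φ (r.right i) b := by
  refine (congrArg (fun f : WithConv (A ⊗[k] A →ₗ[k] k) => f (a ⊗ₜ b))
    (commProd_apply ((convComap k (projLeft A)).comp Φ) ((convComap k (projRight A)).comp Φ)
      (fun x y => commute_convComap_proj (Φ x) (Φ y)) r)).trans ?_
  rw [ofConv_sum, LinearMap.sum_apply]
  exact Finset.sum_congr rfl fun i _ =>
    onLeft_mul_onRight_tmul (Φ (r.right i)).ofConv (Φ (r.left i)).ofConv a b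

/-- The bilinear form attached to a homomorphism from `H` to the dual of `A`. -/
def formOfHom (Φ : H →ₐ[k] WithConv (A →ₗ[k] k)) : H →ₗ[k] A →ₗ[k] k :=
  (WithConv.linearEquiv k (A →ₗ[k] k)).toLinearMap ∘ₗ Φ.toLinearMap

theorem formOfHom_apply (Φ : H →ₐ[k] WithConv (A →ₗ[k] k)) (x : H) (a : A) :
    formOfHom Φ x a = Φ x a := rfl

/-- A matrix `W` with `Δ W = W ⊗ W` and `ε W = 1`. -/
structure IsMatrixCoalgebra {J : Type*} [Fintype J] [DecidableEq J] (W : J → J → H) : Prop where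
  comul_eq : ∀ i j, comul (R := k) (W i j) = ∑ c, W i c ⊗ₜ W c j
  counit_eq : ∀ i j, counit (R := k) (W i j) = if i = j then 1 else 0

variable {J : Type*} [Fintype J] [DecidableEq J] {W : J → J → H}

theorem IsMatrixCoalgebra.tensorForm_tmul (hW : IsMatrixCoalgebra (k := k) W)
    (P Q : H →ₗ[k] A →ₗ[k] k) (i j : J) (a b : A) :
    tensorForm P Q (comul (W i j)) (a ⊗ₜ b) = ∑ c, P (W i c) a * Q (W c j) b := by
  simp [tensorForm, hW.comul_eq]

/-- A homomorphism from `H` to the dual of `A` is a skew pairing if it is so on generators. -/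
theorem isSkewPairing_formOfHom (Φ : H →ₐ[k] WithConv (A →ₗ[k] k))
    (hW : IsMatrixCoalgebra (k := k) W)
    (hs : Algebra.adjoin k (Set.range fun p : J × J => W p.1 p.2) = ⊤)
    (h1 : ∀ i j, Φ (W i j) 1 = if i = j then 1 else 0)
    (h2 : ∀ i j a b, Φ (W i j) (b * a) = ∑ c, Φ (W i c) a * Φ (W c j) b) :
    IsSkewPairing (formOfHom Φ) where
  mul_left x y a := by
    rw [tensorForm_tmul_comul, formOfHom_apply, map_mul]
    rfl
  mul_right x a b := by
    -- Both sides of the rule are algebra homomorphisms from `H` to the dual of `A ⊗ A`, the second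
    -- because multiplication of a bialgebra is a coalgebra map. Hence the entries of `W` suffice.
    have e : dualComul Φ = dualMul Φ := by
      refine AlgHom.ext_of_adjoin_eq_top hs ?_
      rintro _ ⟨⟨i, j⟩, rfl⟩
      refine conv_ext fun a b => ?_
      let r : Coalgebra.Repr k (W i j) J := ⟨Finset.univ, W i, (W · j), (hW.comul_eq i j).symm⟩
      rw [dualComul_apply Φ r, dualMul_apply, h2]
    rw [tensorForm_comul_tmul x a b (ℛ k x)]
    exact (dualComul_apply Φ (ℛ k x) a b).symm.trans (by rw [e]; rfl)
  one_left a := by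
    rw [formOfHom_apply, map_one]
    rfl
  one_right x := by
    -- Evaluation at `1` is multiplicative for convolution because `Δ 1 = 1 ⊗ 1`.
    let ev : WithConv (A →ₗ[k] k) →ₐ[k] k := AlgHom.ofLinearMap
      (LinearMap.applyₗ (1 : A) ∘ₗ (WithConv.linearEquiv k (A →ₗ[k] k)).toLinearMap)
      (by simp) (fun f g => by simp [Algebra.TensorProduct.one_def])
    have e : ev.comp Φ = Bialgebra.counitAlgHom k H := by
      refine AlgHom.ext_of_adjoin_eq_top hs ?_
      rintro _ ⟨⟨i, j⟩, rfl⟩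
      exact (h1 i j).trans (hW.counit_eq i j).symm
    exact DFunLike.congr_fun e x

/-- The transposed matrices `P(W, a)` form a representation of `A`. -/
def IsSkewPairing.matrixHom {P : H →ₗ[k] A →ₗ[k] k} (hP : IsSkewPairing P)
    (hW : IsMatrixCoalgebra (k := k) W) : A →ₐ[k] Matrix J J k :=
  AlgHom.ofLinearMap
    { toFun := fun a => Matrix.of fun i j => P (W j i) a
      map_add' := fun a b => by ext; simp
      map_smul' := fun c a => by ext; simp }
    (by
      ext i j
      simp [hP.one_right, hW.counit_eq, Matrix.one_apply, eq_comm])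
    (fun a b => by
      ext i j
      simp only [LinearMap.coe_mk, AddHom.coe_mk, Matrix.mul_apply, Matrix.of_apply,
        ← hP.mul_right, hW.tensorForm_tmul]
      exact Finset.sum_congr rfl fun _ _ => mul_comm _ _)

/-- The matrices `Q(W, a)` form a representation of `A`. -/
def IsOppositeSkewPairing.matrixHom {Q : H →ₗ[k] A →ₗ[k] k} (hQ : IsOppositeSkewPairing Q)
    (hW : IsMatrixCoalgebra (k := k) W) : A →ₐ[k] Matrix J J k :=
  AlgHom.ofLinearMap
    { toFun := fun a => Matrix.of fun i j => Q (W i j) a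
      map_add' := fun a b => by ext; simp
      map_smul' := fun c a => by ext; simp }
    (by
      ext i j
      simp [hQ.one_right, hW.counit_eq, Matrix.one_apply])
    (fun a b => by
      ext i j
      simp only [LinearMap.coe_mk, AddHom.coe_mk, Matrix.mul_apply, Matrix.of_apply,
        ← hQ.mul_right, hW.tensorForm_tmul])

/-- With `W` fixed, the values on `A` form a matrix representation, hence are determined on `s`.
With `a` free, the pairing is a homomorphism from `H` to the dual of `A`, hence is determined on
`W`. -/
theorem IsSkewPairing.ext_of_generators {P P' : H →ₗ[k] A →ₗ[k] k} (hP : IsSkewPairing P)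
    (hP' : IsSkewPairing P') (hW : IsMatrixCoalgebra (k := k) W)
    (hs : Algebra.adjoin k (Set.range fun p : J × J => W p.1 p.2) = ⊤) {s : Set A}
    (hs' : Algebra.adjoin k s = ⊤) (h : ∀ i j, ∀ a ∈ s, P (W i j) a = P' (W i j) a) : P = P' := by
  have e : hP.matrixHom hW = hP'.matrixHom hW :=
    AlgHom.ext_of_adjoin_eq_top hs' fun a ha => Matrix.ext fun i j => h j i a ha
  have e' : hP.dualHom = hP'.dualHom := by
    refine AlgHom.ext_of_adjoin_eq_top hs ?_
    rintro _ ⟨⟨i, j⟩, rfl⟩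
    ext a
    exact congrFun (congrFun (DFunLike.congr_fun e a) j) i
  ext x a
  exact LinearMap.congr_fun (congrArg ofConv (DFunLike.congr_fun e' x)) a

/-! ### Convolution inverses checked on generators -/

section ConvolutionInverse

variable {M : Type*} [Ring M] [Algebra k M] {q p : H →ₗ[k] M}

/-- For `q` multiplicative and `p` antimultiplicative, `q * p = ε` is preserved by products. -/
theorem convMul_apply_mul_of_hom_anti (hq : ∀ x y, q (x * y) = q x * q y)
    (hp : ∀ x y, p (x * y) = p y * p x) {x y : H}
    (hx : (toConv q * toConv p) x = algebraMap k M (counit x))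
    (hy : (toConv q * toConv p) y = algebraMap k M (counit y)) :
    (toConv q * toConv p) (x * y) = algebraMap k M (counit (x * y)) := by
  -- In `Σ q(x₁) q(y₁) p(y₂) p(x₂)` the inner sum over `y` is the central scalar `ε(y)`.
  rw [((ℛ k x).mul (ℛ k y)).convMul_apply, Bialgebra.counit_mul, map_mul, ← hx,
    (ℛ k x).convMul_apply, Finset.sum_mul]
  simp only [Coalgebra.Repr.mul_index, Coalgebra.Repr.mul_left, Coalgebra.Repr.mul_right,
    Finset.sum_product, hq, hp]
  refine Finset.sum_congr rfl fun i _ => ?_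
  rw [mul_assoc, ← Algebra.commutes, ← hy, (ℛ k y).convMul_apply, Finset.sum_mul, Finset.mul_sum]
  simp only [mul_assoc]

/-- For `q` antimultiplicative and `p` multiplicative, `q * p = ε` is preserved by products. -/
theorem convMul_apply_mul_of_anti_hom (hq : ∀ x y, q (x * y) = q y * q x)
    (hp : ∀ x y, p (x * y) = p x * p y) {x y : H}
    (hx : (toConv q * toConv p) x = algebraMap k M (counit x))
    (hy : (toConv q * toConv p) y = algebraMap k M (counit y)) :
    (toConv q * toConv p) (x * y) = algebraMap k M (counit (x * y)) := by
  rw [((ℛ k x).mul (ℛ k y)).convMul_apply, Bialgebra.counit_mul, map_mul, ← hy,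
    (ℛ k y).convMul_apply, Finset.mul_sum]
  simp only [Coalgebra.Repr.mul_index, Coalgebra.Repr.mul_left, Coalgebra.Repr.mul_right,
    Finset.sum_product, hq, hp]
  rw [Finset.sum_comm]
  refine Finset.sum_congr rfl fun i _ => ?_
  rw [← mul_assoc, Algebra.commutes, ← hx, (ℛ k x).convMul_apply, Finset.mul_sum, Finset.sum_mul]
  simp only [mul_assoc]

theorem convMul_eq_one_of_generators {s : Set H} (hs : Algebra.adjoin k s = ⊤)
    (h1 : q 1 * p 1 = 1)
    (hmul : ∀ x y, (toConv q * toConv p) x = algebraMap k M (counit x) →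
      (toConv q * toConv p) y = algebraMap k M (counit y) →
      (toConv q * toConv p) (x * y) = algebraMap k M (counit (x * y)))
    (h : ∀ x ∈ s, (toConv q * toConv p) x = algebraMap k M (counit x)) :
    toConv q * toConv p = 1 := by
  ext x
  have hx : x ∈ Algebra.adjoin k s := hs ▸ Algebra.mem_top
  induction hx using Algebra.adjoin_induction with
  | mem x hx => exact h x hx
  | algebraMap c =>
    rw [Algebra.algebraMap_eq_smul_one, map_smul, map_smul, LinearMap.convMul_apply]
    simp [Algebra.TensorProduct.one_def, h1]
  | add x y _ _ hx hy => rw [map_add, hx, hy, map_add]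
  | mul x y _ _ hx hy => exact hmul x y hx hy

end ConvolutionInverse

/-- Convolution inverses can be checked on generators. -/
theorem isConvolutionInverse_of_generators {P Q : H →ₗ[k] A →ₗ[k] k} (hP : IsSkewPairing P)
    (hQ : IsOppositeSkewPairing Q) (hW : IsMatrixCoalgebra (k := k) W)
    (hs : Algebra.adjoin k (Set.range fun p : J × J => W p.1 p.2) = ⊤) {s : Set A}
    (hs' : Algebra.adjoin k s = ⊤)
    (h1 : ∀ i j, ∀ a ∈ s, (∑ c, toConv (Q (W i c)) * toConv (P (W c j))) a =
      if i = j then counit (R := k) a else 0)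
    (h2 : ∀ i j, ∀ a ∈ s, (∑ c, toConv (P (W i c)) * toConv (Q (W c j))) a =
      if i = j then counit (R := k) a else 0) :
    IsConvolutionInverse Q P := by
  -- First `W` is fixed and `a` runs over `A`, with values in matrices; below, `dQ` and `dP` extend
  -- the result from `W` to `H`, with values in the dual of `A`. The transpose in `mP` undoes that
  -- of `matrixHom`, so `mP` reverses products while `mQ` preserves them.
  let mQ : A →ₗ[k] Matrix J J k := (hQ.matrixHom hW).toLinearMap
  let mP : A →ₗ[k] Matrix J J k :=
    (Matrix.transposeLinearEquiv J J k k).toLinearMap ∘ₗ (hP.matrixHom hW).toLinearMap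
  have hmQ : ∀ a b, mQ (a * b) = mQ a * mQ b := map_mul (hQ.matrixHom hW)
  have hmP : ∀ a b, mP (a * b) = mP b * mP a := fun a b => by
    simp [mP, Matrix.transpose_mul]
  have hmQ1 : mQ 1 = 1 := map_one (hQ.matrixHom hW)
  have hmP1 : mP 1 = 1 := by simp [mP]
  have eQP : ∀ a i j, ((toConv mQ * toConv mP) a) i j =
      (∑ c, toConv (Q (W i c)) * toConv (P (W c j))) a := by
    intro a i j
    simp only [(ℛ k a).convMul_apply, ofConv_sum, LinearMap.sum_apply, Matrix.sum_apply,
      Matrix.mul_apply]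
    exact Finset.sum_comm
  have ePQ : ∀ a i j, ((toConv mP * toConv mQ) a) i j =
      (∑ c, toConv (P (W i c)) * toConv (Q (W c j))) a := by
    intro a i j
    simp only [(ℛ k a).convMul_apply, ofConv_sum, LinearMap.sum_apply, Matrix.sum_apply,
      Matrix.mul_apply]
    exact Finset.sum_comm
  have kQP : toConv mQ * toConv mP = 1 := by
    refine convMul_eq_one_of_generators hs' (by rw [hmQ1, hmP1, one_mul])
      (fun x y => convMul_apply_mul_of_hom_anti hmQ hmP) fun a ha => Matrix.ext fun i j => ?_
    rw [eQP, h1 i j a ha, Matrix.algebraMap_matrix_apply]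
    rfl
  have kPQ : toConv mP * toConv mQ = 1 := by
    refine convMul_eq_one_of_generators hs' (by rw [hmQ1, hmP1, one_mul])
      (fun x y => convMul_apply_mul_of_anti_hom hmP hmQ) fun a ha => Matrix.ext fun i j => ?_
    rw [ePQ, h2 i j a ha, Matrix.algebraMap_matrix_apply]
    rfl
  let dQ : H →ₗ[k] WithConv (A →ₗ[k] k) :=
    (WithConv.linearEquiv k (A →ₗ[k] k)).symm.toLinearMap ∘ₗ Q
  let dP : H →ₗ[k] WithConv (A →ₗ[k] k) :=
    (WithConv.linearEquiv k (A →ₗ[k] k)).symm.toLinearMap ∘ₗ P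
  have hdQ1 : dQ 1 = 1 := by ext a; exact hQ.one_left a
  have hdP1 : dP 1 = 1 := by ext a; exact hP.one_left a
  have gQP : ∀ i j, (toConv dQ * toConv dP) (W i j) =
      algebraMap k (WithConv (A →ₗ[k] k)) (counit (W i j)) := by
    intro i j
    ext a
    have e := (eQP a i j).symm.trans (congrFun (congrFun (congrArg (fun f => f.ofConv a) kQP) i) j)
    simp only [LinearMap.convMul_apply, hW.comul_eq, hW.counit_eq, map_sum, TensorProduct.map_tmul,
      LinearMap.mul'_apply]
    refine e.trans ?_
    by_cases hij : i = j <;> simp [hij, Matrix.algebraMap_matrix_apply]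
  have gPQ : ∀ i j, (toConv dP * toConv dQ) (W i j) =
      algebraMap k (WithConv (A →ₗ[k] k)) (counit (W i j)) := by
    intro i j
    ext a
    have e := (ePQ a i j).symm.trans (congrFun (congrFun (congrArg (fun f => f.ofConv a) kPQ) i) j)
    simp only [LinearMap.convMul_apply, hW.comul_eq, hW.counit_eq, map_sum, TensorProduct.map_tmul,
      LinearMap.mul'_apply]
    refine e.trans ?_
    by_cases hij : i = j <;> simp [hij, Matrix.algebraMap_matrix_apply]
  have tQP : toConv dQ * toConv dP = 1 := by
    refine convMul_eq_one_of_generators hs (by rw [hdQ1, hdP1, one_mul])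
      (fun x y => convMul_apply_mul_of_anti_hom hQ.toConv_mul hP.toConv_mul) ?_
    rintro _ ⟨⟨i, j⟩, rfl⟩
    exact gQP i j
  have tPQ : toConv dP * toConv dQ = 1 := by
    refine convMul_eq_one_of_generators hs (by rw [hdQ1, hdP1, one_mul])
      (fun x y => convMul_apply_mul_of_hom_anti hP.toConv_mul hQ.toConv_mul) ?_
    rintro _ ⟨⟨i, j⟩, rfl⟩
    exact gPQ i j
  have aux : ∀ (S T : H →ₗ[k] A →ₗ[k] k) (x : H) (a : A), tensorForm S T (comul x) (comul a) =
      ((toConv ((WithConv.linearEquiv k (A →ₗ[k] k)).symm.toLinearMap ∘ₗ S) *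
        toConv ((WithConv.linearEquiv k (A →ₗ[k] k)).symm.toLinearMap ∘ₗ T)) x) a := by
    intro S T x a
    rw [tensorForm_apply S T (ℛ k x) (ℛ k a), (ℛ k x).convMul_apply, ofConv_sum,
      LinearMap.sum_apply]
    exact Finset.sum_congr rfl fun i _ => ((ℛ k a).convMul_apply _ _).symm
  intro x a
  constructor
  · rw [aux]
    exact congrArg (fun f => (f.ofConv x).ofConv a) tQP
  · rw [aux]
    exact congrArg (fun f => (f.ofConv x).ofConv a) tPQ

end PairingConstruction

/-! ### The Yang–Baxter equation and its consequences for the inverse matrix -/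

section YangBaxterEntries

variable {k ι : Type*} [CommRing k] [Fintype ι] [DecidableEq ι] {R S : Matrix (ι × ι) (ι × ι) k}

theorem R₁₂_mul : R₁₂ (R * S) = R₁₂ R * R₁₂ S := by
  ext ⟨i, j, l⟩ ⟨m, n, o⟩
  simp [R₁₂, Matrix.mul_apply, Fintype.sum_prod_type]

theorem R₁₃_mul : R₁₃ (R * S) = R₁₃ R * R₁₃ S := by
  ext ⟨i, j, l⟩ ⟨m, n, o⟩
  simp [R₁₃, Matrix.mul_apply, Fintype.sum_prod_type]

theorem R₂₃_mul : R₂₃ (R * S) = R₂₃ R * R₂₃ S := by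
  ext ⟨i, j, l⟩ ⟨m, n, o⟩
  simp [R₂₃, Matrix.mul_apply, Fintype.sum_prod_type]

set_option linter.unusedSectionVars false in
theorem R₁₂_one : R₁₂ (1 : Matrix (ι × ι) (ι × ι) k) = 1 := by
  ext ⟨i, j, l⟩ ⟨m, n, o⟩
  simp [R₁₂, Matrix.one_apply]
  grind

set_option linter.unusedSectionVars false in
theorem R₁₃_one : R₁₃ (1 : Matrix (ι × ι) (ι × ι) k) = 1 := by
  ext ⟨i, j, l⟩ ⟨m, n, o⟩
  simp [R₁₃, Matrix.one_apply]
  grind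

set_option linter.unusedSectionVars false in
theorem R₂₃_one : R₂₃ (1 : Matrix (ι × ι) (ι × ι) k) = 1 := by
  ext ⟨i, j, l⟩ ⟨m, n, o⟩
  simp [R₂₃, Matrix.one_apply]
  grind

theorem YangBaxterEquation.entry (h : YangBaxterEquation R) (b i j c m n : ι) :
    ∑ p, ∑ q, ∑ d, R (i, j) (p, q) * (R (d, p) (c, m) * R (b, q) (d, n)) =
      ∑ p, ∑ q, ∑ d, R (p, q) (m, n) * (R (d, j) (c, q) * R (b, i) (d, p)) := by
  have := congrFun (congrFun h (b, i, j)) (c, m, n)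
  simp [R₁₂, R₁₃, R₂₃, Matrix.mul_apply, Fintype.sum_prod_type, Finset.sum_mul] at this
  calc _ = ∑ d, ∑ p, ∑ q, R (i, j) (p, q) * R (b, q) (d, n) * R (d, p) (c, m) := by
        conv_rhs => rw [Finset.sum_comm]
        refine Finset.sum_congr rfl fun p _ => ?_
        rw [Finset.sum_comm]
        simp only [mul_assoc, mul_comm (R (b, _) _)]
    _ = _ := by
        rw [← this]
        simp only [mul_comm]

/-- Multiply the Yang–Baxter equation by `S₁₃ S₂₃` on the left and by `S₂₃ S₁₃` on the right, and
take entries. This is the relation needed for `R⁻¹` to represent `U`. -/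
theorem YangBaxterEquation.inv_entry (h : YangBaxterEquation R) (h1 : R * S = 1) (h2 : S * R = 1)
    (c i j b m n : ι) :
    ∑ p, ∑ q, ∑ d, R (i, j) (p, q) * (S (p, d) (m, c) * S (q, b) (n, d)) =
      ∑ p, ∑ q, ∑ d, R (p, q) (m, n) * (S (j, d) (q, c) * S (i, b) (p, d)) := by
  have e : R₁₂ R * R₂₃ S * R₁₃ S = R₁₃ S * R₂₃ S * R₁₂ R := by
    have h13 : R₁₃ S * R₁₃ R = 1 := by rw [← R₁₃_mul, h2, R₁₃_one]
    have h13' : R₁₃ R * R₁₃ S = 1 := by rw [← R₁₃_mul, h1, R₁₃_one]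
    have h23 : R₂₃ S * R₂₃ R = 1 := by rw [← R₂₃_mul, h2, R₂₃_one]
    have h23' : R₂₃ R * R₂₃ S = 1 := by rw [← R₂₃_mul, h1, R₂₃_one]
    calc R₁₂ R * R₂₃ S * R₁₃ S
        = R₁₃ S * (R₂₃ S * R₂₃ R) * R₁₃ R * R₁₂ R * R₂₃ S * R₁₃ S := by
          rw [h23, Matrix.mul_one, h13, Matrix.one_mul]
      _ = R₁₃ S * R₂₃ S * (R₂₃ R * R₁₃ R * R₁₂ R) * R₂₃ S * R₁₃ S := by
          simp only [Matrix.mul_assoc]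
      _ = R₁₃ S * R₂₃ S * R₁₂ R * (R₁₃ R * (R₂₃ R * R₂₃ S) * R₁₃ S) := by
          rw [← h]
          simp only [Matrix.mul_assoc]
      _ = R₁₃ S * R₂₃ S * R₁₂ R := by rw [h23', Matrix.mul_one, h13', Matrix.mul_one]
  have := congrFun (congrFun e (i, j, b)) (m, n, c)
  simp [R₁₂, R₁₃, R₂₃, Matrix.mul_apply, Fintype.sum_prod_type, Finset.sum_mul] at this
  calc _ = ∑ p, ∑ d, ∑ q, R (i, j) (p, q) * S (q, b) (n, d) * S (p, d) (m, c) := by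
        refine Finset.sum_congr rfl fun p _ => ?_
        rw [Finset.sum_comm]
        simp only [mul_assoc, mul_comm (S (p, _) _)]
    _ = _ := by
        rw [this]
        simp only [mul_comm]

/-- Here the multipliers are `S₁₃ S₁₂` on the left and `S₁₂ S₁₃` on the right. This form is the
intertwining condition used for the relations of `Y₋`. -/
theorem YangBaxterEquation.inv_entry' (h : YangBaxterEquation R) (h1 : R * S = 1) (h2 : S * R = 1)
    (b i j c m n : ι) :
    ∑ p, ∑ q, ∑ d, R (i, j) (p, q) * (S (b, p) (d, m) * S (d, q) (c, n)) =
      ∑ p, ∑ q, ∑ d, R (p, q) (m, n) * (S (b, j) (d, q) * S (d, i) (c, p)) := by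
  have e : R₂₃ R * R₁₂ S * R₁₃ S = R₁₃ S * R₁₂ S * R₂₃ R := by
    have h13 : R₁₃ S * R₁₃ R = 1 := by rw [← R₁₃_mul, h2, R₁₃_one]
    have h13' : R₁₃ R * R₁₃ S = 1 := by rw [← R₁₃_mul, h1, R₁₃_one]
    have h12 : R₁₂ S * R₁₂ R = 1 := by rw [← R₁₂_mul, h2, R₁₂_one]
    have h12' : R₁₂ R * R₁₂ S = 1 := by rw [← R₁₂_mul, h1, R₁₂_one]
    calc R₂₃ R * R₁₂ S * R₁₃ S
        = R₁₃ S * (R₁₂ S * R₁₂ R) * R₁₃ R * R₂₃ R * R₁₂ S * R₁₃ S := by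
          rw [h12, Matrix.mul_one, h13, Matrix.one_mul]
      _ = R₁₃ S * R₁₂ S * (R₁₂ R * R₁₃ R * R₂₃ R) * R₁₂ S * R₁₃ S := by
          simp only [Matrix.mul_assoc]
      _ = R₁₃ S * R₁₂ S * R₂₃ R * (R₁₃ R * (R₁₂ R * R₁₂ S) * R₁₃ S) := by
          rw [h]
          simp only [Matrix.mul_assoc]
      _ = R₁₃ S * R₁₂ S * R₂₃ R := by rw [h12', Matrix.mul_one, h13', Matrix.mul_one]
  have := congrFun (congrFun e (b, i, j)) (c, m, n)
  simp [R₁₂, R₁₃, R₂₃, Matrix.mul_apply, Fintype.sum_prod_type, Finset.sum_mul] at this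
  calc _ = ∑ d, ∑ q, ∑ p, R (i, j) (p, q) * S (b, p) (d, m) * S (d, q) (c, n) := by
        rw [Finset.sum_comm]
        conv_rhs => rw [Finset.sum_comm]
        refine Finset.sum_congr rfl fun q _ => ?_
        rw [Finset.sum_comm]
        simp only [mul_assoc]
    _ = _ := by
        rw [this]
        simp only [mul_comm]

end YangBaxterEntries

/-! ### Tensor products of matrix representations and intertwiners -/

section TensorRep

variable {k A J K : Type*} [CommRing k] [Ring A] [Bialgebra k A] [Fintype J] [DecidableEq J]
  [Fintype K] [DecidableEq K]

/-- The tensor product of two matrix representations of a bialgebra. -/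
def tensorRep (ρ : A →ₐ[k] Matrix J J k) (σ : A →ₐ[k] Matrix K K k) :
    A →ₐ[k] Matrix (J × K) (J × K) k :=
  (Matrix.kroneckerAlgEquiv J K k).toAlgHom.comp
    ((Algebra.TensorProduct.map ρ σ).comp (Bialgebra.comulAlgHom k A))

/-- The matrix entries of a representation, as functionals. -/
def entry (ρ : A →ₐ[k] Matrix J J k) (i j : J) : WithConv (A →ₗ[k] k) :=
  toConv (Matrix.entryLinearMap k k i j ∘ₗ ρ.toLinearMap)

set_option linter.unusedSectionVars false in
@[simp] theorem entry_apply (ρ : A →ₐ[k] Matrix J J k) (i j : J) (a : A) :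
    entry ρ i j a = ρ a i j := rfl

/-- Quadratic relations among matrix entries in the dual algebra are thereby intertwining identities
between tensor products, and these can be tested on generators of `A`. -/
theorem tensorRep_apply (ρ : A →ₐ[k] Matrix J J k) (σ : A →ₐ[k] Matrix K K k) (a : A) (i j : J)
    (m n : K) : tensorRep ρ σ a (i, m) (j, n) = (entry ρ i j * entry σ m n) a := by
  simp [tensorRep, (ℛ k a).convMul_apply, ← (ℛ k a).eq, Matrix.sum_apply]

theorem intertwines_of_generators {ρ : A →ₐ[k] Matrix J J k} {σ : A →ₐ[k] Matrix K K k}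
    {X : Matrix J K k} {s : Set A} (hs : Algebra.adjoin k s = ⊤) (h : ∀ a ∈ s, ρ a * X = X * σ a)
    (a : A) : ρ a * X = X * σ a := by
  have ha : a ∈ Algebra.adjoin k s := hs ▸ Algebra.mem_top
  induction ha using Algebra.adjoin_induction with
  | mem x hx => exact h x hx
  | algebraMap c => simp [Algebra.algebraMap_eq_smul_one]
  | add x y _ _ hx hy => rw [map_add, map_add, Matrix.add_mul, Matrix.mul_add, hx, hy]
  | mul x y _ _ hx hy =>
    rw [map_mul, map_mul, Matrix.mul_assoc, hy, ← Matrix.mul_assoc, hx, Matrix.mul_assoc]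

end TensorRep

/-! ### Generating matrix coalgebras of `Y₊` and `Y₋` -/

section Generators

variable {k ι : Type*} [CommRing k] [Fintype ι] (R : Matrix (ι × ι) (ι × ι) k)

/-- The matrix with blocks `U, F, 0, 1`. -/
def YPlus.mat : Option ι → Option ι → YPlus R
  | some i, some j => YPlus.u R i j
  | some i, none => YPlus.F R i
  | none, some _ => 0
  | none, none => 1

/-- The matrix with blocks `T, 0, E, 1`. -/
def YMinus.mat : Option ι → Option ι → YMinus R
  | some i, some j => YMinus.t R i j
  | some _, none => 0
  | none, some j => YMinus.E R j
  | none, none => 1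

/-- The generators satisfy the relations inside `S`, so the universal property gives a map to `S`
whose composite with the inclusion fixes the generators and is therefore the identity. -/
theorem YPlus.subalgebra_eq_top {S : Subalgebra k (YPlus R)} (hu : ∀ i j, YPlus.u R i j ∈ S)
    (hF : ∀ i, YPlus.F R i ∈ S) : S = ⊤ := by
  let f : YPlus R →ₐ[k] S := YPlus.lift (fun i j => ⟨YPlus.u R i j, hu i j⟩)
    (fun i => ⟨YPlus.F R i, hF i⟩)
    (fun i j m n => Subtype.ext (by simpa using YPlus.rel_uu R i j m n))
    (fun i j m => Subtype.ext (by simpa using YPlus.rel_fu R i j m))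
  have e : S.val.comp f = AlgHom.id k _ :=
    YPlus.algHom_ext (fun i j => congrArg S.val (YPlus.lift_u ..))
      (fun i => congrArg S.val (YPlus.lift_F ..))
  refine eq_top_iff.2 fun x _ => ?_
  have := DFunLike.congr_fun e x
  rw [← show S.val (f x) = x from this]
  exact (f x).2

theorem YMinus.subalgebra_eq_top {S : Subalgebra k (YMinus R)} (ht : ∀ i j, YMinus.t R i j ∈ S)
    (hE : ∀ i, YMinus.E R i ∈ S) : S = ⊤ := by
  let f : YMinus R →ₐ[k] S := YMinus.lift (fun i j => ⟨YMinus.t R i j, ht i j⟩)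
    (fun i => ⟨YMinus.E R i, hE i⟩)
    (fun i j m n => Subtype.ext (by simpa using YMinus.rel_tt R i j m n))
    (fun i j m => Subtype.ext (by simpa using YMinus.rel_et R i j m))
  have e : S.val.comp f = AlgHom.id k _ :=
    YMinus.algHom_ext (fun i j => congrArg S.val (YMinus.lift_t ..))
      (fun i => congrArg S.val (YMinus.lift_E ..))
  refine eq_top_iff.2 fun x _ => ?_
  have := DFunLike.congr_fun e x
  rw [← show S.val (f x) = x from this]
  exact (f x).2

theorem YPlus.adjoin_mat :
    Algebra.adjoin k (Set.range fun p : Option ι × Option ι => YPlus.mat R p.1 p.2) = ⊤ :=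
  YPlus.subalgebra_eq_top R
    (fun i j => Algebra.subset_adjoin ⟨(some i, some j), rfl⟩)
    (fun i => Algebra.subset_adjoin ⟨(some i, none), rfl⟩)

theorem YMinus.adjoin_mat :
    Algebra.adjoin k (Set.range fun p : Option ι × Option ι => YMinus.mat R p.1 p.2) = ⊤ :=
  YMinus.subalgebra_eq_top R
    (fun i j => Algebra.subset_adjoin ⟨(some i, some j), rfl⟩)
    (fun i => Algebra.subset_adjoin ⟨(none, some i), rfl⟩)

variable [DecidableEq ι]

/-- The triangular block form absorbs `Δ F = F ⊗ 1 + U ⊗ F` into a single matrix product, so `F`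
needs no separate treatment. -/
theorem YPlus.isMatrixCoalgebra : IsMatrixCoalgebra (k := k) (YPlus.mat R) where
  comul_eq i j := by
    cases i <;> cases j <;>
      simp [YPlus.mat, YPlus.comul_u, YPlus.comul_F, Algebra.TensorProduct.one_def]
  counit_eq i j := by
    cases i <;> cases j <;> simp [YPlus.mat, YPlus.counit_u, YPlus.counit_F]

theorem YMinus.isMatrixCoalgebra : IsMatrixCoalgebra (k := k) (YMinus.mat R) where
  comul_eq i j := by
    cases i <;> cases j <;>
      simp [YMinus.mat, YMinus.comul_t, YMinus.comul_E, Algebra.TensorProduct.one_def, add_comm]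
  counit_eq i j := by
    cases i <;> cases j <;> simp [YMinus.mat, YMinus.counit_t, YMinus.counit_E]

end Generators

/-! ### Existence of the skew pairing -/

section PlusForm

variable {k ι : Type*} [CommRing k] [Fintype ι] [DecidableEq ι] {R : Matrix (ι × ι) (ι × ι) k}

/-- The representation of `Y₋` by the transposed matrices `⟨U, ·⟩`. -/
def minusRep (h : YangBaxterEquation R) : YMinus R →ₐ[k] Matrix ι ι k :=
  YMinus.lift (fun j n => Matrix.of fun m i => R (i, j) (m, n)) (fun _ => 0)
    (by
      intro i j m n
      ext c b
      simp only [Matrix.sum_apply, Matrix.smul_apply, Matrix.mul_apply, Matrix.of_apply,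
        smul_eq_mul, Finset.mul_sum]
      exact h.entry b i j c m n)
    (by
      intro j m n
      simp)

/-- The representation of `Y₋` by the transposed matrices with blocks `⟨U, ·⟩, ⟨F, ·⟩, 0, ε`. -/
def minusRepExt (h : YangBaxterEquation R) :
    YMinus R →ₐ[k] Matrix (Option ι) (Option ι) k :=
  YMinus.lift
    (fun j n => Matrix.of fun m i => match m, i with
      | some m, some i => R (i, j) (m, n)
      | none, none => if j = n then 1 else 0
      | _, _ => 0)
    (fun j => Matrix.of fun m i => match m, i with
      | none, some i => if i = j then 1 else 0
      | _, _ => 0)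
    (by
      intro i j m n
      ext c b
      simp only [Matrix.sum_apply, Matrix.smul_apply, Matrix.mul_apply, Matrix.of_apply,
        smul_eq_mul, Fintype.sum_option]
      cases c <;> cases b <;> simp
      simpa only [Finset.mul_sum] using h.entry _ i j _ m n)
    (by
      intro j m n
      ext c b
      simp only [Matrix.sum_apply, Matrix.smul_apply, Matrix.mul_apply, Matrix.of_apply,
        smul_eq_mul, Fintype.sum_option]
      cases c <;> cases b <;> simp)

theorem minusRep_t (h : YangBaxterEquation R) (j n m i : ι) :
    minusRep h (YMinus.t R j n) m i = R (i, j) (m, n) :=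
  congrArg (fun M : Matrix ι ι k => M m i)
    (show minusRep h (YMinus.t R j n) = Matrix.of fun m i => R (i, j) (m, n) from YMinus.lift_t ..)

theorem minusRep_E (h : YangBaxterEquation R) (j : ι) : minusRep h (YMinus.E R j) = 0 :=
  YMinus.lift_E ..

theorem minusRepExt_t (h : YangBaxterEquation R) (j n : ι) :
    minusRepExt h (YMinus.t R j n) = Matrix.of fun m i => match m, i with
      | some m, some i => R (i, j) (m, n)
      | none, none => if j = n then 1 else 0
      | _, _ => 0 :=
  YMinus.lift_t ..

theorem minusRepExt_E (h : YangBaxterEquation R) (j : ι) :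
    minusRepExt h (YMinus.E R j) = Matrix.of fun m i => match m, i with
      | none, some i => if i = j then 1 else 0
      | _, _ => 0 :=
  YMinus.lift_E ..

/-- `minusRepExt` is block triangular, with diagonal blocks `minusRep` and `ε`. -/
theorem minusRepExt_blocks (h : YangBaxterEquation R) (a : YMinus R) :
    (∀ m i, minusRepExt h a (some m) (some i) = minusRep h a m i) ∧
      (∀ m, minusRepExt h a (some m) none = 0) ∧
      minusRepExt h a none none = counit (R := k) a := by
  have ha : a ∈ Algebra.adjoin k _ := YMinus.adjoin_mat R ▸ Algebra.mem_top
  induction ha using Algebra.adjoin_induction with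
  | mem x hx =>
    obtain ⟨⟨i, j⟩, rfl⟩ := hx
    cases i <;> cases j <;>
      simp [YMinus.mat, minusRepExt_t, minusRepExt_E, minusRep_t, minusRep_E, YMinus.counit_t,
        YMinus.counit_E, Matrix.one_apply]
  | algebraMap c => simp [Matrix.algebraMap_matrix_apply]
  | add x y _ _ hx hy => simp [hx, hy]
  | mul x y _ _ hx hy => simp [hx, hy, Matrix.mul_apply, Fintype.sum_option]

/-- The matrix of the relations of `Y₊`. -/
def minusIntertwiner (R : Matrix (ι × ι) (ι × ι) k) : Matrix (ι × Option ι) (Option ι × ι) k :=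
  Matrix.of fun x y => match x, y with
    | (p, some q), (some j, i) => R (i, j) (p, q)
    | (p, none), (none, i) => if p = i then 1 else 0
    | _, _ => 0

/-- One identity contains both families of relations of `Y₊`: its `some` rows give `R₁₂ U₁ U₂ = U₂
U₁ R₁₂` and its `none` rows give `F₂ U₁ = R₁₂ U₁ F₂`. On the generators `T` the essential block is
the Yang–Baxter equation. -/
theorem tensorRep_mul_minusIntertwiner (h : YangBaxterEquation R) (a : YMinus R) :
    tensorRep (minusRep h) (minusRepExt h) a * minusIntertwiner R =
      minusIntertwiner R * tensorRep (minusRepExt h) (minusRep h) a := by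
  refine intertwines_of_generators (YMinus.adjoin_mat R) ?_ a
  rintro _ ⟨⟨b, c⟩, rfl⟩
  ext ⟨m, n⟩ ⟨j, i⟩
  simp only [Matrix.mul_apply, Fintype.sum_prod_type, tensorRep_apply, Fintype.sum_option,
    LinearMap.convMul_apply]
  cases b <;> cases c <;> cases n <;> cases j <;>
    simp [YMinus.mat, YMinus.comul_t, YMinus.comul_E, minusRep_t, minusRep_E, minusRepExt_t,
      minusRepExt_E, minusIntertwiner, entry, Algebra.TensorProduct.one_def, Matrix.one_apply]
  rename_i c b n' j'
  have e := h.entry i j' c m n' b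
  simp only [Finset.sum_mul, Finset.mul_sum]
  calc _ = ∑ p, ∑ q, ∑ d, R (p, q) (n', b) * (R (d, c) (m, q) * R (i, j') (d, p)) := by
        rw [Finset.sum_comm]
        refine Finset.sum_congr rfl fun p _ => ?_
        rw [Finset.sum_comm]
        simp only [mul_assoc, mul_left_comm]
    _ = _ := by
        rw [← e]
        refine Finset.sum_congr rfl fun p _ => ?_
        rw [Finset.sum_comm]
        simp only [mul_left_comm]

/-- The matrix of functionals `⟨U, ·⟩, ⟨F, ·⟩` on `Y₋`. -/
def plusHom (h : YangBaxterEquation R) : YPlus R →ₐ[k] WithConv (YMinus R →ₗ[k] k) :=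
  YPlus.lift (fun i m => entry (minusRep h) m i) (fun i => entry (minusRepExt h) none (some i))
    (by
      intro i j m n
      ext a
      have e := congrFun (congrFun (tensorRep_mul_minusIntertwiner h a) (m, some n)) (some j, i)
      have hb : ∀ m i, entry (minusRepExt h) (some m) (some i) = entry (minusRep h) m i :=
        fun m i => by ext a; exact (minusRepExt_blocks h a).1 m i
      simp only [Matrix.mul_apply, Fintype.sum_prod_type, tensorRep_apply, Fintype.sum_option,
        minusIntertwiner, Matrix.of_apply, hb] at e
      simp [-LinearMap.convMul_apply] at e ⊢
      rw [Finset.sum_comm (f := fun p q => R (p, q) (m, n) * _)]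
      simpa only [mul_comm _ (R _ _)] using e)
    (by
      intro i j m
      ext a
      have e := congrFun (congrFun (tensorRep_mul_minusIntertwiner h a) (m, none)) (some j, i)
      simp only [Matrix.mul_apply, Fintype.sum_prod_type, tensorRep_apply, Fintype.sum_option,
        minusIntertwiner, Matrix.of_apply] at e
      simp [-LinearMap.convMul_apply] at e ⊢
      simpa only [mul_comm _ (R _ _)] using e.symm)

theorem plusHom_u (h : YangBaxterEquation R) (i m : ι) :
    plusHom h (YPlus.u R i m) = entry (minusRep h) m i := YPlus.lift_u ..

theorem plusHom_F (h : YangBaxterEquation R) (i : ι) :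
    plusHom h (YPlus.F R i) = entry (minusRepExt h) none (some i) := YPlus.lift_F ..

/-- Block triangularity merges the two representations used for `U` and `F` into one. The indices
are transposed because `⟨Δ x, a ⊗ b⟩ = ⟨x, ba⟩` makes `a ↦ ⟨W, a⟩` reverse products. -/
theorem plusHom_mat_apply (h : YangBaxterEquation R) (i j : Option ι) (a : YMinus R) :
    plusHom h (YPlus.mat R i j) a = minusRepExt h a j i := by
  obtain ⟨h1, h2, h3⟩ := minusRepExt_blocks h a
  cases i <;> cases j <;> simp [YPlus.mat, plusHom_u, plusHom_F, h1, h2, h3]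

theorem exists_skewPairing (h : YangBaxterEquation R) :
    ∃ P : YPlus R →ₗ[k] YMinus R →ₗ[k] k, IsSkewPairing P ∧ HasGeneratorValues R R 1 P := by
  refine ⟨formOfHom (plusHom h), isSkewPairing_formOfHom _ (YPlus.isMatrixCoalgebra R)
    (YPlus.adjoin_mat R) ?_ ?_, ?_⟩
  · intro i j
    simp [plusHom_mat_apply, Matrix.one_apply, eq_comm]
  · intro i j a b
    simp only [plusHom_mat_apply, map_mul, Matrix.mul_apply]
    exact Finset.sum_congr rfl fun _ _ => mul_comm _ _
  · constructor <;> intros <;>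
      simp [formOfHom_apply, plusHom_u, plusHom_F, minusRep_t, minusRep_E, minusRepExt_t,
        minusRepExt_E, Matrix.one_apply, YMinus.counit_t, YMinus.counit_E, eq_comm]

end PlusForm

/-! ### Existence of the opposite skew pairing -/

section MinusForm

variable {k ι : Type*} [CommRing k] [Fintype ι] [DecidableEq ι] {R S : Matrix (ι × ι) (ι × ι) k}

/-- The representation of `Y₊` by the transposed matrices `⟨·, T⟩⁻`. -/
def plusRep (h : YangBaxterEquation R) (h1 : R * S = 1) (h2 : S * R = 1) :
    YPlus R →ₐ[k] Matrix ι ι k :=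
  YPlus.lift (fun i m => Matrix.of fun n j => S (i, j) (m, n)) (fun _ => 0)
    (by
      intro i j m n
      ext c b
      simp only [Matrix.sum_apply, Matrix.smul_apply, Matrix.mul_apply, Matrix.of_apply,
        smul_eq_mul, Finset.mul_sum]
      exact h.inv_entry h1 h2 c i j b m n)
    (by
      intro i j m
      simp)

/-- The representation of `Y₊` by the transposed matrices with blocks `⟨·, T⟩⁻, 0, ⟨·, E⟩⁻, ε`. -/
def plusRepExt (h : YangBaxterEquation R) (h1 : R * S = 1) (h2 : S * R = 1) :
    YPlus R →ₐ[k] Matrix (Option ι) (Option ι) k :=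
  YPlus.lift
    (fun i m => Matrix.of fun n j => match n, j with
      | some n, some j => S (i, j) (m, n)
      | none, none => if i = m then 1 else 0
      | _, _ => 0)
    (fun i => Matrix.of fun n j => match n, j with
      | some n, none => if i = n then -1 else 0
      | _, _ => 0)
    (by
      intro i j m n
      ext c b
      simp only [Matrix.sum_apply, Matrix.smul_apply, Matrix.mul_apply, Matrix.of_apply,
        smul_eq_mul, Fintype.sum_option]
      cases c <;> cases b <;> simp
      simpa only [Finset.mul_sum] using h.inv_entry h1 h2 _ i j _ m n)
    (by
      intro i j m
      ext c b
      simp only [Matrix.sum_apply, Matrix.smul_apply, Matrix.mul_apply, Matrix.of_apply,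
        smul_eq_mul, Fintype.sum_option]
      cases c <;> cases b <;> simp
      rename_i c
      -- In the last column, `F₂ U₁ = R₁₂ U₁ F₂` amounts to `R R⁻¹ = 1`.
      have e := congrFun (congrFun h1 (i, j)) (m, c)
      simp only [Matrix.mul_apply, Fintype.sum_prod_type, Matrix.one_apply, Prod.mk.injEq] at e
      rw [e]
      split_ifs <;> simp_all)

theorem plusRep_u (h : YangBaxterEquation R) (h1 : R * S = 1) (h2 : S * R = 1) (i m n j : ι) :
    plusRep h h1 h2 (YPlus.u R i m) n j = S (i, j) (m, n) :=
  congrArg (fun M : Matrix ι ι k => M n j)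
    (show plusRep h h1 h2 (YPlus.u R i m) = Matrix.of fun n j => S (i, j) (m, n) from
      YPlus.lift_u ..)

theorem plusRep_F (h : YangBaxterEquation R) (h1 : R * S = 1) (h2 : S * R = 1) (i : ι) :
    plusRep h h1 h2 (YPlus.F R i) = 0 :=
  YPlus.lift_F ..

theorem plusRepExt_u (h : YangBaxterEquation R) (h1 : R * S = 1) (h2 : S * R = 1) (i m : ι) :
    plusRepExt h h1 h2 (YPlus.u R i m) = Matrix.of fun n j => match n, j with
      | some n, some j => S (i, j) (m, n)
      | none, none => if i = m then 1 else 0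
      | _, _ => 0 :=
  YPlus.lift_u ..

theorem plusRepExt_F (h : YangBaxterEquation R) (h1 : R * S = 1) (h2 : S * R = 1) (i : ι) :
    plusRepExt h h1 h2 (YPlus.F R i) = Matrix.of fun n j => match n, j with
      | some n, none => if i = n then -1 else 0
      | _, _ => 0 :=
  YPlus.lift_F ..

/-- `plusRepExt` is block triangular, with diagonal blocks `plusRep` and `ε`. -/
theorem plusRepExt_blocks (h : YangBaxterEquation R) (h1 : R * S = 1) (h2 : S * R = 1)
    (x : YPlus R) :
    (∀ n j, plusRepExt h h1 h2 x (some n) (some j) = plusRep h h1 h2 x n j) ∧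
      (∀ j, plusRepExt h h1 h2 x none (some j) = 0) ∧
      plusRepExt h h1 h2 x none none = counit (R := k) x := by
  have hx : x ∈ Algebra.adjoin k _ := YPlus.adjoin_mat R ▸ Algebra.mem_top
  induction hx using Algebra.adjoin_induction with
  | mem x hx =>
    obtain ⟨⟨i, j⟩, rfl⟩ := hx
    cases i <;> cases j <;>
      simp [YPlus.mat, plusRepExt_u, plusRepExt_F, plusRep_u, plusRep_F, YPlus.counit_u,
        YPlus.counit_F, Matrix.one_apply]
  | algebraMap c => simp [Matrix.algebraMap_matrix_apply]
  | add x y _ _ hx hy => simp [hx, hy]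
  | mul x y _ _ hx hy => simp [hx, hy, Matrix.mul_apply, Fintype.sum_option]

/-- The matrix of the relations of `Y₋`. -/
def plusIntertwiner (R : Matrix (ι × ι) (ι × ι) k) : Matrix (Option ι × ι) (ι × Option ι) k :=
  Matrix.of fun x y => match x, y with
    | (some p, q), (j, some i) => R (i, j) (p, q)
    | (none, q), (j, none) => if q = j then 1 else 0
    | _, _ => 0

/-- In the rows `(some m, n)`, the `some` columns give the relations among the `T` and the `none`
columns give `E₁ T₂ = T₂ E₁ R₁₂`. On the generators of `Y₊` the nontrivial blocks are `R⁻¹ R = 1`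
for `F` and `inv_entry'` for `U`. -/
theorem tensorRep_mul_plusIntertwiner (h : YangBaxterEquation R) (h1 : R * S = 1)
    (h2 : S * R = 1) (x : YPlus R) :
    tensorRep (plusRepExt h h1 h2) (plusRep h h1 h2) x * plusIntertwiner R =
      plusIntertwiner R * tensorRep (plusRep h h1 h2) (plusRepExt h h1 h2) x := by
  refine intertwines_of_generators (YPlus.adjoin_mat R) ?_ x
  rintro _ ⟨⟨b, c⟩, rfl⟩
  ext ⟨m, n⟩ ⟨j, i⟩
  simp only [Matrix.mul_apply, Fintype.sum_prod_type, tensorRep_apply, Fintype.sum_option,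
    LinearMap.convMul_apply]
  cases b <;> cases c <;> cases m <;> cases i <;>
    simp [YPlus.mat, YPlus.comul_u, YPlus.comul_F, plusRep_u, plusRep_F, plusRepExt_u,
      plusRepExt_F, plusIntertwiner, entry, Algebra.TensorProduct.one_def, Matrix.one_apply]
  · rename_i b m
    have e := congrFun (congrFun h2 (b, j)) (m, n)
    simp only [Matrix.mul_apply, Fintype.sum_prod_type, Matrix.one_apply, Prod.mk.injEq] at e
    rw [Finset.sum_comm, show ∑ p, ∑ q, R (p, q) (m, n) * S (b, j) (p, q) = _ from
      (Finset.sum_congr rfl fun p _ => Finset.sum_congr rfl fun q _ => mul_comm _ _).trans e]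
    clear e h h1 h2
    grind
  · rename_i b c m i
    have e := h.inv_entry' h1 h2 b i j c m n
    simp only [Finset.sum_mul, Finset.mul_sum]
    rw [Finset.sum_comm (f := fun q p => ∑ d, R (p, q) (m, n) * _)]
    simpa only [mul_comm _ (R _ _)] using e

/-- The matrix of functionals `⟨·, T⟩⁻, ⟨·, E⟩⁻` on `Y₊`. -/
def minusHom (h : YangBaxterEquation R) (h1 : R * S = 1) (h2 : S * R = 1) :
    YMinus R →ₐ[k] WithConv (YPlus R →ₗ[k] k) :=
  YMinus.lift (fun j n => entry (plusRep h h1 h2) n j)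
    (fun j => entry (plusRepExt h h1 h2) (some j) none)
    (by
      intro i j m n
      ext x
      have e := congrFun (congrFun (tensorRep_mul_plusIntertwiner h h1 h2 x) (some m, n))
        (j, some i)
      have hb : ∀ m i, entry (plusRepExt h h1 h2) (some m) (some i) = entry (plusRep h h1 h2) m i :=
        fun m i => by ext x; exact (plusRepExt_blocks h h1 h2 x).1 m i
      simp only [Matrix.mul_apply, Fintype.sum_prod_type, tensorRep_apply, Fintype.sum_option,
        plusIntertwiner, Matrix.of_apply, hb] at e
      simp [-LinearMap.convMul_apply] at e ⊢
      rw [Finset.sum_comm (f := fun p q => R (p, q) (m, n) * _)]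
      simpa only [mul_comm _ (R _ _)] using e)
    (by
      intro j m n
      ext x
      have e := congrFun (congrFun (tensorRep_mul_plusIntertwiner h h1 h2 x) (some m, n)) (j, none)
      simp only [Matrix.mul_apply, Fintype.sum_prod_type, tensorRep_apply, Fintype.sum_option,
        plusIntertwiner, Matrix.of_apply] at e
      simp [-LinearMap.convMul_apply] at e ⊢
      rw [Finset.sum_comm]
      simpa only [mul_comm _ (R _ _)] using e)

theorem minusHom_t (h : YangBaxterEquation R) (h1 : R * S = 1) (h2 : S * R = 1) (j n : ι) :
    minusHom h h1 h2 (YMinus.t R j n) = entry (plusRep h h1 h2) n j := YMinus.lift_t ..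

theorem minusHom_E (h : YangBaxterEquation R) (h1 : R * S = 1) (h2 : S * R = 1) (j : ι) :
    minusHom h h1 h2 (YMinus.E R j) = entry (plusRepExt h h1 h2) (some j) none := YMinus.lift_E ..

theorem minusHom_mat_apply (h : YangBaxterEquation R) (h1 : R * S = 1) (h2 : S * R = 1)
    (i j : Option ι) (x : YPlus R) :
    minusHom h h1 h2 (YMinus.mat R i j) x = plusRepExt h h1 h2 x j i := by
  obtain ⟨e1, e2, e3⟩ := plusRepExt_blocks h h1 h2 x
  cases i <;> cases j <;> simp [YMinus.mat, minusHom_t, minusHom_E, e1, e2, e3]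

theorem exists_oppositeSkewPairing (h : YangBaxterEquation R) (h1 : R * S = 1) (h2 : S * R = 1) :
    ∃ Q : YPlus R →ₗ[k] YMinus R →ₗ[k] k,
      IsOppositeSkewPairing Q ∧ HasGeneratorValues R S (-1) Q := by
  refine ⟨(formOfHom (minusHom h h1 h2)).flip, isOppositeSkewPairing_iff_flip.2
    (isSkewPairing_formOfHom _ (YMinus.isMatrixCoalgebra R) (YMinus.adjoin_mat R) ?_ ?_), ?_⟩
  · intro i j
    simp [minusHom_mat_apply, Matrix.one_apply, eq_comm]
  · intro i j a b
    simp only [minusHom_mat_apply, map_mul, Matrix.mul_apply]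
    exact Finset.sum_congr rfl fun _ _ => mul_comm _ _
  · constructor <;> intros <;>
      simp [formOfHom_apply, minusHom_t, minusHom_E, plusRep_u, plusRep_F, plusRepExt_u,
        plusRepExt_F, Matrix.one_apply, YPlus.counit_u, YPlus.counit_F, eq_comm]

end MinusForm

/-! ### Uniqueness, and inverseness of the two pairings -/

section Values

variable {k ι : Type*} [CommRing k] [Fintype ι] [DecidableEq ι] {R M : Matrix (ι × ι) (ι × ι) k}
  {c : k} {P P' : YPlus R →ₗ[k] YMinus R →ₗ[k] k}

theorem HasGeneratorValues.mat_eq (h : HasGeneratorValues R M c P)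
    (h' : HasGeneratorValues R M c P') (h1 : P 1 1 = P' 1 1) (i j p q : Option ι) :
    P (YPlus.mat R i j) (YMinus.mat R p q) = P' (YPlus.mat R i j) (YMinus.mat R p q) := by
  cases i <;> cases j <;> cases p <;> cases q <;>
    simp [YPlus.mat, YMinus.mat, h.u_t, h'.u_t, h.one_t, h'.one_t, h.u_one, h'.u_one, h.F_E,
      h'.F_E, h.u_E, h'.u_E, h.F_t, h'.F_t, h.one_E, h'.one_E, h.F_one, h'.F_one, h1]

theorem IsSkewPairing.eq_of_hasGeneratorValues (hP : IsSkewPairing P) (hP' : IsSkewPairing P')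
    (h : HasGeneratorValues R M c P) (h' : HasGeneratorValues R M c P') : P = P' := by
  refine hP.ext_of_generators hP' (YPlus.isMatrixCoalgebra R) (YPlus.adjoin_mat R)
    (YMinus.adjoin_mat R) ?_
  rintro i j _ ⟨⟨p, q⟩, rfl⟩
  -- The value at `(1, 1)` is not among the prescribed ones; it is `ε(1)` for both pairings.
  exact h.mat_eq h' (by rw [hP.one_left, hP'.one_left]) i j p q

theorem IsOppositeSkewPairing.eq_of_hasGeneratorValues (hP : IsOppositeSkewPairing P)
    (hP' : IsOppositeSkewPairing P') (h : HasGeneratorValues R M c P)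
    (h' : HasGeneratorValues R M c P') : P = P' := by
  have e : P.flip = P'.flip := by
    refine (isOppositeSkewPairing_iff_flip.1 hP).ext_of_generators
      (isOppositeSkewPairing_iff_flip.1 hP') (YMinus.isMatrixCoalgebra R) (YMinus.adjoin_mat R)
      (YPlus.adjoin_mat R) ?_
    rintro p q _ ⟨⟨i, j⟩, rfl⟩
    exact h.mat_eq h' (by rw [hP.one_left, hP'.one_left]) i j p q
  rw [← P.flip_flip, e, P'.flip_flip]

/-- On `U` and `T` the condition is that `S` inverts `R`; on `F` and `E` the values `1` and `-1`
cancel. -/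
theorem isConvolutionInverse_of_hasGeneratorValues {S : Matrix (ι × ι) (ι × ι) k}
    (h1 : R * S = 1) (h2 : S * R = 1) {P Q : YPlus R →ₗ[k] YMinus R →ₗ[k] k}
    (hP : IsSkewPairing P) (hQ : IsOppositeSkewPairing Q) (vP : HasGeneratorValues R R 1 P)
    (vQ : HasGeneratorValues R S (-1) Q) : IsConvolutionInverse Q P := by
  have e1 := fun i j m n => congrFun (congrFun h1 (i, j)) (m, n)
  have e2 := fun i j m n => congrFun (congrFun h2 (i, j)) (m, n)
  simp only [Matrix.mul_apply, Fintype.sum_prod_type, Matrix.one_apply, Prod.mk.injEq] at e1 e2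
  refine isConvolutionInverse_of_generators hP hQ (YPlus.isMatrixCoalgebra R) (YPlus.adjoin_mat R)
    (YMinus.adjoin_mat R) ?_ ?_
  all_goals
    rintro i j _ ⟨⟨p, q⟩, rfl⟩
    simp only [ofConv_sum, LinearMap.sum_apply, LinearMap.convMul_apply]
    cases i <;> cases j <;> cases p <;> cases q <;>
      simp [YPlus.mat, YMinus.mat, YMinus.comul_t, YMinus.comul_E, YMinus.counit_t,
        YMinus.counit_E, vP.u_t, vP.one_t, vP.u_one, vP.F_E, vP.u_E, vP.F_t, vP.one_E, vP.F_one,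
        vQ.u_t, vQ.one_t, vQ.u_one, vQ.F_E, vQ.u_E, vQ.F_t, vQ.one_E, vQ.F_one, hP.one_left,
        hQ.one_left, e1, e2, Algebra.TensorProduct.one_def]
  all_goals split_ifs <;> simp_all

end Values

/-! ### Recognising a double crossproduct from an action -/

section DoubleCrossproduct

variable {k H A D : Type*} [CommRing k] [Ring H] [Bialgebra k H] [Ring A] [Bialgebra k A]
  [Ring D] [Bialgebra k D]

/-- The coalgebra homomorphism `a ⊗ x ↦ f(a) g(x)`. -/
def mulMap (f : A →ₐc[k] D) (g : H →ₐc[k] D) : A ⊗[k] H →ₗc[k] D :=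
  (Bialgebra.mulCoalgHom k D).comp (Coalgebra.TensorProduct.map (f : A →ₗc[k] D) (g : H →ₗc[k] D))

@[simp] theorem mulMap_tmul (f : A →ₐc[k] D) (g : H →ₐc[k] D) (a : A) (x : H) :
    mulMap f g (a ⊗ₜ x) = f a * g x := rfl

theorem mulMap_map_mulLeft_mulRight (f : A →ₐc[k] D) (g : H →ₐc[k] D) (a : A) (y : H)
    (z : A ⊗[k] H) :
    mulMap f g (TensorProduct.map (LinearMap.mulLeft k a) (LinearMap.mulRight k y) z) =
      f a * mulMap f g z * g y := by
  induction z with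
  | zero => simp
  | add z w hz hw => simp only [map_add, hz, hw, mul_add, add_mul]
  | tmul b x => simp [mul_assoc]

variable {Q P : H →ₗ[k] A →ₗ[k] k} {f : A →ₐc[k] D} {g : H →ₐc[k] D}
  {hQ : IsOppositeSkewPairing Q} {hP : IsSkewPairing P} {ψ : D →ₐ[k] Module.End k (A ⊗[k] H)}

/-- An algebra acting on `A ⊗ H` by extending the actions of `A` and `H` contains `A ⊗ H`. -/
theorem apply_mulMap_one_tmul_one (hf : ∀ a, ψ (f a) = leftMulOp k H A a)
    (hg : ∀ x, ψ (g x) = crossOp hQ hP x) (z : A ⊗[k] H) : ψ (mulMap f g z) (1 ⊗ₜ 1) = z := by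
  induction z with
  | zero => simp
  | add z w hz hw => simp [hz, hw]
  | tmul a x => simp [hf, hg, crossOp_one_tmul]

theorem mulMap_injective (hf : ∀ a, ψ (f a) = leftMulOp k H A a)
    (hg : ∀ x, ψ (g x) = crossOp hQ hP x) : Function.Injective (mulMap f g) :=
  Function.LeftInverse.injective (g := fun d => ψ d (1 ⊗ₜ 1)) (apply_mulMap_one_tmul_one hf hg)

theorem injective_of_extends_leftMulOp (hf : ∀ a, ψ (f a) = leftMulOp k H A a) :
    Function.Injective f :=
  Function.LeftInverse.injective (g := fun d => fstProj (ψ d (1 ⊗ₜ 1))) fun a => by simp [hf]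

theorem injective_of_extends_crossOp (hg : ∀ x, ψ (g x) = crossOp hQ hP x) :
    Function.Injective g :=
  Function.LeftInverse.injective (g := fun d => sndProj (ψ d (1 ⊗ₜ 1))) fun x => by
    simp [hg, crossOp_one_tmul]

/-- The product formula comes down to the straightening of `g x * f b`. Surjectivity writes this
element as the image of some `z`, and its action on `1 ⊗ 1` computes `z` as `crossMap Q P x b`. -/
theorem isDoubleCrossproduct_ofBijective (h : IsConvolutionInverse Q P)
    (hf : ∀ a, ψ (f a) = leftMulOp k H A a) (hg : ∀ x, ψ (g x) = crossOp hQ hP x)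
    (hb : Function.Bijective (mulMap f g)) :
    IsDoubleCrossproduct (leftAction Q P) (rightAction Q P) (CoalgEquiv.ofBijective hb) where
  map_one := by simp
  map_mul a x b y := by
    have e : mulMap f g (crossMap Q P x b) = g x * f b := by
      obtain ⟨z, hz⟩ := hb.2 (g x * f b)
      rw [← crossOp_tmul_one h hQ hP, ← hz, ← apply_mulMap_one_tmul_one hf hg z, hz, map_mul, hf,
        hg]
      simp
    have e' := mulMap_map_mulLeft_mulRight f g a y (crossMap Q P x b)
    rw [e] at e'
    simp only [CoalgEquiv.coe_ofBijective]
    refine Eq.trans ?_ e'.symm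
    simp [mul_assoc]

end DoubleCrossproduct

/-! ### Reordering products of subspaces -/

section Span

variable {k D : Type*} [CommRing k] [Ring D] [Algebra k D]

/-- Induction along the subalgebra `N` generated by `s`: if `x` and `y` can each be moved to the
left of `V`, then `V x y ⊆ N V y ⊆ N N V = N V`. The induction hypothesis must hold for all `v ∈ V`
at once. -/
theorem mul_adjoin_le {V : Submodule k D} {s : Set D}
    (h : ∀ v ∈ V, ∀ a ∈ s, v * a ∈ Subalgebra.toSubmodule (Algebra.adjoin k s) * V) :
    V * Subalgebra.toSubmodule (Algebra.adjoin k s) ≤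
      Subalgebra.toSubmodule (Algebra.adjoin k s) * V := by
  set N := Subalgebra.toSubmodule (Algebra.adjoin k s) with hN
  have hmul : N * N = N := Subalgebra.isIdempotentElem_toSubmodule _
  rw [Submodule.mul_le]
  intro v hv a ha
  have ha' : a ∈ Algebra.adjoin k s := ha
  induction ha' using Algebra.adjoin_induction generalizing v with
  | mem x hx => exact h v hv x hx
  | algebraMap c =>
    rw [← Algebra.commutes]
    exact Submodule.mul_mem_mul (algebraMap_mem (Algebra.adjoin k s) c) hv
  | add x y hx hy ihx ihy =>
    rw [mul_add]
    exact add_mem (ihx v hv hx) (ihy v hv hy)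
  | mul x y hx hy ihx ihy =>
    have e : N * V * Submodule.span k {y} ≤ N * V := by
      rw [mul_assoc]
      calc N * (V * Submodule.span k {y}) ≤ N * (N * V) := by
            refine mul_le_mul' le_rfl ?_
            rw [Submodule.mul_le]
            intro w hw z hz
            obtain ⟨c, rfl⟩ := Submodule.mem_span_singleton.1 hz
            rw [mul_smul_comm]
            exact Submodule.smul_mem _ c (ihy w hw hy)
        _ = N * V := by rw [← mul_assoc, hmul]
    rw [← mul_assoc]
    exact e (Submodule.mul_mem_mul (ihx v hv hx) (Submodule.mem_span_singleton_self y))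

/-- Solves the relations in which `R` multiplies the products to be reordered. -/
theorem mem_of_sum_smul_mem {J : Type*} [Fintype J] [DecidableEq J] {R S : Matrix J J k}
    (h : S * R = 1) (w : J → D) (N : Submodule k D) (hN : ∀ p, ∑ q, R p q • w q ∈ N) (p : J) :
    w p ∈ N := by
  have e : w p = ∑ r, S p r • ∑ q, R r q • w q := by
    simp only [Finset.smul_sum, smul_smul]
    rw [Finset.sum_comm]
    simp only [← Finset.sum_smul, ← Matrix.mul_apply, h]
    simp [Matrix.one_apply]
  rw [e]
  exact sum_mem fun r _ => N.smul_mem _ (hN r)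

end Span

/-! ### The maps into `Y` and the surjectivity of multiplication -/

section YB

variable {k ι : Type*} [CommRing k] [Fintype ι] (R : Matrix (ι × ι) (ι × ι) k)

theorem YB.subalgebra_eq_top {S : Subalgebra k (YB R)} (ht : ∀ i j, YB.t R i j ∈ S)
    (hE : ∀ i, YB.E R i ∈ S) (hu : ∀ i j, YB.u R i j ∈ S) (hF : ∀ i, YB.F R i ∈ S) : S = ⊤ := by
  let f : YB R →ₐ[k] S := YB.lift (fun i j => ⟨YB.t R i j, ht i j⟩) (fun i => ⟨YB.E R i, hE i⟩)
    (fun i j => ⟨YB.u R i j, hu i j⟩) (fun i => ⟨YB.F R i, hF i⟩)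
    (fun i j m n => Subtype.ext (by simpa using YB.rel_tt R i j m n))
    (fun i j m => Subtype.ext (by simpa using YB.rel_et R i j m))
    (fun i j m n => Subtype.ext (by simpa using YB.rel_uu R i j m n))
    (fun i j m => Subtype.ext (by simpa using YB.rel_fu R i j m))
    (fun i j m n => Subtype.ext (by simpa using YB.rel_ut R i j m n))
    (fun i j m => Subtype.ext (by simpa using YB.rel_tf R i j m))
    (fun i j => Subtype.ext (by simpa using YB.rel_ef R i j))
    (fun i j m => Subtype.ext (by simpa using YB.rel_ue R i j m))
  have e : S.val.comp f = AlgHom.id k _ :=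
    YB.algHom_ext (fun i j => congrArg S.val (YB.lift_t ..))
      (fun i => congrArg S.val (YB.lift_E ..)) (fun i j => congrArg S.val (YB.lift_u ..))
      (fun i => congrArg S.val (YB.lift_F ..))
  refine eq_top_iff.2 fun x _ => ?_
  have := DFunLike.congr_fun e x
  rw [← show S.val (f x) = x from this]
  exact (f x).2

/-- The homomorphism `Y₋ → Y`, as a homomorphism of algebras. -/
def minusInclAlg : YMinus R →ₐ[k] YB R :=
  YMinus.lift (YB.t R) (YB.E R) (YB.rel_tt R) (YB.rel_et R)

/-- The homomorphism `Y₊ → Y`, as a homomorphism of algebras. -/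
def plusInclAlg : YPlus R →ₐ[k] YB R :=
  YPlus.lift (YB.u R) (YB.F R) (YB.rel_uu R) (YB.rel_fu R)

@[simp] theorem minusInclAlg_t (i j : ι) : minusInclAlg R (YMinus.t R i j) = YB.t R i j :=
  YMinus.lift_t ..

@[simp] theorem minusInclAlg_E (i : ι) : minusInclAlg R (YMinus.E R i) = YB.E R i :=
  YMinus.lift_E ..

@[simp] theorem plusInclAlg_u (i j : ι) : plusInclAlg R (YPlus.u R i j) = YB.u R i j :=
  YPlus.lift_u ..

@[simp] theorem plusInclAlg_F (i : ι) : plusInclAlg R (YPlus.F R i) = YB.F R i :=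
  YPlus.lift_F ..

variable [DecidableEq ι]

/-- The homomorphism `Y₋ → Y`. -/
def minusIncl : YMinus R →ₐc[k] YB R :=
  BialgHom.ofAlgHom (minusInclAlg R)
    (YMinus.algHom_ext (by simp [YMinus.counit_t, YB.counit_t])
      (by simp [YMinus.counit_E, YB.counit_E]))
    (YMinus.algHom_ext (by simp [YMinus.comul_t, YB.comul_t])
      (by simp [YMinus.comul_E, YB.comul_E]))

/-- The homomorphism `Y₊ → Y`. -/
def plusIncl : YPlus R →ₐc[k] YB R :=
  BialgHom.ofAlgHom (plusInclAlg R)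
    (YPlus.algHom_ext (by simp [YPlus.counit_u, YB.counit_u])
      (by simp [YPlus.counit_F, YB.counit_F]))
    (YPlus.algHom_ext (by simp [YPlus.comul_u, YB.comul_u])
      (by simp [YPlus.comul_F, YB.comul_F]))

@[simp] theorem minusIncl_t (i j : ι) : minusIncl R (YMinus.t R i j) = YB.t R i j :=
  minusInclAlg_t R i j

@[simp] theorem minusIncl_E (i : ι) : minusIncl R (YMinus.E R i) = YB.E R i :=
  minusInclAlg_E R i

@[simp] theorem plusIncl_u (i j : ι) : plusIncl R (YPlus.u R i j) = YB.u R i j :=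
  plusInclAlg_u R i j

@[simp] theorem plusIncl_F (i : ι) : plusIncl R (YPlus.F R i) = YB.F R i :=
  plusInclAlg_F R i

-- The cross relations give `V L ⊆ L V`, with `L` generated by `T, E` and `V` spanned by `1, U, F`.
-- With `M` the image of `Y₊`, the space `L M` is then stable under left multiplication by all
-- generators of `Y` and contains `1`, so it is all of `Y`.
variable {R} in
theorem mulMap_incl_surjective {S : Matrix (ι × ι) (ι × ι) k} (h : S * R = 1) :
    Function.Surjective (mulMap (minusIncl R) (plusIncl R)) := by
  let s : Set (YB R) := Set.range (fun p : ι × ι => YB.t R p.1 p.2) ∪ Set.range (YB.E R)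
  -- The element `1` is needed because `F E = E F - T · 1 + 1 · U` has terms of lower degree.
  let V : Submodule k (YB R) := Submodule.span k
    (insert 1 (Set.range (fun p : ι × ι => YB.u R p.1 p.2) ∪ Set.range (YB.F R)))
  let L : Submodule k (YB R) := Subalgebra.toSubmodule (Algebra.adjoin k s)
  let M : Submodule k (YB R) := Subalgebra.toSubmodule (plusInclAlg R).range
  have hLL : L * L = L := Subalgebra.isIdempotentElem_toSubmodule _
  have hMM : M * M = M := Subalgebra.isIdempotentElem_toSubmodule _
  have h1V : (1 : YB R) ∈ V := Submodule.subset_span (Or.inl rfl)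
  have huV : ∀ i j, YB.u R i j ∈ V := fun i j => Submodule.subset_span (Or.inr (Or.inl ⟨(i, j), rfl⟩))
  have hFV : ∀ i, YB.F R i ∈ V := fun i => Submodule.subset_span (Or.inr (Or.inr ⟨i, rfl⟩))
  have h1L : (1 : YB R) ∈ L := one_mem (Algebra.adjoin k s)
  have htL : ∀ i j, YB.t R i j ∈ L := fun i j => Algebra.subset_adjoin (Or.inl ⟨(i, j), rfl⟩)
  have hEL : ∀ i, YB.E R i ∈ L := fun i => Algebra.subset_adjoin (Or.inr ⟨i, rfl⟩)
  have hut : ∀ i m j n, YB.u R i m * YB.t R j n ∈ L * V := by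
    intro i m j n
    refine mem_of_sum_smul_mem h (fun p => YB.u R p.1 m * YB.t R p.2 n) (L * V) (fun p => ?_) (i, j)
    rw [Fintype.sum_prod_type]
    have e := YB.rel_ut R p.1 p.2 m n
    rw [show ∑ a, ∑ b, R p (a, b) • (YB.u R a m * YB.t R b n) = _ from e]
    exact sum_mem fun a _ => sum_mem fun b _ => Submodule.smul_mem _ _
      (Submodule.mul_mem_mul (htL _ _) (huV _ _))
  have hFt : ∀ i j n, YB.F R i * YB.t R j n ∈ L * V := by
    intro i j n
    refine mem_of_sum_smul_mem h (fun p => YB.F R p.1 * YB.t R p.2 n) (L * V) (fun p => ?_) (i, j)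
    rw [Fintype.sum_prod_type]
    have e := YB.rel_tf R p.1 p.2 n
    rw [show ∑ a, ∑ b, R p (a, b) • (YB.F R a * YB.t R b n) = _ from e.symm]
    exact Submodule.mul_mem_mul (htL _ _) (hFV _)
  have huE : ∀ i m n, YB.u R i m * YB.E R n ∈ L * V := by
    intro i m n
    rw [YB.rel_ue R i m n]
    exact sum_mem fun a _ => sum_mem fun b _ => Submodule.smul_mem _ _
      (Submodule.mul_mem_mul (hEL _) (huV _ _))
  have hFE : ∀ i j, YB.F R i * YB.E R j ∈ L * V := by
    intro i j
    rw [show YB.F R i * YB.E R j = YB.E R j * YB.F R i - YB.t R i j * 1 + 1 * YB.u R i j by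
      have e := YB.rel_ef R i j
      rw [mul_one, one_mul, sub_add, ← e, sub_sub_cancel]]
    exact add_mem (sub_mem (Submodule.mul_mem_mul (hEL _) (hFV _))
      (Submodule.mul_mem_mul (htL _ _) h1V)) (Submodule.mul_mem_mul h1L (huV _ _))
  have hVL : V * L ≤ L * V := by
    refine mul_adjoin_le fun v hv a ha => ?_
    induction hv using Submodule.span_induction with
    | mem v hv =>
      rcases hv with rfl | ⟨p, rfl⟩ | ⟨i, rfl⟩
      · rw [one_mul, ← mul_one a]
        exact Submodule.mul_mem_mul (Algebra.subset_adjoin ha) h1V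
      · rcases ha with ⟨q, rfl⟩ | ⟨j, rfl⟩
        · exact hut _ _ _ _
        · exact huE _ _ _
      · rcases ha with ⟨q, rfl⟩ | ⟨j, rfl⟩
        · exact hFt _ _ _
        · exact hFE _ _
    | zero => simp
    | add v w _ _ hv hw => rw [add_mul]; exact add_mem hv hw
    | smul c v _ hv => rw [smul_mul_assoc]; exact Submodule.smul_mem _ _ hv
  have hVM : V ≤ M := by
    refine Submodule.span_le.2 ?_
    rintro _ (rfl | ⟨p, rfl⟩ | ⟨i, rfl⟩)
    · exact one_mem (plusInclAlg R).range
    · exact ⟨YPlus.u R p.1 p.2, plusInclAlg_u ..⟩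
    · exact ⟨YPlus.F R i, plusInclAlg_F ..⟩
  have hL : L * (L * M) ≤ L * M := by rw [← mul_assoc, hLL]
  have hV : V * (L * M) ≤ L * M := by
    calc V * (L * M) = V * L * M := (mul_assoc _ _ _).symm
      _ ≤ L * V * M := mul_le_mul' hVL le_rfl
      _ ≤ L * M * M := mul_le_mul' (mul_le_mul' le_rfl hVM) le_rfl
      _ = L * M := by rw [mul_assoc, hMM]
  -- The elements that preserve `L M` under left multiplication form a subalgebra, so the generators
  -- suffice.
  let T : Subalgebra k (YB R) :=
    { carrier := {d | ∀ n ∈ L * M, d * n ∈ L * M}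
      mul_mem' := fun ha hb n hn => by rw [mul_assoc]; exact ha _ (hb n hn)
      add_mem' := fun ha hb n hn => by rw [add_mul]; exact add_mem (ha n hn) (hb n hn)
      algebraMap_mem' := fun c n hn => by
        rw [← Algebra.smul_def]
        exact Submodule.smul_mem _ _ hn }
  have hT : T = ⊤ := YB.subalgebra_eq_top R
    (fun i j n hn => hL (Submodule.mul_mem_mul (htL i j) hn))
    (fun i n hn => hL (Submodule.mul_mem_mul (hEL i) hn))
    (fun i j n hn => hV (Submodule.mul_mem_mul (huV i j) hn))
    (fun i n hn => hV (Submodule.mul_mem_mul (hFV i) hn))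
  have hLm : L ≤ Subalgebra.toSubmodule (minusInclAlg R).range := by
    refine Algebra.adjoin_le ?_
    rintro _ (⟨p, rfl⟩ | ⟨i, rfl⟩)
    · exact ⟨YMinus.t R p.1 p.2, minusInclAlg_t ..⟩
    · exact ⟨YMinus.E R i, minusInclAlg_E ..⟩
  have hr : L * M ≤ LinearMap.range (mulMap (minusIncl R) (plusIncl R)).toLinearMap := by
    rw [Submodule.mul_le]
    rintro a ha b ⟨y, rfl⟩
    obtain ⟨z, rfl⟩ := hLm ha
    exact ⟨z ⊗ₜ y, rfl⟩
  intro d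
  have hd : d ∈ T := hT ▸ Algebra.mem_top
  have := hd 1 (by
    rw [← mul_one (1 : YB R)]
    exact Submodule.mul_mem_mul h1L (one_mem (plusInclAlg R).range))
  rw [mul_one] at this
  exact hr this

end YB

/-! ### The action of `Y` on `Y₋ ⊗ Y₊` -/

section Representation

variable {k ι : Type*} [CommRing k] [Fintype ι] [DecidableEq ι] {R : Matrix (ι × ι) (ι × ι) k}
  {Q P : YPlus R →ₗ[k] YMinus R →ₗ[k] k}

/-- Convolving the exchange rule with `P` on the left removes `Q` and leaves `P * crossOp *
leftMulOp = leftMulOp * crossOp * P`, here evaluated on the two matrix coalgebras. -/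
theorem crossOp_mul_leftMulOp_mat (h : IsConvolutionInverse Q P) (hQ : IsOppositeSkewPairing Q)
    (hP : IsSkewPairing P) (i j p q : Option ι) :
    ∑ c, ∑ d, P (YPlus.mat R i c) (YMinus.mat R p d) •
        (crossOp hQ hP (YPlus.mat R c j) * leftMulOp k _ _ (YMinus.mat R d q)) =
      ∑ c, ∑ d, P (YPlus.mat R c j) (YMinus.mat R d q) •
        (leftMulOp k _ _ (YMinus.mat R p d) * crossOp hQ hP (YPlus.mat R i c)) := by
  have e := congrArg (scal _ P * ·) (onLeft_crossOp_mul hQ hP)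
  simp only [← mul_assoc] at e
  rw [scal_mul_scal_eq_one' h, one_mul, mul_assoc] at e
  have e' := LinearMap.congr_fun (congrArg ofConv e) (YPlus.mat R i j ⊗ₜ YMinus.mat R p q)
  let r : Coalgebra.Repr k (YPlus.mat R i j) (Option ι) :=
    ⟨Finset.univ, _, _, ((YPlus.isMatrixCoalgebra R).comul_eq i j).symm⟩
  let s : Coalgebra.Repr k (YMinus.mat R p q) (Option ι) :=
    ⟨Finset.univ, _, _, ((YMinus.isMatrixCoalgebra R).comul_eq p q).symm⟩
  simp only [conv_tmul _ _ r s, onRight_mul_onLeft_tmul, onLeft_mul_onRight_tmul] at e'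
  simpa only [r, s, scal_tmul, ← Algebra.commutes, ← Algebra.smul_def, AlgHom.toLinearMap_apply]
    using e'

/-- Each cross relation is one choice of blocks in the preceding identity. In the block of `F` and
`E`, the value `⟨F, E⟩ = 1` produces the terms `T` and `U`. -/
theorem crossRelations_crossOp (h : IsConvolutionInverse Q P) (hQ : IsOppositeSkewPairing Q)
    (hP : IsSkewPairing P) (vP : HasGeneratorValues R R 1 P) :
    CrossRelations R (fun i j => leftMulOp k (YPlus R) _ (YMinus.t R i j))
      (fun i => leftMulOp k (YPlus R) _ (YMinus.E R i))
      (fun i j => crossOp hQ hP (YPlus.u R i j)) (fun i => crossOp hQ hP (YPlus.F R i)) where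
  ut i j m n := by
    have e := crossOp_mul_leftMulOp_mat h hQ hP (some i) (some m) (some j) (some n)
    simpa [YPlus.mat, YMinus.mat, vP.u_t, vP.F_t] using e
  tf i j n := by
    have e := crossOp_mul_leftMulOp_mat h hQ hP (some i) none (some j) (some n)
    simpa [YPlus.mat, YMinus.mat, vP.u_t, vP.F_t, vP.one_t] using e.symm
  ef i j := by
    have e := crossOp_mul_leftMulOp_mat h hQ hP (some i) none none (some j)
    simp [YPlus.mat, YMinus.mat, vP.u_one, vP.u_E, vP.one_t, vP.one_E, vP.F_one, vP.F_E,
      vP.F_t, Finset.sum_add_distrib] at e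
    exact sub_eq_sub_iff_add_eq_add.2 ((add_comm _ _).trans (e.symm.trans (add_comm _ _)))
  ue i m n := by
    have e := crossOp_mul_leftMulOp_mat h hQ hP (some i) (some m) none (some n)
    simpa [YPlus.mat, YMinus.mat, vP.u_t, vP.u_one, vP.u_E, vP.F_one, vP.F_E] using e

/-- An algebra containing compatible images of `Y₋` and `Y₊` receives a homomorphism from `Y`. -/
theorem exists_algHom_incl {B : Type*} [Ring B] [Algebra k B] (φ : YMinus R →ₐ[k] B)
    (χ : YPlus R →ₐ[k] B) (c : CrossRelations R (fun i j => φ (YMinus.t R i j))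
      (fun i => φ (YMinus.E R i)) (fun i j => χ (YPlus.u R i j)) (fun i => χ (YPlus.F R i))) :
    ∃ ψ : YB R →ₐ[k] B, (∀ a, ψ (minusIncl R a) = φ a) ∧ ∀ x, ψ (plusIncl R x) = χ x := by
  let ψ : YB R →ₐ[k] B := YB.lift (fun i j => φ (YMinus.t R i j)) (fun i => φ (YMinus.E R i))
    (fun i j => χ (YPlus.u R i j)) (fun i => χ (YPlus.F R i)) ((YMinus.rel_tt R).map φ)
    ((YMinus.rel_et R).map φ) ((YPlus.rel_uu R).map χ) ((YPlus.rel_fu R).map χ) c.ut c.tf c.ef c.ue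
  have e1 : ψ.comp (minusInclAlg R) = φ :=
    YMinus.algHom_ext (fun i j => (congrArg ψ (minusInclAlg_t R i j)).trans (YB.lift_t ..))
      (fun i => (congrArg ψ (minusInclAlg_E R i)).trans (YB.lift_E ..))
  have e2 : ψ.comp (plusInclAlg R) = χ :=
    YPlus.algHom_ext (fun i j => (congrArg ψ (plusInclAlg_u R i j)).trans (YB.lift_u ..))
      (fun i => (congrArg ψ (plusInclAlg_F R i)).trans (YB.lift_F ..))
  exact ⟨ψ, DFunLike.congr_fun e1, DFunLike.congr_fun e2⟩

end Representation

end YangBaxter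

end

open scoped TensorProduct in
open YangBaxter in
/-- Let `R` be an invertible solution of the Yang-Baxter equation. The skew pairing `P` of `Y₊`, `Y₋`
with `⟨U, T⟩ = R`, `⟨F, E⟩ = 1` and the opposite skew pairing `Q` with `⟨U, T⟩⁻ = R⁻¹`,
`⟨F, E⟩⁻ = -1` exist and are unique, `Q` is the convolution inverse of `P`, the resulting actions
make `(Y₋, Y₊)` a matched pair of bialgebras, and its double crossproduct is the bialgebra `Y`
presented by the relations of `Y₋`, of `Y₊` and the cross relations; `Y₋` and `Y₊` embed in `Y`. -/
theorem mainTheorem3 (n : ℕ) (R : Matrix (Fin n × Fin n) (Fin n × Fin n) ℂ)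
    (hR : IsUnit R) (hYB : YangBaxterEquation R) :
    (∃! P : YPlus R →ₗ[ℂ] YMinus R →ₗ[ℂ] ℂ, IsSkewPairing P ∧ HasGeneratorValues R R 1 P) ∧
    (∃! Q : YPlus R →ₗ[ℂ] YMinus R →ₗ[ℂ] ℂ,
      IsOppositeSkewPairing Q ∧ HasGeneratorValues R R⁻¹ (-1) Q) ∧
    ∀ P Q : YPlus R →ₗ[ℂ] YMinus R →ₗ[ℂ] ℂ,
      IsSkewPairing P → HasGeneratorValues R R 1 P →
      IsOppositeSkewPairing Q → HasGeneratorValues R R⁻¹ (-1) Q →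
      IsConvolutionInverse Q P ∧
      IsMatchedPair (leftAction Q P) (rightAction Q P) ∧
      ∃ (jm : YMinus R →ₐc[ℂ] YB R) (jp : YPlus R →ₐc[ℂ] YB R)
        (θ : YMinus R ⊗[ℂ] YPlus R ≃ₗc[ℂ] YB R),
        (∀ i j, jm (YMinus.t R i j) = YB.t R i j) ∧ (∀ i, jm (YMinus.E R i) = YB.E R i) ∧
        (∀ i j, jp (YPlus.u R i j) = YB.u R i j) ∧ (∀ i, jp (YPlus.F R i) = YB.F R i) ∧
        Function.Injective jm ∧ Function.Injective jp ∧
        IsDoubleCrossproduct (leftAction Q P) (rightAction Q P) θ ∧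
        (∀ a x, θ (a ⊗ₜ x) = jm a * jp x) ∧
        CrossRelations R
          (fun i j => θ (YMinus.t R i j ⊗ₜ 1)) (fun i => θ (YMinus.E R i ⊗ₜ 1))
          (fun i j => θ (1 ⊗ₜ YPlus.u R i j)) (fun i => θ (1 ⊗ₜ YPlus.F R i)) := by
  have hdet := (Matrix.isUnit_iff_isUnit_det R).1 hR
  have h1 : R * R⁻¹ = 1 := Matrix.mul_nonsing_inv R hdet
  have h2 : R⁻¹ * R = 1 := Matrix.nonsing_inv_mul R hdet
  refine ⟨?_, ?_, fun P Q hP vP hQ vQ => ?_⟩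
  · obtain ⟨P, hP, vP⟩ := exists_skewPairing hYB
    exact ⟨P, ⟨hP, vP⟩, fun P' h' => h'.1.eq_of_hasGeneratorValues hP h'.2 vP⟩
  · obtain ⟨Q, hQ, vQ⟩ := exists_oppositeSkewPairing hYB h1 h2
    exact ⟨Q, ⟨hQ, vQ⟩, fun Q' h' => h'.1.eq_of_hasGeneratorValues hQ h'.2 vQ⟩
  have h := isConvolutionInverse_of_hasGeneratorValues h1 h2 hP hQ vP vQ
  refine ⟨h, isMatchedPair h hQ hP, ?_⟩
  -- This action of `Y` on `Y₋ ⊗ Y₊` supplies all the injectivity statements and the product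
  -- formula.
  obtain ⟨ψ, hm, hp⟩ := exists_algHom_incl (leftMulOp ℂ (YPlus R) (YMinus R)) (crossOp hQ hP)
    (crossRelations_crossOp h hQ hP vP)
  have hb : Function.Bijective (mulMap (minusIncl R) (plusIncl R)) :=
    ⟨mulMap_injective hm hp, mulMap_incl_surjective h2⟩
  refine ⟨minusIncl R, plusIncl R, CoalgEquiv.ofBijective hb, minusIncl_t R, minusIncl_E R,
    plusIncl_u R, plusIncl_F R, injective_of_extends_leftMulOp hm, injective_of_extends_crossOp hp,
    isDoubleCrossproduct_ofBijective h hm hp hb, fun a x => mulMap_tmul _ _ a x, ?_⟩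
  simp only [CoalgEquiv.coe_ofBijective, mulMap_tmul, map_one, mul_one, one_mul, minusIncl_t,
    minusIncl_E, plusIncl_u, plusIncl_F]
  exact ⟨YB.rel_ut R, YB.rel_tf R, YB.rel_ef R, YB.rel_ue R⟩
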